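/- Let $q_1,q_2\in L_2(0,1/2)$ be real-valued, let $h_1,h_2,a_1,a_2\in\mathbb R$ with $a_1>0$, and consider the boundary value problem $L$ with spectral parameter $\lambda^2$: $$-y_j''+q_j(x)y_j=\lambda^2y_j,\quad x\in(0,1/2),\qquad y_j'(0)-h_jy_j(0)=0,\qquad j=1,2,$$ $$y_2(1/2)=a_1y_1(1/2),\qquad y_2'(1/2)+a_1^{-1}y_1'(1/2)+a_2y_1(1/2)=0.$$ (This is the Sturm–Liouville problem on $(0,1)$ with a discontinuity at $d=1/2$.) Assume that all eigenvalues of $L$ are positive, and write them as $\lambda_0^2<\lambda_1^2<\lambda_2^2<\dots$ with $\lambda_n>0$. Let $\varphi_2(x,\lambda)$ be the solution of $-y''+q_2(x)y=\lambda^2y$ on $(0,1/2)$ with $\varphi_2(0,\lambda)=1$, $\varphi_2'(0,\lambda)=h_2$, where the prime denotes the derivative with respect to $x$. Then the system of vector functions $$v_n(x)=\begin{pmatrix}\dfrac1{\lambda_n}\bigl(a_1\varphi_2'(1/2,\lambda_n)+a_2\varphi_2(1/2,\lambda_n)\bigr)\sin(\lambda_nx)\\[2mm] a_1^{-1}\varphi_2(1/2,\lambda_n)\cos(\lambda_nx)\end{pmatrix},\qquad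 n\ge0,$$ is a Riesz basis in the real Hilbert space $H=L_2(0,1/2)\oplus L_2(0,1/2)$ with the inner product $(g,w)_H=\int_0^{1/2}(g_1w_1+g_2w_2)\,dx$; that is, it is the image of an orthonormal basis of $H$ under a bounded linear operator with bounded inverse. -/

import Mathlib

open MeasureTheory Set

noncomputable section

/-- `y` is a (Carathéodory) solution on `[0, d]` of `-y'' + q y = μ y`, with values in `𝕜 = ℝ` or `ℂ`.
The function `y'` is the derivative of `y` on `[0, d]` (one-sided at the end points), it is absolutely
continuous, and the equation, written as `(y')' = (q - μ) y`, holds almost everywhere on `(0, d)`. -/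
structure IsSLSolution {𝕜 : Type*} [RCLike 𝕜] (d : ℝ) (q : ℝ → ℝ) (μ : 𝕜) (y y' : ℝ → 𝕜) :
    Prop where
  hasDeriv : ∀ x ∈ Icc 0 d, HasDerivWithinAt y (y' x) (Icc 0 d) x
  absCont : AbsolutelyContinuousOnInterval y' 0 d
  eqn : ∀ᵐ x ∂(volume.restrict (Ioo 0 d)), HasDerivAt y' (((q x : 𝕜) - μ) * y x) x

/-- `μ` is an eigenvalue of the problem `L(d, q₁, q₂, h₁, h₂, a₁, a₂)`: with `d₁ = d`, `d₂ = 1 - d`,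
there is a pair `(y₁, y₂)`, not identically zero, such that
`-yⱼ'' + qⱼ yⱼ = μ yⱼ` on `(0, dⱼ)`, `yⱼ'(0) - hⱼ yⱼ(0) = 0` for `j = 1, 2`, and
`y₂(d₂) = a₁ y₁(d₁)`, `y₂'(d₂) + a₁⁻¹ y₁'(d₁) + a₂ y₁(d₁) = 0`. -/
def IsSLEigenvalue (d : ℝ) (q₁ q₂ : ℝ → ℝ) (h₁ h₂ a₁ a₂ : ℝ) (μ : ℂ) : Prop :=
  ∃ y₁ y₁' y₂ y₂' : ℝ → ℂ,
    IsSLSolution d q₁ μ y₁ y₁' ∧ IsSLSolution (1 - d) q₂ μ y₂ y₂' ∧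
    y₁' 0 - h₁ * y₁ 0 = 0 ∧ y₂' 0 - h₂ * y₂ 0 = 0 ∧
    y₂ (1 - d) = a₁ * y₁ d ∧
    y₂' (1 - d) + (a₁ : ℂ)⁻¹ * y₁' d + a₂ * y₁ d = 0 ∧
    ((∃ x ∈ Icc 0 d, y₁ x ≠ 0) ∨ (∃ x ∈ Icc 0 (1 - d), y₂ x ≠ 0))

/-- The pair `(φ(·, lam), φ'(·, lam))`, where `φ(·, lam)` is the solution on `[0, d]` of
`-y'' + q y = lam² y` with `φ(0, lam) = 1`, `φ'(0, lam) = h`. For `q` integrable on `(0, d)` this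
pair exists and its restriction to `[0, d]` is unique. -/
def slPhiPair (d : ℝ) (q : ℝ → ℝ) (h lam : ℝ) : (ℝ → ℝ) × (ℝ → ℝ) :=
  Classical.epsilon fun p : (ℝ → ℝ) × (ℝ → ℝ) =>
    IsSLSolution d q (lam ^ 2) p.1 p.2 ∧ p.1 0 = 1 ∧ p.2 0 = h

/-- The value `φ(x, lam)`, for `x ∈ [0, d]`. -/
def slPhi (d : ℝ) (q : ℝ → ℝ) (h x lam : ℝ) : ℝ := (slPhiPair d q h lam).1 x

/-- The value `φ'(x, lam)` of the derivative in `x`, for `x ∈ [0, d]`. -/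
def slPhi' (d : ℝ) (q : ℝ → ℝ) (h x lam : ℝ) : ℝ := (slPhiPair d q h lam).2 x

/-- Lebesgue measure on `(0, d)`. -/
abbrev volIoo (d : ℝ) : Measure ℝ := volume.restrict (Ioo 0 d)

/-- The Hilbert space `L₂(0, d) ⊕ L₂(0, d)` of real-valued vector functions, with the inner product
`(g, w) = ∫ (g₁ w₁ + g₂ w₂)`. -/
abbrev SLSpace (d : ℝ) : Type := WithLp 2 (Lp ℝ 2 (volIoo d) × Lp ℝ 2 (volIoo d))

theorem memLp_const_mul_sin (d c lam : ℝ) :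
    MemLp (fun x : ℝ => c * Real.sin (lam * x)) 2 (volIoo d) := by
  refine MemLp.of_bound (Continuous.aestronglyMeasurable (by fun_prop)) |c| (.of_forall fun x => ?_)
  rw [Real.norm_eq_abs, abs_mul]
  exact mul_le_of_le_one_right (abs_nonneg c) (Real.abs_sin_le_one _)

theorem memLp_const_mul_cos (d c lam : ℝ) :
    MemLp (fun x : ℝ => c * Real.cos (lam * x)) 2 (volIoo d) := by
  refine MemLp.of_bound (Continuous.aestronglyMeasurable (by fun_prop)) |c| (.of_forall fun x => ?_)
  rw [Real.norm_eq_abs, abs_mul]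
  exact mul_le_of_le_one_right (abs_nonneg c) (Real.abs_cos_le_one _)

/-- The vector function with the components
`lam⁻¹ (a₁ φ₂'(1-d, lam) + a₂ φ₂(1-d, lam)) sin (lam x)` and `a₁⁻¹ φ₂(1-d, lam) cos (lam x)`,
as an element of `L₂(0, d) ⊕ L₂(0, d)`. -/
def slVec (d : ℝ) (q₂ : ℝ → ℝ) (h₂ a₁ a₂ lam : ℝ) : SLSpace d :=
  WithLp.toLp 2
    ((memLp_const_mul_sin d
        (1 / lam * (a₁ * slPhi' (1 - d) q₂ h₂ (1 - d) lam
          + a₂ * slPhi (1 - d) q₂ h₂ (1 - d) lam)) lam).toLp _,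
     (memLp_const_mul_cos d (a₁⁻¹ * slPhi (1 - d) q₂ h₂ (1 - d) lam) lam).toLp _)

/-- A family in a Hilbert space is a Riesz basis if it is the image of an orthonormal (Hilbert) basis
under a bounded linear operator with a bounded inverse. -/
def IsRieszBasis (𝕜 : Type*) [RCLike 𝕜] {ι E : Type*} [NormedAddCommGroup E]
    [InnerProductSpace 𝕜 E] (v : ι → E) : Prop :=
  ∃ (e : HilbertBasis ι 𝕜 E) (T : E ≃L[𝕜] E), ∀ i, v i = T (e i)

end

/-! Write d = 1/2 and let Φₙ = (y₁, y₂) be the eigenfunction for λₙ², scaled so that y₂(0) = 1; then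
y₂ = φ₂(·, λₙ). The claim follows from three facts: the Φₙ are orthogonal and complete in H, their
norms lie between two positive constants, and a single bounded invertible operator T sends every Φₙ
to vₙ. Normalizing the Φₙ gives an orthonormal basis, and vₙ is its image under T composed with the
diagonal operator of the norms (`isRieszBasis_of_orthogonal`).

Orthogonality and completeness (`eigenfunctions_orthogonal_complete`) come from self-adjointness:
Lagrange's identity has no boundary terms left under the boundary and interface conditions. Zero is
not an eigenvalue, so there is a compact symmetric Green operator. The spectral theorem makes its
eigenspaces complete, and each nonzero eigenvector is a multiple of some Φₙ, since an eigenfunction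
is determined by y₂(0).

The operator T (`exists_trigonometric_transform`) comes from transmutation started at the
discontinuity. A solution equals the solution of -y'' = λ²y with the same Cauchy data at the base
point, plus a Volterra integral of that free solution whose kernel does not depend on λ
(`exists_transmutation_kernel`). Let (g, f) be the two components of vₙ and J the integration from
0. By the interface conditions, the free part of y₁(d - t) is f + g, and that of y₂(d - t) is a₁f -
a₁⁻¹g + a₂Jf. Hence the reflected eigenfunction is an invertible constant matrix applied to vₙ, plus
a Volterra operator applied to vₙ. The determinant a₁ + a₁⁻¹ is nonzero because a₁ > 0, and identity
plus Volterra is invertible (`VolterraBound.isUnit_one_add`). Nothing in this relation depends on n.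

For the norm bounds, transmutation from 0 gives φ₂(d, λ) = O(1) and φ₂'(d, λ) = O(λ) for λ ≥ λ₀, so
the vₙ are bounded and Φₙ = T⁻¹vₙ is too. Also φ₂(·, λ) is a λ-independent invertible operator
applied to cos(λt), whose norm is bounded below; this bounds ‖Φₙ‖ from below. -/

noncomputable section

/-! ### Volterra operators -/

/-- The real Hilbert space `L₂(0, d)`. -/
abbrev LTwo (d : ℝ) : Type := Lp ℝ 2 (volIoo d)

/-- An operator is of Volterra type with respect to the localized energies `e t` if the energy up to `t`
of the image is controlled by the integrated energies up to `t`. -/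
def VolterraBound {E : Type*} [NormedAddCommGroup E] [NormedSpace ℝ E] (d : ℝ) (e : ℝ → E → ℝ)
    (K : E →L[ℝ] E) : Prop :=
  ∃ C, 0 ≤ C ∧ ∀ f t, e t (K f) ≤ C * ∫ s in Iic t, e s f ∂(volIoo d)

theorem integral_pow_Iic_le {d : ℝ} (n : ℕ) {t : ℝ} (ht : 0 ≤ t) :
    ∫ s in Iic t, s ^ n ∂(volIoo d) ≤ t ^ (n + 1) / (n + 1) := by
  have h1 : ∫ s in Ioc 0 t, s ^ n = t ^ (n + 1) / (n + 1) := by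
    rw [← intervalIntegral.integral_of_le ht, integral_pow]; simp
  rw [← h1, Measure.restrict_restrict measurableSet_Iic]
  refine setIntegral_mono_set ?_ ?_ ?_
  · exact (intervalIntegral.intervalIntegrable_pow n).1
  · filter_upwards [ae_restrict_mem measurableSet_Ioc] with s hs
    exact pow_nonneg hs.1.le n
  · refine (Filter.Eventually.of_forall fun s hs => ?_)
    exact ⟨hs.2.1, hs.1⟩

/-- Iterating the defining inequality integrates a power of t at each step, which produces the
factorial. The quasinilpotence of Volterra operators rests on this factor. -/
theorem VolterraBound.pow_le {E : Type*} [NormedAddCommGroup E] [NormedSpace ℝ E] {d : ℝ}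
    {e : ℝ → E → ℝ} (he0 : ∀ t f, 0 ≤ e t f) (hle : ∀ t f, e t f ≤ ‖f‖ ^ 2)
    {K : E →L[ℝ] E} {C : ℝ} (hC : 0 ≤ C)
    (hK : ∀ f t, e t (K f) ≤ C * ∫ s in Iic t, e s f ∂(volIoo d)) (n : ℕ) (f : E) {t : ℝ}
    (ht : 0 ≤ t) : e t ((K ^ n) f) ≤ (C * t) ^ n / n.factorial * ‖f‖ ^ 2 := by
  induction n generalizing t with
  | zero => simpa using hle t f
  | succ n ih =>
    rw [pow_succ']
    change e t (K ((K ^ n) f)) ≤ _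
    refine (hK _ _).trans ?_
    have hint : IntegrableOn (fun s : ℝ => C ^ n / n.factorial * ‖f‖ ^ 2 * s ^ n) (Iic t)
        (volIoo d) := by
      rw [IntegrableOn, Measure.restrict_restrict measurableSet_Iic]
      refine (((continuous_const.mul (continuous_pow n)).integrableOn_Icc (a := 0) (b := t))).mono_set ?_
      intro s hs
      exact ⟨hs.2.1.le, hs.1⟩
    have h1 : ∫ s in Iic t, e s ((K ^ n) f) ∂(volIoo d)
        ≤ ∫ s in Iic t, C ^ n / n.factorial * ‖f‖ ^ 2 * s ^ n ∂(volIoo d) := by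
      refine integral_mono_of_nonneg (.of_forall fun s => he0 _ _) hint ?_
      rw [Measure.restrict_restrict measurableSet_Iic]
      filter_upwards [ae_restrict_mem (measurableSet_Iic.inter measurableSet_Ioo)] with s hs
      refine (ih hs.2.1.le).trans (le_of_eq ?_)
      rw [mul_pow]; ring
    rw [integral_const_mul] at h1
    have h2 := mul_le_mul_of_nonneg_left (integral_pow_Iic_le (d := d) n ht)
      (show 0 ≤ C ^ n / n.factorial * ‖f‖ ^ 2 by positivity)
    refine (mul_le_mul_of_nonneg_left (h1.trans h2) hC).trans (le_of_eq ?_)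
    rw [Nat.factorial_succ]; push_cast
    field_simp
    ring

/-- The identity plus a Volterra operator is invertible. -/
theorem VolterraBound.isUnit_one_add {E : Type*} [NormedAddCommGroup E] [NormedSpace ℝ E]
    [CompleteSpace E] {d : ℝ} (hd : 0 ≤ d) {e : ℝ → E → ℝ} (he0 : ∀ t f, 0 ≤ e t f)
    (hle : ∀ t f, e t f ≤ ‖f‖ ^ 2) (hed : ∀ f, e d f = ‖f‖ ^ 2) {K : E →L[ℝ] E}
    (hK : VolterraBound d e K) : IsUnit (1 + K) := by
  obtain ⟨C, hC, hK⟩ := hK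
  have hpow : ∀ n, ‖K ^ n‖ ≤ Real.sqrt ((C * d) ^ n / n.factorial) := fun n => by
    refine ContinuousLinearMap.opNorm_le_bound _ (Real.sqrt_nonneg _) fun f => ?_
    have h := VolterraBound.pow_le he0 hle hC hK n f hd
    rw [hed] at h
    have := Real.sqrt_le_sqrt h
    rwa [Real.sqrt_sq (norm_nonneg _), Real.sqrt_mul (by positivity),
      Real.sqrt_sq (norm_nonneg _)] at this
  have hlim : Filter.Tendsto (fun n : ℕ => Real.sqrt ((C * d) ^ n / n.factorial)) Filter.atTop
      (nhds 0) := by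
    have h := (Real.continuous_sqrt.tendsto 0).comp
      (FloorSemiring.tendsto_pow_div_factorial_atTop (C * d))
    rwa [Real.sqrt_zero] at h
  -- It suffices that one power of K is a strict contraction: 1 - (-K)ⁿ is then invertible, and 1 +
  -- K is one of its two commuting factors.
  obtain ⟨n, hn⟩ := (hlim.eventually (gt_mem_nhds zero_lt_one)).exists
  have hlt : ‖(-K) ^ n‖ < 1 := by
    have : ‖(-K) ^ n‖ = ‖K ^ n‖ := by
      rcases neg_one_pow_eq_or (E →L[ℝ] E) n with h | h <;> rw [neg_pow, h] <;> simp
    rw [this]; exact (hpow n).trans_lt hn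
  have hu := isUnit_one_sub_of_norm_lt_one hlt
  have hfac : (1 - (-K) ^ n) = (1 + K) * ∑ i ∈ Finset.range n, (-K) ^ i := by
    have := mul_neg_geom_sum (-K) n
    rw [← this, sub_neg_eq_add]
  have hcomm : Commute (1 + K) (∑ i ∈ Finset.range n, (-K) ^ i) := by
    refine Commute.sum_right _ _ _ fun i _ => ?_
    exact (((Commute.one_left _).add_left ((Commute.refl K).neg_right))).pow_right i
  rw [hfac] at hu
  exact (hcomm.isUnit_mul_iff.1 hu).1

/-! ### Energies in `L₂(0, d)` -/

/-- The energy of `f` on `(0, t]`. -/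
def energy (d t : ℝ) (f : LTwo d) : ℝ := ∫ u in Iic t, (f u) ^ 2 ∂(volIoo d)

theorem LTwo.integrable_sq {d : ℝ} (f : LTwo d) : Integrable (fun u => (f u) ^ 2) (volIoo d) :=
  (Lp.memLp f).integrable_sq

theorem LTwo.norm_sq {d : ℝ} (f : LTwo d) : ‖f‖ ^ 2 = ∫ u, (f u) ^ 2 ∂(volIoo d) := by
  rw [← real_inner_self_eq_norm_sq, L2.inner_def]
  simp [pow_two]

theorem energy_nonneg (d t : ℝ) (f : LTwo d) : 0 ≤ energy d t f :=
  integral_nonneg fun _ => sq_nonneg _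

theorem energy_le (d t : ℝ) (f : LTwo d) : energy d t f ≤ ‖f‖ ^ 2 := by
  rw [LTwo.norm_sq]
  exact setIntegral_le_integral f.integrable_sq (.of_forall fun _ => sq_nonneg _)

theorem energy_top (d : ℝ) (f : LTwo d) : energy d d f = ‖f‖ ^ 2 := by
  rw [LTwo.norm_sq, energy, Measure.restrict_restrict measurableSet_Iic]
  congr 2
  exact inter_eq_right.2 fun x hx => hx.2.le

theorem measurable_energy (d : ℝ) (f : LTwo d) : Measurable (fun t => energy d t f) := by
  refine Monotone.measurable fun s t hst => ?_
  exact setIntegral_mono_set f.integrable_sq.integrableOn (.of_forall fun _ => sq_nonneg _)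
    (.of_forall (Iic_subset_Iic.2 hst))

theorem integrable_energy (d : ℝ) (f : LTwo d) : Integrable (fun t => energy d t f) (volIoo d) :=
  Integrable.of_bound (measurable_energy d f).aestronglyMeasurable (‖f‖ ^ 2)
    (.of_forall fun t => by
      rw [Real.norm_eq_abs, abs_of_nonneg (energy_nonneg d t f)]; exact energy_le d t f)

/-! ### Integral operators with Volterra kernels -/

theorem integral_mul_sq_le {α : Type*} [MeasurableSpace α] {μ : Measure α} {a b : α → ℝ}
    (ha : MemLp a 2 μ) (hb : MemLp b 2 μ) :
    (∫ x, a x * b x ∂μ) ^ 2 ≤ (∫ x, a x ^ 2 ∂μ) * ∫ x, b x ^ 2 ∂μ := by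
  have h := real_inner_mul_inner_self_le (ha.toLp a) (hb.toLp b)
  have key : ∀ {u v : α → ℝ} (hu : MemLp u 2 μ) (hv : MemLp v 2 μ),
      inner ℝ (hu.toLp u) (hv.toLp v) = ∫ x, u x * v x ∂μ := fun {u v} hu hv => by
    rw [L2.inner_def]
    refine integral_congr_ae ?_
    filter_upwards [hu.coeFn_toLp, hv.coeFn_toLp] with x h1 h2
    rw [h1, h2]; simp [mul_comm]
  rw [key ha hb, key ha ha, key hb hb] at h
  simpa [pow_two] using h

/-- Cauchy–Schwarz on (0, t] alone, since the kernel vanishes beyond t; this localization is what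
yields a Volterra bound. The majorant m may be any L₂ function, which admits kernels containing the
potential. -/
theorem integral_kernel_sq_le {d : ℝ} {k : ℝ → ℝ} (hk : Measurable k) {m : ℝ → ℝ}
    (hm : MemLp m 2 (volIoo d)) (hkm : ∀ u ∈ Ioo 0 d, |k u| ≤ m u) {t : ℝ}
    (hsupp : ∀ u, t < u → k u = 0) (f : LTwo d) :
    (∫ u, k u * f u ∂(volIoo d)) ^ 2 ≤ (∫ u, m u ^ 2 ∂(volIoo d)) * energy d t f := by
  have h1 : ∫ u, k u * f u ∂(volIoo d) = ∫ u in Iic t, k u * f u ∂(volIoo d) := by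
    symm
    refine setIntegral_eq_integral_of_forall_compl_eq_zero fun u hu => ?_
    rw [hsupp u (not_le.1 hu), zero_mul]
  have hk2 : MemLp k 2 (volIoo d) := by
    refine hm.of_le hk.aestronglyMeasurable ?_
    filter_upwards [ae_restrict_mem measurableSet_Ioo] with u hu
    exact (hkm u hu).trans (le_abs_self _)
  rw [h1]
  refine (integral_mul_sq_le (hk2.restrict _) ((Lp.memLp f).restrict _)).trans ?_
  refine mul_le_mul_of_nonneg_right ?_ (energy_nonneg _ _ _)
  refine (setIntegral_le_integral hk2.integrable_sq (.of_forall fun _ => sq_nonneg _)).trans ?_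
  refine integral_mono_ae hk2.integrable_sq hm.integrable_sq ?_
  filter_upwards [ae_restrict_mem measurableSet_Ioo] with u hu
  exact sq_le_sq.2 ((hkm u hu).trans (le_abs_self _))

/-- The integral operator on `L₂(0, d)` with a Volterra kernel `k` dominated by a square integrable
function of the second variable. -/
theorem exists_kernel_operator {d : ℝ} {k : ℝ → ℝ → ℝ} (hk : Measurable (Function.uncurry k))
    {m : ℝ → ℝ} (hm : MemLp m 2 (volIoo d))
    (hkm : ∀ t ∈ Ioo 0 d, ∀ u ∈ Ioo 0 d, |k t u| ≤ m u) (hsupp : ∀ t u, t < u → k t u = 0) :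
    ∃ K : LTwo d →L[ℝ] LTwo d,
      (∀ f : LTwo d, K f =ᵐ[volIoo d] fun t => ∫ u, k t u * f u ∂(volIoo d)) ∧
      VolterraBound d (energy d) K := by
  have hkt : ∀ t, Measurable (k t) := fun t => hk.comp measurable_prodMk_left
  set S := ∫ u, m u ^ 2 ∂(volIoo d) with hS
  have hS0 : 0 ≤ S := integral_nonneg fun _ => sq_nonneg _
  have hbound : ∀ (f : LTwo d), ∀ t ∈ Ioo 0 d,
      (∫ u, k t u * f u ∂(volIoo d)) ^ 2 ≤ S * energy d t f := fun f t ht =>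
    integral_kernel_sq_le (hkt t) hm (hkm t ht) (hsupp t) f
  have hmeas : ∀ f : LTwo d, AEStronglyMeasurable
      (fun t => ∫ u, k t u * f u ∂(volIoo d)) (volIoo d) := fun f => by
    have : StronglyMeasurable (Function.uncurry fun t u => k t u * f u) :=
      hk.stronglyMeasurable.mul ((Lp.stronglyMeasurable f).comp_measurable measurable_snd)
    exact this.integral_prod_right.aestronglyMeasurable
  have hint : ∀ (f : LTwo d), ∀ t ∈ Ioo 0 d, Integrable (fun u => k t u * f u) (volIoo d) :=
    fun f t ht => by
      have hk2 : MemLp (k t) 2 (volIoo d) := by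
        refine hm.of_le (hkt t).aestronglyMeasurable ?_
        filter_upwards [ae_restrict_mem measurableSet_Ioo] with u hu
        exact (hkm t ht u hu).trans (le_abs_self _)
      exact hk2.integrable_mul (Lp.memLp f)
  have hmem : ∀ f : LTwo d, MemLp (fun t => ∫ u, k t u * f u ∂(volIoo d)) 2 (volIoo d) :=
    fun f => by
      refine MemLp.of_bound (hmeas f) (Real.sqrt (S * ‖f‖ ^ 2)) ?_
      filter_upwards [ae_restrict_mem measurableSet_Ioo] with t ht
      refine Real.abs_le_sqrt ((hbound f t ht).trans ?_)
      exact mul_le_mul_of_nonneg_left (energy_le d t f) hS0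
  have hen : ∀ (f : LTwo d) t, energy d t ((hmem f).toLp _) ≤
      S * ∫ s in Iic t, energy d s f ∂(volIoo d) := fun f t => by
    rw [← integral_const_mul]
    refine integral_mono_of_nonneg (.of_forall fun _ => sq_nonneg _)
      ((integrable_energy d f).integrableOn.const_mul S) ?_
    refine ae_restrict_of_ae ?_
    filter_upwards [(hmem f).coeFn_toLp, ae_restrict_mem measurableSet_Ioo] with s h1 h2
    rw [h1]; exact hbound f s h2
  let K₀ : LTwo d →ₗ[ℝ] LTwo d :=
    { toFun := fun f => (hmem f).toLp _
      map_add' := fun f g => by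
        ext1
        filter_upwards [(hmem (f + g)).coeFn_toLp, (hmem f).coeFn_toLp, (hmem g).coeFn_toLp,
          Lp.coeFn_add ((hmem f).toLp _) ((hmem g).toLp _), ae_restrict_mem measurableSet_Ioo]
          with t h1 h2 h3 h4 ht
        rw [h1, h4, Pi.add_apply, h2, h3, ← integral_add (hint f t ht) (hint g t ht)]
        refine integral_congr_ae ?_
        filter_upwards [Lp.coeFn_add f g] with u hu
        rw [hu, Pi.add_apply, mul_add]
      map_smul' := fun c f => by
        ext1
        filter_upwards [(hmem (c • f)).coeFn_toLp, (hmem f).coeFn_toLp,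
          Lp.coeFn_smul c ((hmem f).toLp _)] with t h1 h2 h4
        rw [h1, RingHom.id_apply, h4, Pi.smul_apply, h2, smul_eq_mul, ← integral_const_mul]
        refine integral_congr_ae ?_
        filter_upwards [Lp.coeFn_smul c f] with u hu
        rw [hu, Pi.smul_apply, smul_eq_mul]; ring }
  let K : LTwo d →L[ℝ] LTwo d := K₀.mkContinuous (Real.sqrt (S * (volIoo d).real univ)) fun f => by
    have h := hen f d
    rw [energy_top] at h
    have h2 : ∫ s in Iic d, energy d s f ∂(volIoo d) ≤ (volIoo d).real univ * ‖f‖ ^ 2 := by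
      refine (setIntegral_le_integral (integrable_energy d f)
        (.of_forall fun _ => energy_nonneg _ _ _)).trans ?_
      refine (integral_mono (integrable_energy d f) (integrable_const (‖f‖ ^ 2))
        (fun s => energy_le d s f)).trans ?_
      simp
    have h3 := h.trans (mul_le_mul_of_nonneg_left h2 hS0)
    have h4 := Real.abs_le_sqrt h3
    rw [abs_of_nonneg (norm_nonneg _), ← mul_assoc, Real.sqrt_mul (by positivity),
      Real.sqrt_sq (norm_nonneg _)] at h4
    exact h4
  exact ⟨K, fun f => (hmem f).coeFn_toLp, S, hS0, fun f t => hen f t⟩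

/-! ### Closure of the Volterra class under sums, multiples and products -/

theorem energy_add_le (d t : ℝ) (f g : LTwo d) :
    energy d t (f + g) ≤ 2 * energy d t f + 2 * energy d t g := by
  rw [energy, energy, energy, ← integral_const_mul, ← integral_const_mul,
    ← integral_add (f.integrable_sq.integrableOn.const_mul 2)
      (g.integrable_sq.integrableOn.const_mul 2)]
  refine integral_mono_ae (f + g).integrable_sq.integrableOn
    ((f.integrable_sq.integrableOn.const_mul 2).add (g.integrable_sq.integrableOn.const_mul 2)) ?_
  refine ae_restrict_of_ae ?_
  filter_upwards [Lp.coeFn_add f g] with u hu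
  rw [hu, Pi.add_apply]
  nlinarith [sq_nonneg (f u - g u)]

theorem energy_smul (d t c : ℝ) (f : LTwo d) : energy d t (c • f) = c ^ 2 * energy d t f := by
  rw [energy, energy, ← integral_const_mul]
  refine integral_congr_ae (ae_restrict_of_ae ?_)
  filter_upwards [Lp.coeFn_smul c f] with u hu
  rw [hu, Pi.smul_apply, smul_eq_mul, mul_pow]

theorem VolterraBound.add {d : ℝ} {K L : LTwo d →L[ℝ] LTwo d}
    (hK : VolterraBound d (energy d) K) (hL : VolterraBound d (energy d) L) :
    VolterraBound d (energy d) (K + L) := by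
  obtain ⟨C, hC, hK⟩ := hK
  obtain ⟨D, hD, hL⟩ := hL
  refine ⟨2 * C + 2 * D, by positivity, fun f t => ?_⟩
  have h := energy_add_le d t (K f) (L f)
  have h1 := hK f t
  have h2 := hL f t
  rw [add_apply]
  linarith

theorem VolterraBound.smul {d : ℝ} {K : LTwo d →L[ℝ] LTwo d}
    (hK : VolterraBound d (energy d) K) (c : ℝ) : VolterraBound d (energy d) (c • K) := by
  obtain ⟨C, hC, hK⟩ := hK
  refine ⟨c ^ 2 * C, by positivity, fun f t => ?_⟩
  rw [smul_apply, energy_smul, mul_assoc]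
  exact mul_le_mul_of_nonneg_left (hK f t) (sq_nonneg c)

/-- The integrated energy is monotone in its upper limit, so the inner bound at any s ≤ t is
replaced by its value at t; the outer integral then costs only the total measure. -/
theorem VolterraBound.mul {d : ℝ} {K L : LTwo d →L[ℝ] LTwo d}
    (hK : VolterraBound d (energy d) K) (hL : VolterraBound d (energy d) L) :
    VolterraBound d (energy d) (K * L) := by
  obtain ⟨C, hC, hK⟩ := hK
  obtain ⟨D, hD, hL⟩ := hL
  refine ⟨C * (D * (volIoo d).real univ), by positivity, fun f t => ?_⟩
  refine (hK (L f) t).trans ?_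
  rw [mul_assoc]
  refine mul_le_mul_of_nonneg_left ?_ hC
  set I := ∫ s in Iic t, energy d s f ∂(volIoo d) with hI
  have hI0 : 0 ≤ I := integral_nonneg fun _ => energy_nonneg _ _ _
  have h1 : ∫ s in Iic t, energy d s (L f) ∂(volIoo d) ≤ ∫ _ in Iic t, D * I ∂(volIoo d) := by
    refine integral_mono_of_nonneg (.of_forall fun _ => energy_nonneg _ _ _)
      (integrable_const _) ?_
    filter_upwards [ae_restrict_mem measurableSet_Iic] with s hs
    refine (hL f s).trans (mul_le_mul_of_nonneg_left ?_ hD)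
    exact setIntegral_mono_set (integrable_energy d f).integrableOn
      (.of_forall fun _ => energy_nonneg _ _ _) (.of_forall (Iic_subset_Iic.2 hs))
  refine h1.trans ?_
  rw [integral_const, smul_eq_mul, measureReal_restrict_apply_univ]
  have h2 : (volIoo d).real (Iic t) ≤ (volIoo d).real univ := measureReal_mono (subset_univ _)
  have h3 := mul_le_mul_of_nonneg_right h2 (mul_nonneg hD hI0)
  linarith

theorem VolterraBound.isUnit_one_add_L2 {d : ℝ} (hd : 0 ≤ d) {K : LTwo d →L[ℝ] LTwo d}
    (hK : VolterraBound d (energy d) K) : IsUnit (1 + K) :=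
  hK.isUnit_one_add hd (energy_nonneg d) (energy_le d) (energy_top d)

/-! ### The integration operator -/

theorem LTwo.integrable {d : ℝ} (f : LTwo d) : Integrable f (volIoo d) :=
  (Lp.memLp f).integrable one_le_two

theorem setIntegral_volIoo_Iic {d t : ℝ} (h0 : 0 ≤ t) (ht : t ≤ d) (f : ℝ → ℝ) :
    ∫ u in Iic t, f u ∂(volIoo d) = ∫ u in 0..t, f u := by
  rw [Measure.restrict_restrict measurableSet_Iic, intervalIntegral.integral_of_le h0]
  rcases ht.lt_or_eq with h | h
  · congr 2
    ext x
    simp only [mem_inter_iff, mem_Iic, mem_Ioo, mem_Ioc]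
    constructor
    · rintro ⟨h1, h2, h3⟩; exact ⟨h2, h1⟩
    · rintro ⟨h1, h2⟩; exact ⟨h2, h1, by linarith⟩
  · rw [integral_Ioc_eq_integral_Ioo, h]
    congr 2
    exact inter_eq_right.2 fun x hx => hx.2.le

theorem integral_indicator_Iic_mul {d t : ℝ} (h0 : 0 ≤ t) (ht : t ≤ d) (f : ℝ → ℝ) :
    ∫ u, (if u ≤ t then 1 else 0) * f u ∂(volIoo d) = ∫ u in 0..t, f u := by
  rw [← setIntegral_volIoo_Iic h0 ht, ← integral_indicator measurableSet_Iic]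
  congr 1
  ext u
  by_cases h : u ≤ t <;> simp [h]

/-- Integration from `0` is a compact Volterra operator on `L₂(0, d)`. -/
theorem exists_integration_operator {d : ℝ} :
    ∃ J : LTwo d →L[ℝ] LTwo d,
      (∀ f : LTwo d, J f =ᵐ[volIoo d] fun t => ∫ u in 0..t, f u) ∧
      VolterraBound d (energy d) J := by
  have hmeas : Measurable (Function.uncurry fun t u : ℝ => if u ≤ t then (1 : ℝ) else 0) :=
    Measurable.ite (measurableSet_le measurable_snd measurable_fst) measurable_const
      measurable_const
  obtain ⟨J, hJ, hV⟩ := exists_kernel_operator (d := d) hmeas (m := fun _ => 1)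
    (memLp_const 1) (fun t _ u _ => by split_ifs <;> simp)
    (fun t u h => if_neg (not_le.2 h))
  refine ⟨J, fun f => ?_, hV⟩
  filter_upwards [hJ f, ae_restrict_mem measurableSet_Ioo] with t h1 ht
  rw [h1, integral_indicator_Iic_mul ht.1.le ht.2.le]

theorem LTwo.sq_integral_le {d : ℝ} (f : LTwo d) {a b : ℝ} (ha : 0 ≤ a) (hab : a ≤ b)
    (hb : b ≤ d) : (∫ u in a..b, f u) ^ 2 ≤ (b - a) * ‖f‖ ^ 2 := by
  have hsub : Ioo a b ⊆ Ioo 0 d := Ioo_subset_Ioo ha hb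
  have hr : volume.restrict (Ioo a b) ≤ volIoo d := Measure.restrict_mono hsub le_rfl
  rw [intervalIntegral.integral_of_le hab, integral_Ioc_eq_integral_Ioo]
  have h := integral_mul_sq_le (μ := volume.restrict (Ioo a b)) (a := fun _ => (1 : ℝ)) (b := f)
    (memLp_const 1) ((Lp.memLp f).mono_measure hr)
  simp only [one_mul, one_pow, integral_const, smul_eq_mul, mul_one,
    measureReal_restrict_apply_univ, Real.volume_real_Ioo_of_le hab] at h
  refine h.trans (mul_le_mul_of_nonneg_left ?_ (sub_nonneg.2 hab))
  rw [LTwo.norm_sq]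
  exact integral_mono_measure hr (.of_forall fun _ => sq_nonneg _) f.integrable_sq

theorem LTwo.intervalIntegrable {d : ℝ} (f : LTwo d) {a b : ℝ} (ha : a ∈ Icc 0 d)
    (hb : b ∈ Icc 0 d) : IntervalIntegrable f volume a b := by
  have h : IntervalIntegrable f volume 0 d :=
    (intervalIntegrable_iff_integrableOn_Ioo_of_le (ha.1.trans ha.2)).2 f.integrable
  exact h.mono_set (by rw [uIcc_of_le (ha.1.trans ha.2)]; exact uIcc_subset_Icc ha hb)

/-! ### Compactness of integration -/

theorem isCompactOperator_of_forall_finiteRank {E : Type*} [NormedAddCommGroup E]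
    [NormedSpace ℝ E] [CompleteSpace E] {T : E →L[ℝ] E}
    (h : ∀ ε > 0, ∃ S : E →L[ℝ] E, IsCompactOperator S ∧ ‖T - S‖ ≤ ε) : IsCompactOperator T := by
  have hcl := isClosed_setOfPred_isCompactOperator (𝕜₁ := ℝ) (𝕜₂ := ℝ) (σ₁₂ := RingHom.id ℝ)
    (M₁ := E) (M₂ := E)
  refine hcl.closure_subset (Metric.mem_closure_iff.2 fun ε hε => ?_)
  obtain ⟨S, hS, hTS⟩ := h (ε / 2) (by positivity)
  exact ⟨S, hS, by rw [dist_eq_norm]; linarith⟩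

theorem isCompactOperator_rankOne {E F : Type*} [NormedAddCommGroup E] [NormedSpace ℝ E]
    [NormedAddCommGroup F] [NormedSpace ℝ F] (l : E →L[ℝ] ℝ) (v : F) :
    IsCompactOperator (l.smulRight v) := by
  have h : IsCompactOperator l := isCompactOperator_of_locallyCompactSpace_dom l
  exact h.clm_comp (ContinuousLinearMap.toSpanSingleton ℝ v)

/-- Replacing the upper limit t by the nearest grid point below it gives a finite-rank operator. By
Cauchy–Schwarz the pointwise error squared is at most δ‖f‖² for mesh δ = d/n, so the operator error
squared is at most d²/n. -/
theorem isCompactOperator_integration {d : ℝ} (hd : 0 < d) {J : LTwo d →L[ℝ] LTwo d}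
    (hJ : ∀ f : LTwo d, J f =ᵐ[volIoo d] fun t => ∫ u in 0..t, f u) : IsCompactOperator J := by
  refine isCompactOperator_of_forall_finiteRank fun ε hε => ?_
  obtain ⟨n, hn⟩ := exists_nat_gt (d ^ 2 / ε ^ 2)
  have hn0 : (0 : ℝ) < n := lt_of_le_of_lt (by positivity) hn
  have hn1 : 0 < n := by exact_mod_cast hn0
  set δ := d / n with hδ
  have hδ0 : 0 < δ := by positivity
  have hL : ∀ k : ℕ, MemLp (fun u : ℝ => if u ≤ k * δ then (1 : ℝ) else 0) 2 (volIoo d) :=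
    fun k => MemLp.of_bound
      (Measurable.ite measurableSet_Iic measurable_const measurable_const).aestronglyMeasurable 1
      (.of_forall fun u => by split_ifs <;> simp)
  have hI : ∀ k : ℕ, MemLp (fun t : ℝ => if ⌊t / δ⌋₊ = k then (1 : ℝ) else 0) 2 (volIoo d) :=
    fun k => MemLp.of_bound
      (Measurable.ite (measurableSet_eq_fun (Nat.measurable_floor.comp (measurable_id.div_const δ))
        measurable_const) measurable_const measurable_const).aestronglyMeasurable 1
      (.of_forall fun u => by split_ifs <;> simp)
  let S : LTwo d →L[ℝ] LTwo d := ∑ k ∈ Finset.range n,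
    (innerSL ℝ ((hL k).toLp _)).smulRight ((hI k).toLp _)
  refine ⟨S, ?_, ?_⟩
  · refine Finset.sum_induction (f := fun k : ℕ =>
      (innerSL ℝ ((hL k).toLp _)).smulRight ((hI k).toLp _))
      (fun A : LTwo d →L[ℝ] LTwo d => IsCompactOperator A) (fun A B hA hB => hA.add hB)
      isCompactOperator_zero fun k _ => isCompactOperator_rankOne _ _
  have hS : ∀ f : LTwo d, ∀ᵐ t ∂(volIoo d), (S f) t = ∫ u in 0..(⌊t / δ⌋₊ * δ), f u := by
    intro f
    have h1 : ∀ k : ℕ, k < n → inner ℝ ((hL k).toLp _) f = ∫ u in 0..(k * δ), f u := by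
      intro k hk
      have hkd : (k : ℝ) * δ ≤ d := by
        rw [hδ, mul_div_assoc', div_le_iff₀ hn0, mul_comm]
        exact mul_le_mul_of_nonneg_left (by exact_mod_cast hk.le) hd.le
      rw [← integral_indicator_Iic_mul (by positivity) hkd, L2.inner_def]
      refine integral_congr_ae ?_
      filter_upwards [(hL k).coeFn_toLp] with u hu
      rw [hu]; simp
    have h2 : S f = ∑ k ∈ Finset.range n, (∫ u in 0..(k * δ), f u) • (hI k).toLp _ := by
      simp only [S, sum_apply, ContinuousLinearMap.smulRight_apply,
        innerSL_apply_apply]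
      exact Finset.sum_congr rfl fun k hk => by rw [h1 k (Finset.mem_range.1 hk)]
    rw [h2]
    have h3 : ∀ᵐ t ∂(volIoo d), ∀ k : ℕ, ((∫ u in 0..(k * δ), f u) • (hI k).toLp _ : LTwo d) t
        = (∫ u in 0..(k * δ), f u) * if ⌊t / δ⌋₊ = k then (1 : ℝ) else 0 := by
      refine ae_all_iff.2 fun k => ?_
      filter_upwards [Lp.coeFn_smul (∫ u in 0..(k * δ), f u) ((hI k).toLp _),
        (hI k).coeFn_toLp] with t h4 h5
      rw [h4, Pi.smul_apply, h5, smul_eq_mul]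
    filter_upwards [h3, Lp.coeFn_finsetSum (Finset.range n)
      (fun k : ℕ => (∫ u in 0..(k * δ), f u) • (hI k).toLp _), ae_restrict_mem measurableSet_Ioo]
      with t h4 h5 ht
    rw [h5, Finset.sum_apply, Finset.sum_congr rfl fun k _ => h4 k]
    simp only [mul_ite, mul_one, mul_zero]
    rw [Finset.sum_ite_eq, if_pos]
    rw [Finset.mem_range, Nat.floor_lt (div_nonneg ht.1.le hδ0.le), div_lt_iff₀ hδ0, hδ]
    have : (n : ℝ) * (d / n) = d := by field_simp
    rw [this]; exact ht.2
  refine ContinuousLinearMap.opNorm_le_bound _ hε.le fun f => ?_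
  refine le_of_sq_le_sq ?_ (by positivity)
  rw [LTwo.norm_sq]
  have hpt : ∀ᵐ t ∂(volIoo d), (((J - S) f : LTwo d) t) ^ 2 ≤ δ * ‖f‖ ^ 2 := by
    filter_upwards [hJ f, hS f, Lp.coeFn_sub (J f) (S f), ae_restrict_mem measurableSet_Ioo]
      with t h1 h2 h3 ht
    have hfl : (⌊t / δ⌋₊ : ℝ) * δ ≤ t := by
      rw [← le_div_iff₀ hδ0]; exact Nat.floor_le (div_nonneg ht.1.le hδ0.le)
    have hfl2 : t - ⌊t / δ⌋₊ * δ ≤ δ := by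
      have := Nat.lt_floor_add_one (t / δ)
      rw [div_lt_iff₀ hδ0] at this
      linarith
    have h0 : 0 ≤ (⌊t / δ⌋₊ : ℝ) * δ := by positivity
    rw [sub_apply, h3, Pi.sub_apply, h1, h2,
      intervalIntegral.integral_interval_sub_left
        (f.intervalIntegrable ⟨le_rfl, hd.le⟩ ⟨ht.1.le, ht.2.le⟩)
        (f.intervalIntegrable ⟨le_rfl, hd.le⟩ ⟨h0, hfl.trans ht.2.le⟩)]
    exact (f.sq_integral_le h0 hfl ht.2.le).trans
      (mul_le_mul_of_nonneg_right hfl2 (sq_nonneg _))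
  refine (integral_mono_ae (((J - S) f).integrable_sq) (integrable_const _) hpt).trans ?_
  rw [integral_const, smul_eq_mul, measureReal_restrict_apply_univ,
    Real.volume_real_Ioo_of_le hd.le, mul_pow, ← mul_assoc]
  refine mul_le_mul_of_nonneg_right ?_ (sq_nonneg _)
  rw [div_lt_iff₀ (by positivity)] at hn
  rw [hδ, sub_zero, mul_div_assoc', div_le_iff₀ hn0]
  nlinarith


/-! ### The transmutation kernel -/

theorem abs_sin_mul_div_le {lam : ℝ} (hl : 0 < lam) (τ : ℝ) : |Real.sin (lam * τ) / lam| ≤ |τ| := by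
  rw [abs_div, abs_of_pos hl, div_le_iff₀ hl]
  refine (Real.abs_sin_le_abs).trans (le_of_eq ?_)
  rw [abs_mul, abs_of_pos hl, mul_comm]

/-- The solution of `-y'' = lam² y` with `y(0) = α`, `y'(0) = β`. -/
def freeSol (lam α β x : ℝ) : ℝ := α * Real.cos (lam * x) + β * (Real.sin (lam * x) / lam)

theorem continuous_freeSol (lam α β : ℝ) : Continuous (freeSol lam α β) := by
  unfold freeSol; fun_prop

theorem abs_freeSol_le {lam : ℝ} (hl : 0 < lam) (α β x : ℝ) :
    |freeSol lam α β x| ≤ |α| + |β| / lam := by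
  refine (abs_add_le _ _).trans (add_le_add ?_ ?_)
  · rw [abs_mul]; exact mul_le_of_le_one_right (abs_nonneg _) (Real.abs_cos_le_one _)
  · rw [abs_mul, abs_div, abs_of_pos hl, mul_div_assoc']
    exact div_le_div_of_nonneg_right
      (mul_le_of_le_one_right (abs_nonneg _) (Real.abs_sin_le_one _)) hl.le

/-- This identity removes λ from the kernel: the factor sin(λτ)/λ, applied to a free solution,
becomes an average of that solution over an interval independent of λ. -/
theorem sin_mul_freeSol {lam : ℝ} (hl : 0 < lam) (α β τ u : ℝ) :
    Real.sin (lam * τ) / lam * freeSol lam α β u =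
      1 / 2 * ∫ ρ in (u - τ)..(u + τ), freeSol lam α β ρ := by
  have hd : ∀ ρ : ℝ, HasDerivAt
      (fun ρ => α * (Real.sin (lam * ρ) / lam) - β * (Real.cos (lam * ρ) / lam ^ 2))
      (freeSol lam α β ρ) ρ := fun ρ => by
    have h0 : HasDerivAt (fun ρ : ℝ => lam * ρ) lam ρ := by
      simpa using (hasDerivAt_id ρ).const_mul lam
    have h1 := ((h0.sin.div_const lam).const_mul α).sub ((h0.cos.div_const (lam ^ 2)).const_mul β)
    refine h1.congr_deriv ?_
    unfold freeSol
    field_simp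
    ring
  rw [intervalIntegral.integral_eq_sub_of_hasDerivAt (fun ρ _ => hd ρ)
    ((continuous_freeSol lam α β).intervalIntegrable _ _)]
  simp only [mul_add, mul_sub, Real.sin_add, Real.sin_sub, Real.cos_add, Real.cos_sub, freeSol]
  field_simp
  ring

/-- The operator of Duhamel's formula. -/
def duhamel (lam : ℝ) (Q f : ℝ → ℝ) (t : ℝ) : ℝ :=
  ∫ s in 0..t, Real.sin (lam * (t - s)) / lam * (Q s * f s)

theorem locallyIntegrable_of_memLp_two {Q : ℝ → ℝ} (hQ : MemLp Q 2 volume) :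
    LocallyIntegrable Q volume := hQ.locallyIntegrable one_le_two

/-- A weight exp(γt) makes Duhamel's operator, and the kernel recursion derived from it, contract by
the factor 1/2 on the whole of [0, d], with γ depending on d and Q only and not on λ. -/
theorem exists_weight {d : ℝ} (hd : 0 < d) {Q : ℝ → ℝ} (hQ : MemLp Q 2 volume) :
    ∃ γ, 0 < γ ∧ ∀ t, 0 ≤ t →
      d * ∫ s in Ioc 0 t, |Q s| * Real.exp (γ * s) ≤ 1 / 2 * Real.exp (γ * t) := by
  set S := ∫ s, Q s ^ 2 with hS
  have hS0 : 0 ≤ S := integral_nonneg fun _ => sq_nonneg _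
  -- Young's inequality with parameter ε splits |Q| exp(γ(s - t)) into a part with Q² and a part
  -- with exp(2γ(s - t)). This ε makes the first contribution at most 1/4, and γ = d/ε makes the
  -- second at most 1/4.
  set ε := 1 / (2 * d * (S + 1)) with hε
  have hε0 : 0 < ε := by positivity
  have hγ0 : 0 < d / ε := by positivity
  refine ⟨d / ε, hγ0, fun t ht => ?_⟩
  set γ := d / ε with hγ
  have hpt : ∀ s, |Q s| * Real.exp (γ * s) ≤
      Real.exp (γ * t) * (1 / 2 * (ε * Q s ^ 2) + 1 / 2 / ε * (Real.exp (2 * γ * (s - t)))) := by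
    intro s
    have h1 : Real.exp (γ * s) = Real.exp (γ * t) * Real.exp (γ * (s - t)) := by
      rw [← Real.exp_add]; ring_nf
    have h2 : Real.exp (2 * γ * (s - t)) = Real.exp (γ * (s - t)) ^ 2 := by
      rw [← Real.exp_nat_mul]; ring_nf
    rw [h1, h2, mul_left_comm]
    refine mul_le_mul_of_nonneg_left ?_ (Real.exp_pos _).le
    set E := Real.exp (γ * (s - t))
    have h3 : 0 ≤ (1 / 2 / ε) * (ε * |Q s| - E) ^ 2 := by positivity
    have h4 : (1 / 2 / ε) * (ε * |Q s| - E) ^ 2 =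
        1 / 2 * (ε * Q s ^ 2) + 1 / 2 / ε * E ^ 2 - |Q s| * E := by
      rw [← sq_abs (Q s)]; field_simp; ring
    linarith
  have hiQ : Integrable (fun s => Q s ^ 2) (volume.restrict (Ioc 0 t)) :=
    hQ.integrable_sq.integrableOn
  have hcE : Continuous fun s : ℝ => Real.exp (2 * γ * (s - t)) := by fun_prop
  have hiE : Integrable (fun s => Real.exp (2 * γ * (s - t))) (volume.restrict (Ioc 0 t)) :=
    (hcE.integrableOn_Icc (a := 0) (b := t)).mono_set Ioc_subset_Icc_self
  have hI1 : ∫ s in Ioc 0 t, Q s ^ 2 ≤ S :=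
    setIntegral_le_integral hQ.integrable_sq (.of_forall fun _ => sq_nonneg _)
  have hI2 : ∫ s in Ioc 0 t, Real.exp (2 * γ * (s - t)) ≤ 1 / (2 * γ) := by
    have hder : ∀ s : ℝ, HasDerivAt (fun s => Real.exp (2 * γ * (s - t)) / (2 * γ))
        (Real.exp (2 * γ * (s - t))) s := fun s => by
      have h0 : HasDerivAt (fun s : ℝ => 2 * γ * (s - t)) (2 * γ) s := by
        simpa using ((hasDerivAt_id s).sub_const t).const_mul (2 * γ)
      exact (h0.exp.div_const (2 * γ)).congr_deriv (by field_simp)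
    rw [← intervalIntegral.integral_of_le ht, intervalIntegral.integral_eq_sub_of_hasDerivAt
      (fun s _ => hder s) (hcE.intervalIntegrable _ _)]
    have : 0 ≤ Real.exp (2 * γ * (0 - t)) / (2 * γ) := by positivity
    simp only [sub_self, mul_zero, Real.exp_zero]
    linarith
  have hmain : ∫ s in Ioc 0 t, |Q s| * Real.exp (γ * s) ≤
      Real.exp (γ * t) * (1 / 2 * (ε * S) + 1 / 2 / ε * (1 / (2 * γ))) := by
    refine (integral_mono_of_nonneg (.of_forall fun s => by positivity)
      (((hiQ.const_mul ε).const_mul (1 / 2)).add (hiE.const_mul (1 / 2 / ε)) |>.const_mul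
        (Real.exp (γ * t))) (.of_forall hpt)).trans ?_
    rw [integral_const_mul]
    refine mul_le_mul_of_nonneg_left ?_ (Real.exp_pos _).le
    rw [integral_add' ((hiQ.const_mul ε).const_mul (1 / 2)) (hiE.const_mul (1 / 2 / ε)),
      integral_const_mul, integral_const_mul, integral_const_mul]
    gcongr
  have hcoef : d * (1 / 2 * (ε * S) + 1 / 2 / ε * (1 / (2 * γ))) ≤ 1 / 2 := by
    have h1 : d * (1 / 2 / ε * (1 / (2 * γ))) = 1 / 4 := by rw [hγ]; field_simp; norm_num
    have h2 : d * (1 / 2 * (ε * S)) ≤ 1 / 4 := by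
      rw [hε]
      rw [show d * (1 / 2 * (1 / (2 * d * (S + 1)) * S)) = 1 / 4 * (S / (S + 1)) by field_simp; ring]
      have : S / (S + 1) ≤ 1 := (div_le_one (by positivity)).2 (by linarith)
      linarith
    linarith
  calc d * ∫ s in Ioc 0 t, |Q s| * Real.exp (γ * s)
      ≤ d * (Real.exp (γ * t) * (1 / 2 * (ε * S) + 1 / 2 / ε * (1 / (2 * γ)))) := by gcongr
    _ = Real.exp (γ * t) * (d * (1 / 2 * (ε * S) + 1 / 2 / ε * (1 / (2 * γ)))) := by ring
    _ ≤ Real.exp (γ * t) * (1 / 2) := by gcongr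
    _ = _ := by ring

/-- Fubini's theorem, moving the free solution outside so that the rest becomes a kernel in ρ. Where
h ≠ 0 the limits are ordered, so the interval integral is an integral over `Ioc`, and they lie in
[-T, T], which supplies an integrable majorant on the product. -/
theorem integral_mul_intervalIntegral_eq {X : Type*} [MeasurableSpace X] {m : Measure X} [SFinite m]
    {h a b : X → ℝ} (hh : Integrable h m) (hhm : Measurable h) (ha : Measurable a)
    (hb : Measurable b) {T : ℝ} (hab : ∀ x, h x ≠ 0 → a x ≤ b x ∧ -T ≤ a x ∧ b x ≤ T)
    {y : ℝ → ℝ} (hy : Continuous y) {B : ℝ} (hB : ∀ ρ, |y ρ| ≤ B) :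
    ∫ x, h x * (1 / 2 * ∫ ρ in (a x)..(b x), y ρ) ∂m =
      ∫ ρ, (1 / 2 * ∫ x, (if a x < ρ ∧ ρ ≤ b x then h x else 0) ∂m) * y ρ := by
  have hset : MeasurableSet {p : X × ℝ | a p.1 < p.2 ∧ p.2 ≤ b p.1} :=
    (measurableSet_lt (ha.comp measurable_fst) measurable_snd).inter
      (measurableSet_le measurable_snd (hb.comp measurable_fst))
  have hFm : Measurable (fun p : X × ℝ =>
      (if a p.1 < p.2 ∧ p.2 ≤ b p.1 then h p.1 else 0) * (1 / 2 * y p.2)) :=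
    (Measurable.ite hset (hhm.comp measurable_fst) measurable_const).mul
      ((hy.measurable.comp measurable_snd).const_mul _)
  have hind : Integrable (fun ρ : ℝ => (Icc (-T) T).indicator (fun _ => B) ρ) volume :=
    (integrable_indicator_iff measurableSet_Icc).2 (by simp)
  have hFi : Integrable (fun p : X × ℝ =>
      (if a p.1 < p.2 ∧ p.2 ≤ b p.1 then h p.1 else 0) * (1 / 2 * y p.2)) (m.prod volume) := by
    refine (hh.norm.mul_prod hind).mono' hFm.aestronglyMeasurable (.of_forall fun p => ?_)
    have hB0 : 0 ≤ B := (abs_nonneg _).trans (hB 0)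
    by_cases hp : a p.1 < p.2 ∧ p.2 ≤ b p.1
    · rw [if_pos hp]
      by_cases hx : h p.1 = 0
      · simp [hx]
      · obtain ⟨_, h2, h3⟩ := hab _ hx
        rw [indicator_of_mem (show p.2 ∈ Icc (-T) T from ⟨h2.trans hp.1.le, hp.2.trans h3⟩),
          norm_mul]
        refine mul_le_mul_of_nonneg_left ?_ (norm_nonneg _)
        rw [Real.norm_eq_abs, abs_mul, abs_of_pos (by norm_num : (0 : ℝ) < 1 / 2)]
        linarith [hB p.2, abs_nonneg (y p.2)]
    · rw [if_neg hp, zero_mul, norm_zero]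
      exact mul_nonneg (norm_nonneg _) (indicator_nonneg (fun _ _ => hB0) _)
  have hL : ∀ x, h x * (1 / 2 * ∫ ρ in (a x)..(b x), y ρ) =
      ∫ ρ, (if a x < ρ ∧ ρ ≤ b x then h x else 0) * (1 / 2 * y ρ) := fun x => by
    by_cases hx : h x = 0
    · simp [hx]
    · rw [intervalIntegral.integral_of_le (hab x hx).1, ← integral_const_mul, ← integral_const_mul,
        ← integral_indicator measurableSet_Ioc]
      congr 1
      ext ρ
      by_cases hρ : a x < ρ ∧ ρ ≤ b x
      · rw [if_pos hρ, indicator_of_mem (show ρ ∈ Ioc (a x) (b x) from hρ)]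
      · rw [if_neg hρ, indicator_of_notMem (show ρ ∉ Ioc (a x) (b x) from hρ), zero_mul]
  simp_rw [hL]
  rw [integral_integral_swap hFi]
  congr 1
  ext ρ
  rw [integral_mul_const]
  ring

/-- The first term of the Neumann series of the transmutation kernel. -/
def kernelZero (d : ℝ) (Q : ℝ → ℝ) (p : ℝ × ℝ) : ℝ :=
  1 / 2 * ∫ s, (if 2 * s - p.1 < p.2 ∧ p.2 ≤ p.1 then
    (if 0 < s ∧ s ≤ p.1 ∧ p.1 ≤ d then Q s else 0) else 0)

/-- The step of the Neumann series of the transmutation kernel. -/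
def kernelStep (d : ℝ) (Q : ℝ → ℝ) (P : ℝ × ℝ → ℝ) (p : ℝ × ℝ) : ℝ :=
  1 / 2 * ∫ z : ℝ × ℝ, (if z.2 - (p.1 - z.1) < p.2 ∧ p.2 ≤ z.2 + (p.1 - z.1) then
    (if 0 < z.1 ∧ z.1 ≤ p.1 ∧ p.1 ≤ d then Q z.1 * P z else 0) else 0)

/-- The terms of the Neumann series of the transmutation kernel. -/
def kernelTerm (d : ℝ) (Q : ℝ → ℝ) : ℕ → ℝ × ℝ → ℝ
  | 0 => kernelZero d Q
  | n + 1 => kernelStep d Q (kernelTerm d Q n)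

/-- Measurable kernels supported in the triangle `|ρ| ≤ t ≤ d` with an exponential bound. -/
structure IsTriangleKernel (d γ M : ℝ) (P : ℝ × ℝ → ℝ) : Prop where
  meas : Measurable P
  supp : ∀ p, P p ≠ 0 → 0 < p.1 ∧ p.1 ≤ d ∧ -p.1 ≤ p.2 ∧ p.2 ≤ p.1
  bound : ∀ p, |P p| ≤ M * Real.exp (γ * p.1)

theorem measurableSet_setOf_and {α : Type*} [MeasurableSpace α] {p q : α → Prop}
    (hp : MeasurableSet {a | p a}) (hq : MeasurableSet {a | q a}) :
    MeasurableSet {a | p a ∧ q a} := hp.inter hq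

theorem exists_of_integral_ne_zero {α : Type*} [MeasurableSpace α] {μ : Measure α} {f : α → ℝ}
    (h : ∫ x, f x ∂μ ≠ 0) : ∃ x, f x ≠ 0 := by
  by_contra! h0
  exact h (by simp [h0])

theorem isTriangleKernel_kernelZero {d : ℝ} {Q : ℝ → ℝ} (hQm : Measurable Q)
    (hQ : MemLp Q 2 volume) {γ : ℝ} (hγ : 0 < γ) :
    IsTriangleKernel d γ (∫ s in Ioc 0 d, |Q s|) (kernelZero d Q) := by
  have hI : IntegrableOn Q (Ioc 0 d) :=
    ((locallyIntegrable_of_memLp_two hQ).integrableOn_isCompact isCompact_Icc).mono_set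
      Ioc_subset_Icc_self
  refine ⟨?_, fun p hp => ?_, fun p => ?_⟩
  · have h : StronglyMeasurable (Function.uncurry fun (p : ℝ × ℝ) (s : ℝ) =>
        if 2 * s - p.1 < p.2 ∧ p.2 ≤ p.1 then
          (if 0 < s ∧ s ≤ p.1 ∧ p.1 ≤ d then Q s else 0) else 0) := by
      refine Measurable.stronglyMeasurable ?_
      refine Measurable.ite ?_ (Measurable.ite ?_ (hQm.comp measurable_snd) measurable_const)
        measurable_const
      · exact measurableSet_setOf_and (measurableSet_lt (by fun_prop) (by fun_prop))
          (measurableSet_le (by fun_prop) (by fun_prop))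
      · exact measurableSet_setOf_and (measurableSet_lt (by fun_prop) (by fun_prop))
          (measurableSet_setOf_and (measurableSet_le (by fun_prop) (by fun_prop))
            (measurableSet_le (by fun_prop) (by fun_prop)))
    exact (h.integral_prod_right.measurable).const_mul _
  · obtain ⟨s, hs⟩ := exists_of_integral_ne_zero (right_ne_zero_of_mul hp)
    rw [ite_ne_right_iff, ite_ne_right_iff] at hs
    obtain ⟨⟨h1, h2⟩, ⟨h3, h4, h5⟩, -⟩ := hs
    exact ⟨by linarith, h5, by linarith, h2⟩
  · by_cases hp : 0 < p.1
    · have h1 : |∫ s, (if 2 * s - p.1 < p.2 ∧ p.2 ≤ p.1 then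
          (if 0 < s ∧ s ≤ p.1 ∧ p.1 ≤ d then Q s else 0) else 0)| ≤ ∫ s in Ioc 0 d, |Q s| := by
        rw [← integral_indicator measurableSet_Ioc, ← Real.norm_eq_abs]
        refine norm_integral_le_of_norm_le ((integrable_indicator_iff measurableSet_Ioc).2 hI.abs)
          (.of_forall fun s => ?_)
        by_cases h : 0 < s ∧ s ≤ p.1 ∧ p.1 ≤ d
        · rw [if_pos h, indicator_of_mem (show s ∈ Ioc 0 d from ⟨h.1, h.2.1.trans h.2.2⟩)]
          split_ifs
          · exact le_rfl
          · simp
        · rw [if_neg h, ite_self, norm_zero]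
          exact indicator_nonneg (fun _ _ => abs_nonneg _) _
      have h0 : 0 ≤ ∫ s in Ioc 0 d, |Q s| := integral_nonneg fun _ => abs_nonneg _
      rw [kernelZero, abs_mul, abs_of_pos (by norm_num : (0 : ℝ) < 1 / 2)]
      have h2 : 1 ≤ Real.exp (γ * p.1) := Real.one_le_exp (by positivity)
      nlinarith
    · have : kernelZero d Q p = 0 := by
        by_contra hne
        obtain ⟨s, hs⟩ := exists_of_integral_ne_zero (right_ne_zero_of_mul hne)
        rw [ite_ne_right_iff, ite_ne_right_iff] at hs
        exact hp (hs.2.1.1.trans_le hs.2.1.2.1)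
      rw [this, abs_zero]
      exact mul_nonneg (integral_nonneg fun _ => abs_nonneg _) (Real.exp_pos _).le

/-- The cone conditions on (s, u) confine u to an interval of length 2d around ρ. The factor 1/2 in
front leaves d ∫ |Q| exp(γs), exactly the quantity halved by the weight. -/
theorem IsTriangleKernel.step {d : ℝ} {Q : ℝ → ℝ} (hQm : Measurable Q)
    (hQ : MemLp Q 2 volume) {γ : ℝ} (hw : ∀ t, 0 ≤ t →
      d * ∫ s in Ioc 0 t, |Q s| * Real.exp (γ * s) ≤ 1 / 2 * Real.exp (γ * t)) {M : ℝ}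
    (hM : 0 ≤ M) {P : ℝ × ℝ → ℝ} (hP : IsTriangleKernel d γ M P) :
    IsTriangleKernel d γ (M / 2) (kernelStep d Q P) := by
  have hsupp : ∀ p, kernelStep d Q P p ≠ 0 → 0 < p.1 ∧ p.1 ≤ d ∧ -p.1 ≤ p.2 ∧ p.2 ≤ p.1 := by
    intro p hp
    obtain ⟨z, hz⟩ := exists_of_integral_ne_zero (right_ne_zero_of_mul hp)
    rw [ite_ne_right_iff, ite_ne_right_iff] at hz
    obtain ⟨⟨h1, h2⟩, ⟨h3, h4, h5⟩, h6⟩ := hz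
    obtain ⟨h7, h8, h9, h10⟩ := hP.supp z (right_ne_zero_of_mul h6)
    exact ⟨by linarith, h5, by linarith, by linarith⟩
  refine ⟨?_, hsupp, fun p => ?_⟩
  · have h : StronglyMeasurable (Function.uncurry fun (p : ℝ × ℝ) (z : ℝ × ℝ) =>
        if z.2 - (p.1 - z.1) < p.2 ∧ p.2 ≤ z.2 + (p.1 - z.1) then
          (if 0 < z.1 ∧ z.1 ≤ p.1 ∧ p.1 ≤ d then Q z.1 * P z else 0) else 0) := by
      refine Measurable.stronglyMeasurable ?_
      refine Measurable.ite ?_ (Measurable.ite ?_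
        ((hQm.comp (measurable_fst.comp measurable_snd)).mul (hP.meas.comp measurable_snd))
        measurable_const) measurable_const
      · exact measurableSet_setOf_and (measurableSet_lt (by fun_prop) (by fun_prop))
          (measurableSet_le (by fun_prop) (by fun_prop))
      · exact measurableSet_setOf_and (measurableSet_lt (by fun_prop) (by fun_prop))
          (measurableSet_setOf_and (measurableSet_le (by fun_prop) (by fun_prop))
            (measurableSet_le (by fun_prop) (by fun_prop)))
    exact (h.integral_prod_right.measurable).const_mul _
  · by_cases hp : kernelStep d Q P p = 0
    · rw [hp, abs_zero]; positivity
    obtain ⟨hp1, hpd, -, -⟩ := hsupp p hp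
    have hd : 0 < d := hp1.trans_le hpd
    have hI : IntegrableOn (fun s => |Q s| * Real.exp (γ * s)) (Ioc 0 p.1) := by
      have hQi : IntegrableOn (fun s => |Q s|) (Icc 0 p.1) :=
        ((locallyIntegrable_of_memLp_two hQ).integrableOn_isCompact isCompact_Icc).abs
      exact (hQi.mul_continuousOn (by fun_prop) isCompact_Icc).mono_set Ioc_subset_Icc_self
    set a : ℝ → ℝ := (Ioc 0 p.1).indicator fun s => |Q s| * Real.exp (γ * s) with ha
    set b : ℝ → ℝ := (Icc (p.2 - d) (p.2 + d)).indicator fun _ => 1 with hb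
    have hai : Integrable a := (integrable_indicator_iff measurableSet_Ioc).2 hI
    have hbi : Integrable b := (integrable_indicator_iff measurableSet_Icc).2 (by simp)
    have ha0 : ∀ s, 0 ≤ a s := fun s => indicator_nonneg (fun _ _ => by positivity) s
    have hb0 : ∀ s, 0 ≤ b s := fun s => indicator_nonneg (fun _ _ => by positivity) s
    have hbv : ∫ u, b u = 2 * d := by
      rw [hb, integral_indicator measurableSet_Icc, integral_const, measureReal_restrict_apply_univ,
        Real.volume_real_Icc_of_le (by linarith)]
      simp; ring
    have h1 : |∫ z : ℝ × ℝ, (if z.2 - (p.1 - z.1) < p.2 ∧ p.2 ≤ z.2 + (p.1 - z.1) then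
        (if 0 < z.1 ∧ z.1 ≤ p.1 ∧ p.1 ≤ d then Q z.1 * P z else 0) else 0)| ≤
        ∫ z : ℝ × ℝ, M * (a z.1 * b z.2) := by
      rw [← Real.norm_eq_abs]
      refine norm_integral_le_of_norm_le ((hai.mul_prod hbi).const_mul M) (.of_forall fun z => ?_)
      split_ifs with h2 h3
      · rw [ha, hb, indicator_of_mem (show z.1 ∈ Ioc 0 p.1 from ⟨h3.1, h3.2.1⟩), indicator_of_mem
          (show z.2 ∈ Icc (p.2 - d) (p.2 + d) from ⟨by linarith, by linarith⟩), norm_mul]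
        have := mul_le_mul_of_nonneg_left (hP.bound z) (abs_nonneg (Q z.1))
        simp only [Real.norm_eq_abs]
        linarith
      · rw [norm_zero]; exact mul_nonneg hM (mul_nonneg (ha0 _) (hb0 _))
      · rw [norm_zero]; exact mul_nonneg hM (mul_nonneg (ha0 _) (hb0 _))
    have h4 : ∫ z : ℝ × ℝ, M * (a z.1 * b z.2) = M * ((∫ s, a s) * (2 * d)) := by
      rw [integral_const_mul, ← hbv]
      congr 1
      exact integral_prod_mul a b
    rw [h4, ha, integral_indicator measurableSet_Ioc] at h1
    rw [kernelStep, abs_mul, abs_of_pos (by norm_num : (0 : ℝ) < 1 / 2)]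
    have h5 := mul_le_mul_of_nonneg_left (hw p.1 hp1.le) hM
    linarith


theorem integrable_indicator_Icc_const (a b c : ℝ) :
    Integrable ((Icc a b).indicator fun _ => c) (volume : Measure ℝ) :=
  (integrable_indicator_iff measurableSet_Icc).2 (integrableOn_const (by simp))

theorem setIntegral_Ioc_eq_ite {t d : ℝ} (ht : t ≤ d) (F : ℝ → ℝ) :
    ∫ s in Ioc 0 t, F s = ∫ s, (if 0 < s ∧ s ≤ t ∧ t ≤ d then F s else 0) := by
  rw [← integral_indicator measurableSet_Ioc]
  congr 1
  ext s
  by_cases h : 0 < s ∧ s ≤ t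
  · rw [indicator_of_mem (show s ∈ Ioc 0 t from h), if_pos ⟨h.1, h.2, ht⟩]
  · rw [indicator_of_notMem (show s ∉ Ioc 0 t from h), if_neg fun h' => h ⟨h'.1, h'.2.1⟩]

/-- Start of the recursion: `sin_mul_freeSol` with τ = t - s and u = s averages over (2s - t, t],
and exchanging the integrals leaves `kernelZero`. -/
theorem duhamel_freeSol {d : ℝ} {Q : ℝ → ℝ} (hQm : Measurable Q) (hQ : MemLp Q 2 volume)
    {lam : ℝ} (hl : 0 < lam) (α β : ℝ) {t : ℝ} (ht : t ∈ Icc 0 d) :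
    duhamel lam Q (freeSol lam α β) t =
      ∫ ρ, kernelZero d Q (t, ρ) * freeSol lam α β ρ := by
  have hI : Integrable (fun s => if 0 < s ∧ s ≤ t ∧ t ≤ d then Q s else 0) := by
    have h : IntegrableOn Q (Ioc 0 t) :=
      ((locallyIntegrable_of_memLp_two hQ).integrableOn_isCompact isCompact_Icc).mono_set
        Ioc_subset_Icc_self
    refine ((integrable_indicator_iff measurableSet_Ioc).2 h).congr (.of_forall fun s => ?_)
    by_cases h : 0 < s ∧ s ≤ t
    · simp only [indicator_of_mem (show s ∈ Ioc 0 t from h), if_pos (⟨h.1, h.2, ht.2⟩ : 0 < s ∧ s ≤ t ∧ t ≤ d)]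
    · simp only [indicator_of_notMem (show s ∉ Ioc 0 t from h)]
      rw [if_neg fun h' => h ⟨h'.1, h'.2.1⟩]
  have hm : Measurable (fun s => if 0 < s ∧ s ≤ t ∧ t ≤ d then Q s else 0) :=
    Measurable.ite (measurableSet_setOf_and measurableSet_Ioi
      (measurableSet_setOf_and measurableSet_Iic (MeasurableSet.const _))) hQm measurable_const
  have key := integral_mul_intervalIntegral_eq (a := fun s => 2 * s - t) (b := fun _ => t) hI hm
    (by fun_prop) (by fun_prop) (T := d) (fun s hs => by
      rw [ite_ne_right_iff] at hs
      obtain ⟨⟨h1, h2, h3⟩, -⟩ := hs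
      exact ⟨by linarith, by linarith, h3⟩)
    (continuous_freeSol lam α β) (abs_freeSol_le hl α β)
  unfold kernelZero
  rw [← key, duhamel, intervalIntegral.integral_of_le ht.1, setIntegral_Ioc_eq_ite ht.2]
  congr 1
  ext s
  rw [ite_mul, zero_mul]
  congr 1
  rw [mul_left_comm, sin_mul_freeSol hl, show s - (t - s) = 2 * s - t by ring,
    show s + (t - s) = t by ring]

/-- Inductive step of the recursion: Duhamel's operator maps the integral transform with kernel P to
the one with kernel `kernelStep d Q P`, so the iteration takes place among kernels free of λ. -/
theorem duhamel_kernel {d : ℝ} {Q : ℝ → ℝ} (hQm : Measurable Q) (hQ : MemLp Q 2 volume)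
    {γ M : ℝ} (hγ : 0 < γ) (hM : 0 ≤ M) {P : ℝ × ℝ → ℝ} (hP : IsTriangleKernel d γ M P)
    {lam : ℝ} (hl : 0 < lam) (α β : ℝ) {t : ℝ} (ht : t ∈ Icc 0 d) :
    duhamel lam Q (fun s => ∫ u, P (s, u) * freeSol lam α β u) t =
      ∫ ρ, kernelStep d Q P (t, ρ) * freeSol lam α β ρ := by
  set h : ℝ × ℝ → ℝ := fun z => if 0 < z.1 ∧ z.1 ≤ t ∧ t ≤ d then Q z.1 * P z else 0 with hh
  have hm : Measurable h :=
    Measurable.ite (measurableSet_setOf_and (measurableSet_lt (by fun_prop) (by fun_prop))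
      (measurableSet_setOf_and (measurableSet_le (by fun_prop) (by fun_prop))
        (MeasurableSet.const _)))
      ((hQm.comp measurable_fst).mul hP.meas) measurable_const
  have hQI : IntegrableOn (fun s => |Q s|) (Ioc 0 t) :=
    (((locallyIntegrable_of_memLp_two hQ).integrableOn_isCompact isCompact_Icc).mono_set
      Ioc_subset_Icc_self).abs
  have hdom : Integrable (fun z : ℝ × ℝ => (Ioc 0 t).indicator (fun s => |Q s|) z.1 *
      (Icc (-d) d).indicator (fun _ => M * Real.exp (γ * d)) z.2) :=
    ((integrable_indicator_iff measurableSet_Ioc).2 hQI).mul_prod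
      (integrable_indicator_Icc_const _ _ _)
  have hI : Integrable h := by
    refine hdom.mono' hm.aestronglyMeasurable (.of_forall fun z => ?_)
    by_cases hz : h z = 0
    · rw [hz, norm_zero]
      exact mul_nonneg (indicator_nonneg (fun _ _ => abs_nonneg _) _)
        (indicator_nonneg (fun _ _ => by positivity) _)
    · have hz' := hz
      rw [hh] at hz'
      simp only [ite_ne_right_iff] at hz'
      obtain ⟨h1, h2⟩ := hz'
      obtain ⟨h3, h4, h5, h6⟩ := hP.supp z (right_ne_zero_of_mul h2)
      rw [hh]
      simp only
      rw [if_pos h1, indicator_of_mem (show z.1 ∈ Ioc 0 t from ⟨h1.1, h1.2.1⟩),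
        indicator_of_mem (show z.2 ∈ Icc (-d) d from ⟨by linarith, by linarith⟩), norm_mul,
        Real.norm_eq_abs, Real.norm_eq_abs]
      refine mul_le_mul_of_nonneg_left ((hP.bound z).trans ?_) (abs_nonneg _)
      refine mul_le_mul_of_nonneg_left (Real.exp_le_exp.2 ?_) hM
      exact mul_le_mul_of_nonneg_left h4 hγ.le
  have key := integral_mul_intervalIntegral_eq (a := fun z : ℝ × ℝ => z.2 - (t - z.1))
    (b := fun z => z.2 + (t - z.1)) hI hm
    (by fun_prop) (by fun_prop) (T := d) (fun z hz => by
      rw [hh] at hz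
      simp only [ite_ne_right_iff] at hz
      obtain ⟨⟨h1, h2, h3⟩, h4⟩ := hz
      obtain ⟨h5, h6, h7, h8⟩ := hP.supp z (right_ne_zero_of_mul h4)
      exact ⟨by linarith, by linarith, by linarith⟩)
    (continuous_freeSol lam α β) (abs_freeSol_le hl α β)
  have hstep : ∀ ρ, kernelStep d Q P (t, ρ) = 1 / 2 * ∫ z : ℝ × ℝ,
      (if z.2 - (t - z.1) < ρ ∧ ρ ≤ z.2 + (t - z.1) then h z else 0) := fun ρ => rfl
  simp_rw [hstep]
  rw [← key, duhamel, intervalIntegral.integral_of_le ht.1, setIntegral_Ioc_eq_ite ht.2]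
  simp_rw [← sin_mul_freeSol hl]
  have hprod : Integrable (fun z : ℝ × ℝ =>
      h z * (Real.sin (lam * (t - z.1)) / lam * freeSol lam α β z.2)) := by
    refine hI.mul_bdd (c := 1 / lam * (|α| + |β| / lam)) (by
      refine Continuous.aestronglyMeasurable ?_
      exact ((Real.continuous_sin.comp (by fun_prop)).div_const _).mul
        ((continuous_freeSol lam α β).comp continuous_snd)) (.of_forall fun z => ?_)
    rw [norm_mul]
    refine mul_le_mul ?_ (abs_freeSol_le hl α β _) (norm_nonneg _) (by positivity)
    rw [Real.norm_eq_abs, abs_div, abs_of_pos hl]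
    exact div_le_div_of_nonneg_right (Real.abs_sin_le_one _) hl.le
  rw [Measure.volume_eq_prod, integral_prod _ hprod]
  congr 1
  ext s
  by_cases hs : 0 < s ∧ s ≤ t ∧ t ≤ d
  · simp only [hh, if_pos hs]
    rw [← integral_const_mul, ← integral_const_mul]
    congr 1
    ext u
    ring
  · simp only [hh, if_neg hs, zero_mul, integral_zero]

/-- Functions on `[0, d]` that are measurable and bounded. -/
structure IsBddMeasOn (d : ℝ) (f : ℝ → ℝ) : Prop where
  meas : AEStronglyMeasurable f (volume.restrict (Ioc 0 d))
  bdd : ∃ B, ∀ s ∈ Icc 0 d, |f s| ≤ B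

theorem IsBddMeasOn.sub {d : ℝ} {f g : ℝ → ℝ} (hf : IsBddMeasOn d f) (hg : IsBddMeasOn d g) :
    IsBddMeasOn d (fun s => f s - g s) := by
  obtain ⟨B, hB⟩ := hf.bdd
  obtain ⟨C, hC⟩ := hg.bdd
  exact ⟨hf.meas.sub hg.meas, B + C, fun s hs =>
    (abs_sub _ _).trans (add_le_add (hB s hs) (hC s hs))⟩

theorem ContinuousOn.isBddMeasOn {d : ℝ} {f : ℝ → ℝ} (hf : ContinuousOn f (Icc 0 d)) :
    IsBddMeasOn d f :=
  ⟨(hf.mono Ioc_subset_Icc_self).aestronglyMeasurable measurableSet_Ioc,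
    isCompact_Icc.exists_bound_of_continuousOn hf⟩

theorem IsBddMeasOn.intervalIntegrable {d : ℝ} {f : ℝ → ℝ} (hf : IsBddMeasOn d f) {Q : ℝ → ℝ}
    (hQ : MemLp Q 2 volume) {t : ℝ} (ht : t ∈ Icc 0 d) {φ : ℝ → ℝ} (hφ : Continuous φ) :
    IntervalIntegrable (fun s => φ s * (Q s * f s)) volume 0 t := by
  obtain ⟨B, hB⟩ := hf.bdd
  have hsub : Ioc 0 t ⊆ Ioc 0 d := Ioc_subset_Ioc_right ht.2
  have h1 : IntegrableOn (fun s => Q s * f s) (Ioc 0 t) := by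
    refine Integrable.mul_bdd (c := B)
      (((locallyIntegrable_of_memLp_two hQ).integrableOn_isCompact (isCompact_Icc (a := 0) (b := t))).mono_set
        Ioc_subset_Icc_self) (hf.meas.mono_measure (Measure.restrict_mono hsub le_rfl)) ?_
    filter_upwards [ae_restrict_mem measurableSet_Ioc] with s hs
    exact hB s ⟨(hsub hs).1.le, (hsub hs).2⟩
  exact IntervalIntegrable.continuousOn_mul
    ((intervalIntegrable_iff_integrableOn_Ioc_of_le ht.1).2 h1) hφ.continuousOn

theorem IsBddMeasOn.duhamel_sub {d : ℝ} {f g : ℝ → ℝ} (hf : IsBddMeasOn d f)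
    (hg : IsBddMeasOn d g) {Q : ℝ → ℝ} (hQ : MemLp Q 2 volume) (lam : ℝ) {t : ℝ}
    (ht : t ∈ Icc 0 d) :
    duhamel lam Q (fun s => f s - g s) t = duhamel lam Q f t - duhamel lam Q g t := by
  have hφ : Continuous fun s => Real.sin (lam * (t - s)) / lam :=
    (Real.continuous_sin.comp (by fun_prop)).div_const _
  rw [duhamel, duhamel, duhamel, ← intervalIntegral.integral_sub
    (hf.intervalIntegrable hQ ht hφ) (hg.intervalIntegrable hQ ht hφ)]
  congr 1
  ext s
  ring

theorem abs_duhamel_le {d : ℝ} (hd : 0 < d) {Q : ℝ → ℝ} (hQ : MemLp Q 2 volume) {γ : ℝ}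
    (hw : ∀ t, 0 ≤ t →
      d * ∫ s in Ioc 0 t, |Q s| * Real.exp (γ * s) ≤ 1 / 2 * Real.exp (γ * t))
    {lam : ℝ} (hl : 0 < lam) {C : ℝ} (hC : 0 ≤ C) {f : ℝ → ℝ}
    (hf : ∀ s ∈ Icc 0 d, |f s| ≤ C * Real.exp (γ * s)) {t : ℝ} (ht : t ∈ Icc 0 d) :
    |duhamel lam Q f t| ≤ C / 2 * Real.exp (γ * t) := by
  have hQI : IntegrableOn (fun s => |Q s|) (Icc 0 t) :=
    ((locallyIntegrable_of_memLp_two hQ).integrableOn_isCompact isCompact_Icc).abs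
  have hI : IntegrableOn (fun s => C * d * (|Q s| * Real.exp (γ * s))) (Ioc 0 t) :=
    ((hQI.mul_continuousOn (by fun_prop) isCompact_Icc).mono_set Ioc_subset_Icc_self).const_mul _
  have h1 : |duhamel lam Q f t| ≤ ∫ s in Ioc 0 t, C * d * (|Q s| * Real.exp (γ * s)) := by
    rw [duhamel, intervalIntegral.integral_of_le ht.1, ← Real.norm_eq_abs]
    refine norm_integral_le_of_norm_le hI ?_
    filter_upwards [ae_restrict_mem measurableSet_Ioc] with s hs
    rw [norm_mul, norm_mul, Real.norm_eq_abs, Real.norm_eq_abs, Real.norm_eq_abs]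
    have h2 : |Real.sin (lam * (t - s)) / lam| ≤ d := by
      refine (abs_sin_mul_div_le hl _).trans ?_
      rw [abs_of_nonneg (by linarith [hs.2])]
      linarith [hs.1, ht.2]
    have h3 := hf s ⟨hs.1.le, hs.2.trans ht.2⟩
    calc _ ≤ d * (|Q s| * (C * Real.exp (γ * s))) := by gcongr
      _ = _ := by ring
  rw [integral_const_mul] at h1
  have h2 := mul_le_mul_of_nonneg_left (hw t ht.1) hC
  linarith

theorem isTriangleKernel_kernelTerm {d : ℝ} {Q : ℝ → ℝ} (hQm : Measurable Q)
    (hQ : MemLp Q 2 volume) {γ : ℝ} (hγ : 0 < γ) (hw : ∀ t, 0 ≤ t →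
      d * ∫ s in Ioc 0 t, |Q s| * Real.exp (γ * s) ≤ 1 / 2 * Real.exp (γ * t)) (n : ℕ) :
    IsTriangleKernel d γ ((∫ s in Ioc 0 d, |Q s|) * (1 / 2) ^ n) (kernelTerm d Q n) := by
  induction n with
  | zero => simpa using! isTriangleKernel_kernelZero hQm hQ hγ
  | succ n ih =>
    have h := ih.step hQm hQ hw (mul_nonneg (integral_nonneg fun _ => abs_nonneg _) (by positivity))
    rw [pow_succ, ← mul_assoc, mul_one_div]
    exact h

theorem IsTriangleKernel.abs_le {d γ M : ℝ} (hγ : 0 < γ) (hM : 0 ≤ M) {P : ℝ × ℝ → ℝ}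
    (hP : IsTriangleKernel d γ M P) (p : ℝ × ℝ) : |P p| ≤ M * Real.exp (γ * d) := by
  by_cases h : P p = 0
  · rw [h, abs_zero]; positivity
  · refine (hP.bound p).trans (mul_le_mul_of_nonneg_left (Real.exp_le_exp.2 ?_) hM)
    exact mul_le_mul_of_nonneg_left (hP.supp p h).2.1 hγ.le

theorem IsTriangleKernel.norm_mul_le {d γ M : ℝ} (hγ : 0 < γ) (hM : 0 ≤ M) {P : ℝ × ℝ → ℝ}
    (hP : IsTriangleKernel d γ M P) {y : ℝ → ℝ} {B : ℝ} (hB : ∀ ρ, |y ρ| ≤ B) (t ρ : ℝ) :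
    ‖P (t, ρ) * y ρ‖ ≤ (Icc (-d) d).indicator (fun _ => M * Real.exp (γ * d) * B) ρ := by
  have hB0 : 0 ≤ B := (abs_nonneg _).trans (hB 0)
  by_cases h : P (t, ρ) = 0
  · rw [h, zero_mul, norm_zero]
    exact indicator_nonneg (fun _ _ => by positivity) _
  · obtain ⟨h1, h2, h3, h4⟩ := hP.supp _ h
    rw [indicator_of_mem (show ρ ∈ Icc (-d) d from ⟨by simp at *; linarith, by simp at *; linarith⟩),
      norm_mul]
    exact mul_le_mul (hP.abs_le hγ hM _) (hB ρ) (norm_nonneg _) (by positivity)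

theorem IsTriangleKernel.integrable_mul {d γ M : ℝ} (hγ : 0 < γ) (hM : 0 ≤ M) {P : ℝ × ℝ → ℝ}
    (hP : IsTriangleKernel d γ M P) {y : ℝ → ℝ} (hy : Continuous y) {B : ℝ}
    (hB : ∀ ρ, |y ρ| ≤ B) (t : ℝ) : Integrable (fun ρ => P (t, ρ) * y ρ) := by
  refine Integrable.mono' (integrable_indicator_Icc_const _ _ _) ?_ (.of_forall fun ρ => hP.norm_mul_le hγ hM hB t ρ)
  exact ((hP.meas.comp measurable_prodMk_left).mul hy.measurable).aestronglyMeasurable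

theorem IsTriangleKernel.norm_integral_le {d γ M : ℝ} (hd : 0 < d) (hγ : 0 < γ) (hM : 0 ≤ M)
    {P : ℝ × ℝ → ℝ} (hP : IsTriangleKernel d γ M P) {y : ℝ → ℝ} {B : ℝ}
    (hB : ∀ ρ, |y ρ| ≤ B) (t : ℝ) :
    ∫ ρ, ‖P (t, ρ) * y ρ‖ ≤ M * (Real.exp (γ * d) * B * (2 * d)) := by
  refine (integral_mono_of_nonneg (.of_forall fun _ => norm_nonneg _)
    (integrable_indicator_Icc_const _ _ _)
    (.of_forall fun ρ => hP.norm_mul_le hγ hM hB t ρ)).trans (le_of_eq ?_)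
  rw [integral_indicator measurableSet_Icc, integral_const, measureReal_restrict_apply_univ,
    Real.volume_real_Icc_of_le (by linarith), smul_eq_mul]
  ring

theorem IsTriangleKernel.isBddMeasOn {d γ M : ℝ} (hd : 0 < d) (hγ : 0 < γ) (hM : 0 ≤ M)
    {P : ℝ × ℝ → ℝ} (hP : IsTriangleKernel d γ M P) {y : ℝ → ℝ} (hy : Continuous y) {B : ℝ}
    (hB : ∀ ρ, |y ρ| ≤ B) : IsBddMeasOn d (fun t => ∫ ρ, P (t, ρ) * y ρ) := by
  refine ⟨?_, _, fun t _ => (norm_integral_le_integral_norm _).trans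
    (hP.norm_integral_le hd hγ hM hB t)⟩
  have h : StronglyMeasurable (Function.uncurry fun t ρ => P (t, ρ) * y ρ) :=
    (hP.meas.mul (hy.measurable.comp measurable_snd)).stronglyMeasurable
  exact h.integral_prod_right.aestronglyMeasurable

/-- **Transmutation**: the solutions of the integral form of `-Y'' + Q Y = lam² Y` are obtained from
those with `Q = 0` and the same Cauchy data at `0` by adding a Volterra integral whose kernel does
not depend on `lam`. -/
theorem exists_transmutation_kernel {d : ℝ} (hd : 0 < d) {Q : ℝ → ℝ} (hQm : Measurable Q)
    (hQ : MemLp Q 2 volume) :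
    ∃ (P : ℝ × ℝ → ℝ) (M : ℝ), Measurable P ∧ (∀ p, |P p| ≤ M) ∧
      (∀ p, P p ≠ 0 → 0 < p.1 ∧ p.1 ≤ d ∧ -p.1 ≤ p.2 ∧ p.2 ≤ p.1) ∧
      ∀ lam > 0, ∀ (α β : ℝ) (Y : ℝ → ℝ), ContinuousOn Y (Icc 0 d) →
        (∀ t ∈ Icc 0 d, Y t = freeSol lam α β t + duhamel lam Q Y t) →
        ∀ t ∈ Icc 0 d, Y t = freeSol lam α β t + ∫ ρ, P (t, ρ) * freeSol lam α β ρ := by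
  obtain ⟨γ, hγ, hw⟩ := exists_weight hd hQ
  set M := ∫ s in Ioc 0 d, |Q s| with hM
  have hM0 : 0 ≤ M := integral_nonneg fun _ => abs_nonneg _
  have hker : ∀ n, IsTriangleKernel d γ (M * (1 / 2) ^ n) (kernelTerm d Q n) :=
    fun n => isTriangleKernel_kernelTerm hQm hQ hγ hw n
  have hMn : ∀ n : ℕ, 0 ≤ M * (1 / 2) ^ n := fun n => by positivity
  have hgeo : HasSum (fun n : ℕ => M * (1 / 2) ^ n * Real.exp (γ * d))
      (M * 2 * Real.exp (γ * d)) := (hasSum_geometric_two.mul_left M).mul_right _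
  have hle : ∀ n p, ‖kernelTerm d Q n p‖ ≤ M * (1 / 2) ^ n * Real.exp (γ * d) :=
    fun n p => (hker n).abs_le hγ (hMn n) p
  have hsum : ∀ p, Summable fun n => kernelTerm d Q n p := fun p =>
    Summable.of_norm_bounded hgeo.summable fun n => hle n p
  refine ⟨fun p => ∑' n, kernelTerm d Q n p, M * 2 * Real.exp (γ * d), ?_, ?_, ?_, ?_⟩
  · refine measurable_of_tendsto_metrizable (f := fun n p => ∑ k ∈ Finset.range n, kernelTerm d Q k p)
      (fun n => Finset.measurable_fun_sum _ fun k _ => (hker k).meas) ?_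
    exact tendsto_pi_nhds.2 fun p => (hsum p).hasSum.tendsto_sum_nat
  · exact fun p => tsum_of_norm_bounded hgeo fun n => hle n p
  · intro p hp
    obtain ⟨n, hn⟩ : ∃ n, kernelTerm d Q n p ≠ 0 := by
      by_contra! h0
      exact hp (by simp [h0])
    exact (hker n).supp p hn
  · intro lam hl α β Y hYc hY t ht
    set y := freeSol lam α β with hy
    have hyc : Continuous y := continuous_freeSol lam α β
    set B := |α| + |β| / lam with hB
    have hyB : ∀ ρ, |y ρ| ≤ B := abs_freeSol_le hl α β
    set p : ℕ → ℝ → ℝ := fun n t => ∫ ρ, kernelTerm d Q n (t, ρ) * y ρ with hp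
    have hpb : ∀ n, IsBddMeasOn d (p n) := fun n => (hker n).isBddMeasOn hd hγ (hMn n) hyc hyB
    have hp0 : ∀ t ∈ Icc 0 d, duhamel lam Q y t = p 0 t := fun t ht =>
      duhamel_freeSol hQm hQ hl α β ht
    have hps : ∀ n, ∀ t ∈ Icc 0 d, duhamel lam Q (p n) t = p (n + 1) t := fun n t ht =>
      duhamel_kernel hQm hQ hγ (hMn n) (hker n) hl α β ht
    -- R n is Y - y minus the first n terms of the series. Duhamel's operator shifts R n to R (n +
    -- 1), so R n decays like 2⁻ⁿ in the weighted bound and the series sums to Y - y.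
    let R : ℕ → ℝ → ℝ := fun n => Nat.rec (fun t => Y t - y t) (fun n r t => r t - p n t) n
    have hRb : ∀ n, IsBddMeasOn d (R n) := fun n => by
      induction n with
      | zero => exact hYc.isBddMeasOn.sub hyc.continuousOn.isBddMeasOn
      | succ n ih => exact ih.sub (hpb n)
    have hRs : ∀ n, ∀ t ∈ Icc 0 d, duhamel lam Q (R n) t = R (n + 1) t := fun n => by
      induction n with
      | zero =>
        intro t ht
        refine (hYc.isBddMeasOn.duhamel_sub hyc.continuousOn.isBddMeasOn hQ lam ht).trans ?_
        rw [hp0 t ht]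
        change _ = Y t - y t - p 0 t
        rw [hY t ht]; ring
      | succ n ih =>
        intro t ht
        refine ((hRb n).duhamel_sub (hpb n) hQ lam ht).trans ?_
        rw [ih t ht, hps n t ht]
    obtain ⟨C, hC⟩ := (hRb 0).bdd
    have hC0 : 0 ≤ C := (abs_nonneg _).trans (hC t ht)
    have hRle : ∀ n, ∀ t ∈ Icc 0 d, |R n t| ≤ C * (1 / 2) ^ n * Real.exp (γ * t) := fun n => by
      induction n with
      | zero =>
        intro t ht
        have h1 : 1 ≤ Real.exp (γ * t) := Real.one_le_exp (mul_nonneg hγ.le ht.1)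
        have := hC t ht
        nlinarith
      | succ n ih =>
        intro t ht
        rw [← hRs n t ht, pow_succ, ← mul_assoc, mul_one_div]
        exact abs_duhamel_le hd hQ hw hl (by positivity) ih ht
    have hRlim : Filter.Tendsto (fun n => R n t) Filter.atTop (nhds 0) := by
      refine squeeze_zero_norm (fun n => hRle n t ht) ?_
      have := ((tendsto_pow_atTop_nhds_zero_of_lt_one (by norm_num : (0 : ℝ) ≤ 1 / 2)
        (by norm_num)).const_mul C).mul_const (Real.exp (γ * t))
      simpa using this
    have hReq : ∀ n, R n t = Y t - y t - ∑ k ∈ Finset.range n, p k t := fun n => by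
      induction n with
      | zero => simp [R]
      | succ n ih =>
        rw [Finset.sum_range_succ, ← sub_sub, ← ih]
    have hS : HasSum (fun n => p n t) (∫ ρ, ∑' n, kernelTerm d Q n (t, ρ) * y ρ) := by
      refine hasSum_integral_of_summable_integral_norm
        (fun n => (hker n).integrable_mul hγ (hMn n) hyc hyB t) ?_
      refine Summable.of_nonneg_of_le (fun n => integral_nonneg fun _ => norm_nonneg _)
        (fun n => (hker n).norm_integral_le hd hγ (hMn n) hyB t) ?_
      exact ((summable_geometric_two.mul_left M).mul_right _)
    have hlim2 : Filter.Tendsto (fun n => R n t) Filter.atTop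
        (nhds (Y t - y t - ∫ ρ, ∑' n, kernelTerm d Q n (t, ρ) * y ρ)) := by
      simp_rw [hReq]
      exact hS.tendsto_sum_nat.const_sub _
    have := tendsto_nhds_unique hRlim hlim2
    simp_rw [tsum_mul_right] at this
    linarith


/-! ### Functions with an integrable second derivative -/

/-- `y'` is the derivative of `y` on `[0, d]`, it is absolutely continuous, and its derivative is `F`
almost everywhere. -/
structure HasSecondDeriv (d : ℝ) (F y y' : ℝ → ℝ) : Prop where
  hasDeriv : ∀ x ∈ Icc 0 d, HasDerivWithinAt y (y' x) (Icc 0 d) x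
  absCont : AbsolutelyContinuousOnInterval y' 0 d
  eqn : ∀ᵐ x ∂(volIoo d), HasDerivAt y' (F x) x

theorem ae_mem_Ioo_of_volIoo {d : ℝ} {p : ℝ → Prop} (h : ∀ᵐ x ∂(volIoo d), p x) {a b : ℝ}
    (ha : a ∈ Icc 0 d) (hb : b ∈ Icc 0 d) :
    ∀ᵐ x, x ∈ uIoc a b → p x ∧ x ∈ Ioo 0 d := by
  have h1 : ∀ᵐ x : ℝ, x ≠ d := by simp [ae_iff, measure_singleton]
  filter_upwards [(ae_restrict_iff' measurableSet_Ioo).1 h, h1] with x h2 h3 hx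
  have h4 : 0 < x := (le_min ha.1 hb.1).trans_lt hx.1
  have h5 : x ≤ d := hx.2.trans (max_le ha.2 hb.2)
  have h6 : x ∈ Ioo 0 d := ⟨h4, lt_of_le_of_ne h5 h3⟩
  exact ⟨h2 h6, h6⟩

theorem absolutelyContinuousOnInterval_of_hasDerivWithinAt {d : ℝ} (hd : 0 < d) {z z' : ℝ → ℝ}
    (hz : ∀ x ∈ Icc 0 d, HasDerivWithinAt z (z' x) (Icc 0 d) x) (hz' : ContinuousOn z' (Icc 0 d)) :
    AbsolutelyContinuousOnInterval z 0 d := by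
  obtain ⟨C, hC⟩ := isCompact_Icc.exists_bound_of_continuousOn hz'
  have h := (convex_Icc (0 : ℝ) d).lipschitzOnWith_of_nnnorm_hasDerivWithin_le (C := C.toNNReal) hz
    (fun x hx => by
      rw [← NNReal.coe_le_coe, coe_nnnorm]
      exact (hC x hx).trans (Real.le_coe_toNNReal C))
  rw [← uIcc_of_le hd.le] at h
  exact h.absolutelyContinuousOnInterval

namespace HasSecondDeriv

variable {d : ℝ} {F y y' : ℝ → ℝ}

theorem continuousOn (H : HasSecondDeriv d F y y') : ContinuousOn y (Icc 0 d) :=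
  fun x hx => (H.hasDeriv x hx).continuousWithinAt

theorem continuousOn' (hd : 0 < d) (H : HasSecondDeriv d F y y') : ContinuousOn y' (Icc 0 d) := by
  rw [← uIcc_of_le hd.le]; exact H.absCont.continuousOn

/-- Integration by parts against a continuously differentiable function. -/
theorem parts (hd : 0 < d) (H : HasSecondDeriv d F y y') {z z' : ℝ → ℝ}
    (hz : ∀ x ∈ Icc 0 d, HasDerivWithinAt z (z' x) (Icc 0 d) x) (hz' : ContinuousOn z' (Icc 0 d))
    {a b : ℝ} (ha : a ∈ Icc 0 d) (hb : b ∈ Icc 0 d) :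
    ∫ x in a..b, (F x * z x + y' x * z' x) = y' b * z b - y' a * z a := by
  have hsub : uIcc a b ⊆ uIcc 0 d := by rw [uIcc_of_le hd.le]; exact uIcc_subset_Icc ha hb
  rw [← (H.absCont.mono hsub).integral_deriv_mul_eq_sub
    ((absolutelyContinuousOnInterval_of_hasDerivWithinAt hd hz hz').mono hsub)]
  refine intervalIntegral.integral_congr_ae ?_
  filter_upwards [ae_mem_Ioo_of_volIoo H.eqn ha hb] with x h hx
  obtain ⟨h1, h2⟩ := h hx
  rw [h1.deriv, ((hz x (Ioo_subset_Icc_self h2)).hasDerivAt (Icc_mem_nhds h2.1 h2.2)).deriv]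

theorem intervalIntegrable (hd : 0 < d) (H : HasSecondDeriv d F y y') {a b : ℝ}
    (ha : a ∈ Icc 0 d) (hb : b ∈ Icc 0 d) : IntervalIntegrable F volume a b := by
  have hsub : uIcc a b ⊆ uIcc 0 d := by rw [uIcc_of_le hd.le]; exact uIcc_subset_Icc ha hb
  refine (H.absCont.mono hsub).intervalIntegrable_deriv.congr_ae ?_
  rw [Filter.EventuallyEq, ae_restrict_iff' measurableSet_uIoc]
  filter_upwards [ae_mem_Ioo_of_volIoo H.eqn ha hb] with x h hx
  exact (h hx).1.deriv

/-- Lagrange's identity. -/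
theorem lagrange (hd : 0 < d) (H : HasSecondDeriv d F y y') {G z z' : ℝ → ℝ}
    (H' : HasSecondDeriv d G z z') :
    ∫ x in 0..d, (F x * z x - y x * G x) = (y' d * z d - y d * z' d) - (y' 0 * z 0 - y 0 * z' 0) := by
  have h0 : (0 : ℝ) ∈ Icc 0 d := ⟨le_rfl, hd.le⟩
  have hd' : d ∈ Icc 0 d := ⟨hd.le, le_rfl⟩
  have hu : uIcc 0 d = Icc 0 d := uIcc_of_le hd.le
  have h1 := H.parts hd H'.hasDeriv (H'.continuousOn' hd) h0 hd'
  have h2 := H'.parts hd H.hasDeriv (H.continuousOn' hd) h0 hd'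
  have i1 : IntervalIntegrable (fun x => F x * z x + y' x * z' x) volume 0 d :=
    ((H.intervalIntegrable hd h0 hd').mul_continuousOn (by rw [hu]; exact H'.continuousOn)).add
      (ContinuousOn.intervalIntegrable (by
        rw [hu]; exact (H.continuousOn' hd).mul (H'.continuousOn' hd)))
  have i2 : IntervalIntegrable (fun x => G x * y x + z' x * y' x) volume 0 d :=
    ((H'.intervalIntegrable hd h0 hd').mul_continuousOn (by rw [hu]; exact H.continuousOn)).add
      (ContinuousOn.intervalIntegrable (by
        rw [hu]; exact (H'.continuousOn' hd).mul (H.continuousOn' hd)))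
  have h3 := intervalIntegral.integral_sub i1 i2
  rw [h1, h2] at h3
  have h4 : ∫ x in 0..d, (F x * z x - y x * G x) =
      ∫ x in 0..d, (F x * z x + y' x * z' x - (G x * y x + z' x * y' x)) := by
    congr 1; ext x; ring
  rw [h4, h3]; ring

theorem integral_mul_deriv_add (hd : 0 < d) (H : HasSecondDeriv d F y y') {c c' : ℝ → ℝ}
    (hc : ∀ x, HasDerivAt c (c' x) x) (hc' : Continuous c') {a b : ℝ}
    (ha : a ∈ Icc 0 d) (hb : b ∈ Icc 0 d) :
    ∫ x in a..b, (y' x * c x + y x * c' x) = y b * c b - y a * c a := by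
  have hcc : Continuous c := continuous_iff_continuousAt.2 fun x => (hc x).continuousAt
  have hsub : uIcc a b ⊆ Icc 0 d := uIcc_subset_Icc ha hb
  refine intervalIntegral.integral_eq_sub_of_hasDeriv_right (f := fun x => y x * c x)
    ((H.continuousOn.mono hsub).mul hcc.continuousOn) (fun x hx => ?_) ?_
  · have hx' : x ∈ Ioo 0 d := ⟨(le_min ha.1 hb.1).trans_lt hx.1, hx.2.trans_le (max_le ha.2 hb.2)⟩
    exact (((H.hasDeriv x (Ioo_subset_Icc_self hx')).hasDerivAt
      (Icc_mem_nhds hx'.1 hx'.2)).mul (hc x)).hasDerivWithinAt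
  · exact ((((H.continuousOn' hd).mono hsub).mul hcc.continuousOn).add
      ((H.continuousOn.mono hsub).mul hc'.continuousOn)).intervalIntegrable

theorem congr {G : ℝ → ℝ} (H : HasSecondDeriv d F y y') (h : F =ᵐ[volIoo d] G) :
    HasSecondDeriv d G y y' :=
  ⟨H.hasDeriv, H.absCont, by filter_upwards [H.eqn, h] with x h1 h2; rwa [← h2]⟩

theorem add {G z z' : ℝ → ℝ} (H : HasSecondDeriv d F y y') (H' : HasSecondDeriv d G z z') :
    HasSecondDeriv d (fun x => F x + G x) (fun x => y x + z x) (fun x => y' x + z' x) :=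
  ⟨fun x hx => (H.hasDeriv x hx).add (H'.hasDeriv x hx), H.absCont.add H'.absCont, by
    filter_upwards [H.eqn, H'.eqn] with x h1 h2; exact h1.add h2⟩

theorem const_mul (c : ℝ) (H : HasSecondDeriv d F y y') :
    HasSecondDeriv d (fun x => c * F x) (fun x => c * y x) (fun x => c * y' x) :=
  ⟨fun x hx => (H.hasDeriv x hx).const_mul c, H.absCont.const_mul c, by
    filter_upwards [H.eqn] with x h1; exact h1.const_mul c⟩

theorem deriv_eq_zero (hd : 0 < d) (H : HasSecondDeriv d F y y') (h : ∀ x ∈ Icc 0 d, y x = 0) :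
    ∀ x ∈ Icc 0 d, y' x = 0 := fun x hx => by
  have h1 := (H.hasDeriv x hx).congr (f₁ := fun _ => 0) (fun u hu => (h u hu).symm) (h x hx).symm
  exact ((uniqueDiffOn_Icc hd) x hx).eq_deriv _ h1 (hasDerivWithinAt_const x _ 0)

end HasSecondDeriv

theorem hasDerivAt_const_sub_mul (lam b x : ℝ) :
    HasDerivAt (fun x => lam * (b - x)) (-lam) x := by
  simpa using ((hasDerivAt_id x).const_sub b).const_mul lam

/-! ### Variation of constants and uniqueness for the homogeneous equation -/

section Homogeneous

variable {d : ℝ} {Q y y' : ℝ → ℝ} {lam : ℝ}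

/-- Variation of constants, based at `a`. -/
theorem HasSecondDeriv.eq_freeSol_add (hd : 0 < d) (hl : 0 < lam)
    (H : HasSecondDeriv d (fun x => (Q x - lam ^ 2) * y x) y y') {a b : ℝ}
    (ha : a ∈ Icc 0 d) (hb : b ∈ Icc 0 d) :
    y b = freeSol lam (y a) (y' a) (b - a) +
      ∫ x in a..b, Real.sin (lam * (b - x)) / lam * (Q x * y x) := by
  have hu : uIcc a b ⊆ Icc 0 d := uIcc_subset_Icc ha hb
  have hs : ∀ x, HasDerivAt (fun x => Real.sin (lam * (b - x)) / lam)
      (-Real.cos (lam * (b - x))) x := fun x =>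
    ((hasDerivAt_const_sub_mul lam b x).sin.div_const lam).congr_deriv (by field_simp)
  have hc : ∀ x, HasDerivAt (fun x => Real.cos (lam * (b - x)))
      (lam * Real.sin (lam * (b - x))) x := fun x =>
    ((hasDerivAt_const_sub_mul lam b x).cos).congr_deriv (by ring)
  have hsc : Continuous fun x => Real.sin (lam * (b - x)) / lam :=
    continuous_iff_continuousAt.2 fun x => (hs x).continuousAt
  -- Two integrations by parts against sin(λ(b - x))/λ and its derivative; this function solves the
  -- free equation, so the λ² terms cancel in the sum and only Q y remains.
  have h1 := H.parts hd (fun x _ => (hs x).hasDerivWithinAt) (by fun_prop) ha hb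
  have h2 := H.integral_mul_deriv_add hd hc (by fun_prop) ha hb
  have i1 : IntervalIntegrable (fun x => (Q x - lam ^ 2) * y x * (Real.sin (lam * (b - x)) / lam) +
      y' x * -Real.cos (lam * (b - x))) volume a b :=
    ((H.intervalIntegrable hd ha hb).mul_continuousOn hsc.continuousOn).add
      (ContinuousOn.intervalIntegrable (((H.continuousOn' hd).mono hu).mul (by fun_prop)))
  have i2 : IntervalIntegrable (fun x => y' x * Real.cos (lam * (b - x)) +
      y x * (lam * Real.sin (lam * (b - x)))) volume a b :=
    (ContinuousOn.intervalIntegrable (((H.continuousOn' hd).mono hu).mul (by fun_prop))).add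
      (ContinuousOn.intervalIntegrable ((H.continuousOn.mono hu).mul (by fun_prop)))
  have h3 := intervalIntegral.integral_add i1 i2
  rw [h1, h2] at h3
  have h4 : ∫ x in a..b, Real.sin (lam * (b - x)) / lam * (Q x * y x) =
      ∫ x in a..b, ((Q x - lam ^ 2) * y x * (Real.sin (lam * (b - x)) / lam) +
      y' x * -Real.cos (lam * (b - x)) + (y' x * Real.cos (lam * (b - x)) +
      y x * (lam * Real.sin (lam * (b - x))))) := by
    congr 1; ext x; field_simp; ring
  rw [h4, h3, freeSol]
  simp

/-- Variation of constants for the derivative. -/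
theorem HasSecondDeriv.deriv_eq (hd : 0 < d) (H : HasSecondDeriv d (fun x => (Q x - lam ^ 2) * y x) y y')
    {a b : ℝ} (ha : a ∈ Icc 0 d) (hb : b ∈ Icc 0 d) :
    y' b = y' a * Real.cos (lam * (b - a)) - lam * (y a * Real.sin (lam * (b - a))) +
      ∫ x in a..b, Real.cos (lam * (b - x)) * (Q x * y x) := by
  have hu : uIcc a b ⊆ Icc 0 d := uIcc_subset_Icc ha hb
  have hs : ∀ x, HasDerivAt (fun x => lam * Real.sin (lam * (b - x)))
      (-(lam ^ 2 * Real.cos (lam * (b - x)))) x := fun x =>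
    ((hasDerivAt_const_sub_mul lam b x).sin.const_mul lam).congr_deriv (by ring)
  have hc : ∀ x, HasDerivAt (fun x => Real.cos (lam * (b - x)))
      (lam * Real.sin (lam * (b - x))) x := fun x =>
    ((hasDerivAt_const_sub_mul lam b x).cos).congr_deriv (by ring)
  have h1 := H.parts hd (fun x _ => (hc x).hasDerivWithinAt) (by fun_prop) ha hb
  have h2 := H.integral_mul_deriv_add hd hs (by fun_prop) ha hb
  have i1 : IntervalIntegrable (fun x => (Q x - lam ^ 2) * y x * Real.cos (lam * (b - x)) +
      y' x * (lam * Real.sin (lam * (b - x)))) volume a b :=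
    ((H.intervalIntegrable hd ha hb).mul_continuousOn (by fun_prop)).add
      (ContinuousOn.intervalIntegrable (((H.continuousOn' hd).mono hu).mul (by fun_prop)))
  have i2 : IntervalIntegrable (fun x => y' x * (lam * Real.sin (lam * (b - x))) +
      y x * -(lam ^ 2 * Real.cos (lam * (b - x)))) volume a b :=
    (ContinuousOn.intervalIntegrable (((H.continuousOn' hd).mono hu).mul (by fun_prop))).add
      (ContinuousOn.intervalIntegrable ((H.continuousOn.mono hu).mul (by fun_prop)))
  have h3 := intervalIntegral.integral_sub i1 i2
  rw [h1, h2] at h3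
  have h4 : ∫ x in a..b, Real.cos (lam * (b - x)) * (Q x * y x) =
      ∫ x in a..b, ((Q x - lam ^ 2) * y x * Real.cos (lam * (b - x)) +
      y' x * (lam * Real.sin (lam * (b - x))) - (y' x * (lam * Real.sin (lam * (b - x))) +
      y x * -(lam ^ 2 * Real.cos (lam * (b - x))))) := by
    congr 1; ext x; ring
  rw [h4, h3]
  simp
  ring

theorem HasSecondDeriv.eq_duhamel (hd : 0 < d) (hl : 0 < lam)
    (H : HasSecondDeriv d (fun x => (Q x - lam ^ 2) * y x) y y') :
    ∀ t ∈ Icc 0 d, y t = freeSol lam (y 0) (y' 0) t + duhamel lam Q y t := fun t ht => by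
  have h := H.eq_freeSol_add hd hl ⟨le_rfl, hd.le⟩ ht
  rwa [sub_zero] at h

/-- Reflection makes d the base point, so the free part carries the Cauchy data at the
discontinuity, where the interface conditions act. The slope changes sign. -/
theorem HasSecondDeriv.eq_duhamel_reflect (hd : 0 < d) (hl : 0 < lam)
    (H : HasSecondDeriv d (fun x => (Q x - lam ^ 2) * y x) y y') :
    ∀ t ∈ Icc 0 d, y (d - t) = freeSol lam (y d) (-y' d) t +
      duhamel lam (fun s => Q (d - s)) (fun s => y (d - s)) t := fun t ht => by
  have h := H.eq_freeSol_add hd hl (a := d) (b := d - t) ⟨hd.le, le_rfl⟩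
    ⟨by linarith [ht.2], by linarith [ht.1]⟩
  rw [h]
  congr 1
  · rw [show d - t - d = -t by ring]; simp [freeSol]; ring
  · rw [duhamel, intervalIntegral.integral_symm]
    have h2 := intervalIntegral.integral_comp_sub_left (a := 0) (b := t)
      (fun x => Real.sin (lam * (d - t - x)) / lam * (Q x * y x)) d
    rw [sub_zero] at h2
    rw [← h2, ← intervalIntegral.integral_neg]
    congr 1
    ext s
    rw [show lam * (d - t - (d - s)) = -(lam * (t - s)) by ring, Real.sin_neg]
    ring

theorem continuousOn_reflect (hy : ContinuousOn y (Icc 0 d)) :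
    ContinuousOn (fun t => y (d - t)) (Icc 0 d) :=
  hy.comp (by fun_prop) fun t ht => ⟨by linarith [ht.2], by linarith [ht.1]⟩

theorem memLp_reflect (d : ℝ) (hQ : MemLp Q 2 volume) : MemLp (fun s => Q (d - s)) 2 volume :=
  hQ.comp_measurePreserving (Measure.measurePreserving_sub_left volume d)

theorem freeSol_zero (lam : ℝ) : freeSol lam 0 0 = fun _ => 0 := by
  ext x; simp [freeSol]

/-- A solution with zero Cauchy data at `0` vanishes. -/
theorem HasSecondDeriv.eq_zero (hd : 0 < d) (hl : 0 < lam) (hQm : Measurable Q)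
    (hQ : MemLp Q 2 volume) (H : HasSecondDeriv d (fun x => (Q x - lam ^ 2) * y x) y y')
    (h0 : y 0 = 0) (h0' : y' 0 = 0) : ∀ t ∈ Icc 0 d, y t = 0 := fun t ht => by
  obtain ⟨P, M, -, -, -, hP⟩ := exists_transmutation_kernel hd hQm hQ
  have h := H.eq_duhamel hd hl
  rw [h0, h0'] at h
  have := hP lam hl 0 0 y H.continuousOn h t ht
  simpa [freeSol_zero] using this

/-- A solution with zero Cauchy data at `d` vanishes. -/
theorem HasSecondDeriv.eq_zero_of_right (hd : 0 < d) (hl : 0 < lam) (hQm : Measurable Q)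
    (hQ : MemLp Q 2 volume) (H : HasSecondDeriv d (fun x => (Q x - lam ^ 2) * y x) y y')
    (h0 : y d = 0) (h0' : y' d = 0) : ∀ t ∈ Icc 0 d, y t = 0 := fun t ht => by
  obtain ⟨P, M, -, -, -, hP⟩ := exists_transmutation_kernel hd
    (hQm.comp (measurable_const.sub measurable_id)) (memLp_reflect d hQ)
  have h := H.eq_duhamel_reflect hd hl
  rw [h0, h0', neg_zero] at h
  have := hP lam hl 0 0 _ (continuousOn_reflect H.continuousOn) h (d - t)
    ⟨by linarith [ht.2], by linarith [ht.1]⟩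
  simpa [freeSol_zero] using this

end Homogeneous


/-! ### The inhomogeneous equation `y'' = Q y - f` -/

theorem HasSecondDeriv.of_integral {d : ℝ} (hd : 0 < d) {G : ℝ → ℝ}
    (hG : Integrable G (volIoo d)) (α β : ℝ) :
    ∃ y y' : ℝ → ℝ, HasSecondDeriv d G y y' ∧ (∀ t ∈ Icc 0 d, y' t = β + ∫ s in 0..t, G s) ∧
      (∀ t ∈ Icc 0 d, y t = α + ∫ s in 0..t, y' s) := by
  -- Extension by zero makes the density integrable on the whole line, so its primitive is
  -- continuous everywhere.
  set G' : ℝ → ℝ := (Ioo 0 d).indicator G with hG'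
  have hi : Integrable G' := (integrable_indicator_iff measurableSet_Ioo).2 hG
  have hii : ∀ a b, IntervalIntegrable G' volume a b := fun a b => hi.intervalIntegrable
  have hcont : Continuous fun t => ∫ s in 0..t, G' s := intervalIntegral.continuous_primitive hii 0
  have hGG : ∀ t ∈ Icc 0 d, ∫ s in 0..t, G' s = ∫ s in 0..t, G s := fun t ht => by
    refine intervalIntegral.integral_congr_ae ?_
    have h : ∀ᵐ x ∂(volIoo d), True := .of_forall fun _ => trivial
    filter_upwards [ae_mem_Ioo_of_volIoo h ⟨le_rfl, hd.le⟩ ht] with x hx hx'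
    exact indicator_of_mem (hx hx').2 _
  set w : ℝ → ℝ := fun t => β + ∫ s in 0..t, G' s with hw
  have hwc : Continuous w := continuous_const.add hcont
  refine ⟨fun t => α + ∫ s in 0..t, w s, w, ⟨fun x _ => ?_, ?_, ?_⟩, fun t ht => ?_, fun t _ => rfl⟩
  · exact ((hwc.integral_hasStrictDerivAt 0 x).hasDerivAt.const_add α).hasDerivWithinAt
  · have h1 : AbsolutelyContinuousOnInterval (fun _ : ℝ => β) 0 d :=
      (LipschitzWith.const' (K := 0) β).lipschitzOnWith.absolutelyContinuousOnInterval
    exact h1.add ((hii 0 d).absolutelyContinuousOnInterval_intervalIntegral left_mem_uIcc)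
  · have h := LocallyIntegrable.ae_hasDerivAt_integral hi.locallyIntegrable
    filter_upwards [ae_restrict_of_ae h, ae_restrict_mem measurableSet_Ioo] with x h1 hx
    have h2 := (h1 0).const_add β
    rwa [hG', indicator_of_mem hx] at h2
  · rw [hw]; simp only; rw [hGG t ht]

/-- The solution operator of `y'' = Q y - f` with zero Cauchy data at `0`: it is compact, and the
Cauchy data at `d` depend continuously on `f`. Solutions with arbitrary Cauchy data exist as well. -/
theorem exists_solution_operator {d : ℝ} (hd : 0 < d) {Q : ℝ → ℝ} (hQm : Measurable Q)
    (hQ : MemLp Q 2 volume) :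
    (∀ α β : ℝ, ∃ y y', HasSecondDeriv d (fun x => Q x * y x) y y' ∧ y 0 = α ∧ y' 0 = β) ∧
    ∃ (Z : LTwo d →L[ℝ] LTwo d) (e e' : LTwo d →L[ℝ] ℝ), IsCompactOperator Z ∧
      ∀ f : LTwo d, ∃ y y', HasSecondDeriv d (fun x => Q x * y x - f x) y y' ∧
        y 0 = 0 ∧ y' 0 = 0 ∧ y =ᵐ[volIoo d] Z f ∧ y d = e f ∧ y' d = e' f := by
  have hQd : MemLp Q 2 (volIoo d) := hQ.restrict _
  obtain ⟨J, hJ, hJV⟩ := exists_integration_operator (d := d)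
  have hJc := isCompactOperator_integration hd hJ
  have hmeas : Measurable (Function.uncurry fun t u : ℝ => if u ≤ t then Q u else 0) :=
    Measurable.ite (measurableSet_le measurable_snd measurable_fst) (hQm.comp measurable_snd)
      measurable_const
  obtain ⟨A, hA, hAV⟩ := exists_kernel_operator (d := d) hmeas (m := fun u => |Q u|)
    hQd.abs (fun t _ u _ => by split_ifs <;> simp) (fun t u h => if_neg (not_le.2 h))
  have hA' : ∀ f : LTwo d, A f =ᵐ[volIoo d] fun t => ∫ u in 0..t, Q u * f u := fun f => by
    filter_upwards [hA f, ae_restrict_mem measurableSet_Ioo] with t h1 ht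
    rw [h1, ← integral_indicator_Iic_mul ht.1.le ht.2.le]
    congr 1; ext u; by_cases h : u ≤ t <;> simp [h]
  -- Two integrations turn the equation into u = α + βt - JJf + JAu with A u = ∫₀ᵗ Q u, so solving
  -- it amounts to inverting identity plus a Volterra operator.
  have hunit : IsUnit (1 - J * A) := by
    have := ((hJV.mul hAV).smul (-1)).isUnit_one_add_L2 hd.le
    rwa [neg_one_smul, ← sub_eq_add_neg] at this
  obtain ⟨U, hU⟩ := hunit
  have hUinv : ∀ g : LTwo d, (↑U⁻¹ : LTwo d →L[ℝ] LTwo d) g =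
      g + J (A ((↑U⁻¹ : LTwo d →L[ℝ] LTwo d) g)) := fun g => by
    have h := congrArg (fun T : LTwo d →L[ℝ] LTwo d => T g) U.mul_inv
    rw [hU] at h
    have h2 : (↑U⁻¹ : LTwo d →L[ℝ] LTwo d) g - J (A ((↑U⁻¹ : LTwo d →L[ℝ] LTwo d) g)) = g := h
    exact sub_eq_iff_eq_add.1 h2
  have hlin : ∀ α β : ℝ, MemLp (fun t : ℝ => α + β * t) 2 (volIoo d) := fun α β => by
    refine MemLp.of_bound (by fun_prop) (|α| + |β| * d) ?_
    filter_upwards [ae_restrict_mem measurableSet_Ioo] with t ht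
    refine (abs_add_le _ _).trans (add_le_add le_rfl ?_)
    rw [abs_mul, abs_of_pos ht.1]
    exact mul_le_mul_of_nonneg_left ht.2.le (abs_nonneg _)
  have hgen : ∀ (α β : ℝ) (f u : LTwo d), u = (hlin α β).toLp _ - J (J f) + J (A u) →
      ∃ y y', HasSecondDeriv d (fun x => Q x * y x - f x) y y' ∧ y 0 = α ∧ y' 0 = β ∧
        y =ᵐ[volIoo d] u ∧ (∀ t ∈ Icc 0 d, y' t = β + ∫ s in 0..t, (Q s * u s - f s)) ∧
        (∀ t ∈ Icc 0 d, y t = α + ∫ s in 0..t, y' s) := by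
    intro α β f u hu
    have hQu : Integrable (fun x => Q x * u x) (volIoo d) := hQd.integrable_mul (Lp.memLp u)
    have hG : Integrable (fun x => Q x * u x - f x) (volIoo d) := hQu.sub f.integrable
    obtain ⟨y, y', H, h1, h2⟩ := HasSecondDeriv.of_integral hd hG α β
    have h0 : (0 : ℝ) ∈ Icc 0 d := ⟨le_rfl, hd.le⟩
    have hy' : y' =ᵐ[volIoo d] fun t => β + (A u) t - (J f) t := by
      filter_upwards [hA' u, hJ f, ae_restrict_mem measurableSet_Ioo] with t h3 h4 ht
      have hQi : IntervalIntegrable (fun x => Q x * u x) volume 0 t := by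
        refine ((intervalIntegrable_iff_integrableOn_Ioo_of_le ht.1.le).2 ?_)
        exact IntegrableOn.mono_set hQu (Ioo_subset_Ioo_right ht.2.le)
      rw [h1 t (Ioo_subset_Icc_self ht), h3, h4, intervalIntegral.integral_sub hQi
        (f.intervalIntegrable h0 (Ioo_subset_Icc_self ht))]
      ring
    have hyu : y =ᵐ[volIoo d] u := by
      have h5 : u =ᵐ[volIoo d] fun t => α + β * t - (∫ s in 0..t, (J f) s) +
          ∫ s in 0..t, (A u) s := by
        have h6 := Lp.coeFn_add ((hlin α β).toLp _ - J (J f)) (J (A u))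
        have h7 := Lp.coeFn_sub ((hlin α β).toLp _) (J (J f))
        rw [← hu] at h6
        filter_upwards [h6, h7, (hlin α β).coeFn_toLp, hJ (J f), hJ (A u)]
          with t g1 g2 g3 g4 g5
        rw [g1, Pi.add_apply, g2, Pi.sub_apply, g3, g4, g5]
      filter_upwards [h5, ae_restrict_mem measurableSet_Ioo] with t g1 ht
      have ht' := Ioo_subset_Icc_self ht
      rw [g1, h2 t ht']
      have g2 : ∫ s in 0..t, y' s = ∫ s in 0..t, (β + (A u) s - (J f) s) := by
        refine intervalIntegral.integral_congr_ae ?_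
        filter_upwards [ae_mem_Ioo_of_volIoo hy' h0 ht'] with x hx hx'
        exact (hx hx').1
      rw [g2, intervalIntegral.integral_sub
        (intervalIntegrable_const.add ((A u).intervalIntegrable h0 ht'))
        ((J f).intervalIntegrable h0 ht'), intervalIntegral.integral_add
        intervalIntegrable_const ((A u).intervalIntegrable h0 ht'),
        intervalIntegral.integral_const]
      simp; ring
    refine ⟨y, y', H.congr ?_, ?_, ?_, hyu, h1, h2⟩
    · filter_upwards [hyu] with x hx
      rw [hx]
    · rw [h2 0 h0]; simp
    · rw [h1 0 h0]; simp
  refine ⟨fun α β => ?_, ?_⟩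
  · obtain ⟨y, y', H, h1, h2, -⟩ := hgen α β 0 ((↑U⁻¹ : LTwo d →L[ℝ] LTwo d) ((hlin α β).toLp _))
      (by rw [map_zero, map_zero, sub_zero]; exact hUinv _)
    refine ⟨y, y', H.congr ?_, h1, h2⟩
    filter_upwards [Lp.coeFn_zero ℝ 2 (volIoo d)] with x hx
    rw [hx]; simp
  -- Zero Cauchy data leave Z = -(1 - JA)⁻¹J², compact because J is. The functionals `e'` and `e`
  -- are y'(d) = ∫(Q y - f) and y(d) = ∫y', written as inner products to make their continuity
  -- evident.
  · let Z : LTwo d →L[ℝ] LTwo d := -((↑U⁻¹ : LTwo d →L[ℝ] LTwo d) ∘L (J ∘L J))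
    let one : LTwo d := (memLp_const (1 : ℝ)).toLp _
    let e' : LTwo d →L[ℝ] ℝ := (innerSL ℝ (hQd.toLp Q)) ∘L Z - innerSL ℝ one
    let e : LTwo d →L[ℝ] ℝ := (innerSL ℝ one) ∘L (A ∘L Z - J)
    have hone : ∀ g : LTwo d, inner ℝ one g = ∫ x, g x ∂(volIoo d) := fun g => by
      rw [L2.inner_def]
      refine integral_congr_ae ?_
      filter_upwards [(memLp_const (μ := volIoo d) (p := 2) (1 : ℝ)).coeFn_toLp] with x hx
      rw [hx]; simp
    have hfull : ∀ g : ℝ → ℝ, ∫ x in 0..d, g x = ∫ x, g x ∂(volIoo d) := fun g => by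
      rw [intervalIntegral.integral_of_le hd.le, integral_Ioc_eq_integral_Ioo]
    have hd' : d ∈ Icc 0 d := ⟨hd.le, le_rfl⟩
    refine ⟨Z, e, e', ?_, fun f => ?_⟩
    · exact ((hJc.comp_clm J).clm_comp (↑U⁻¹ : LTwo d →L[ℝ] LTwo d)).neg
    · have hz : (hlin 0 0).toLp _ = (0 : LTwo d) := by
        rw [← MemLp.toLp_zero (MemLp.zero' (ε := ℝ))]
        congr 1; ext x; simp
      have hZ : Z f = (hlin 0 0).toLp _ - J (J f) + J (A (Z f)) := by
        have := hUinv (J (J f))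
        rw [hz, zero_sub]
        change -((↑U⁻¹ : LTwo d →L[ℝ] LTwo d) (J (J f))) = _ + J (A (-((↑U⁻¹ : LTwo d →L[ℝ] LTwo d) (J (J f)))))
        rw [map_neg, map_neg, ← neg_add, ← this]
      obtain ⟨y, y', H, h1, h2, h3, h4, h5⟩ := hgen 0 0 f (Z f) hZ
      have hQu : Integrable (fun x => Q x * Z f x) (volIoo d) := hQd.integrable_mul (Lp.memLp _)
      refine ⟨y, y', H, h1, h2, h3, ?_, ?_⟩
      · change _ = inner ℝ one (A (Z f) - J f)
        rw [hone, h5 d hd', zero_add, hfull]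
        refine integral_congr_ae ?_
        filter_upwards [hA' (Z f), hJ f, Lp.coeFn_sub (A (Z f)) (J f),
          ae_restrict_mem measurableSet_Ioo] with t g1 g2 g3 ht
        have hQi : IntervalIntegrable (fun x => Q x * Z f x) volume 0 t := by
          refine ((intervalIntegrable_iff_integrableOn_Ioo_of_le ht.1.le).2 ?_)
          exact IntegrableOn.mono_set hQu (Ioo_subset_Ioo_right ht.2.le)
        rw [g3, Pi.sub_apply, g1, g2, h4 t (Ioo_subset_Icc_self ht), zero_add,
          intervalIntegral.integral_sub hQi
          (f.intervalIntegrable ⟨le_rfl, hd.le⟩ (Ioo_subset_Icc_self ht))]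
      · change _ = inner ℝ (hQd.toLp Q) (Z f) - inner ℝ one f
        rw [hone, h4 d hd', zero_add, hfull, integral_sub hQu f.integrable, L2.inner_def]
        congr 1
        refine integral_congr_ae ?_
        filter_upwards [hQd.coeFn_toLp] with x hx
        rw [hx]; simp [mul_comm]


/-! ### The Hilbert space `L₂ ⊕ L₂` -/

namespace SLSpace

variable {d : ℝ}

/-- A bounded operator into `L₂ ⊕ L₂` from its components. -/
def pairL {E : Type*} [NormedAddCommGroup E] [NormedSpace ℝ E] (A B : E →L[ℝ] LTwo d) :
    E →L[ℝ] SLSpace d :=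
  ((WithLp.prodContinuousLinearEquiv 2 ℝ (LTwo d) (LTwo d)).symm : _ →L[ℝ] SLSpace d) ∘L A.prod B

/-- The first component. -/
def fstL (d : ℝ) : SLSpace d →L[ℝ] LTwo d := WithLp.fstL 2 ℝ (LTwo d) (LTwo d)

/-- The second component. -/
def sndL (d : ℝ) : SLSpace d →L[ℝ] LTwo d := WithLp.sndL 2 ℝ (LTwo d) (LTwo d)

theorem ext {f g : SLSpace d} (h1 : f.fst = g.fst) (h2 : f.snd = g.snd) : f = g :=
  (WithLp.ofLp_injective 2) (Prod.ext h1 h2)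

theorem inner_eq_integral (f g : SLSpace d) :
    inner ℝ f g = (∫ x, f.fst x * g.fst x ∂(volIoo d)) + ∫ x, f.snd x * g.snd x ∂(volIoo d) := by
  rw [WithLp.prod_inner_apply, L2.inner_def, L2.inner_def]
  simp [mul_comm]

theorem isCompactOperator_pairL {E : Type*} [NormedAddCommGroup E] [NormedSpace ℝ E]
    {A B : E →L[ℝ] LTwo d} (hA : IsCompactOperator A) (hB : IsCompactOperator B) :
    IsCompactOperator (pairL A B) := by
  have h1 : IsCompactOperator (pairL A (0 : E →L[ℝ] LTwo d)) :=
    hA.clm_comp (pairL (ContinuousLinearMap.id ℝ _) (0 : LTwo d →L[ℝ] LTwo d))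
  have h2 : IsCompactOperator (pairL (0 : E →L[ℝ] LTwo d) B) :=
    hB.clm_comp (pairL (0 : LTwo d →L[ℝ] LTwo d) (ContinuousLinearMap.id ℝ _))
  have h3 : pairL A B = pairL A (0 : E →L[ℝ] LTwo d) + pairL (0 : E →L[ℝ] LTwo d) B := by
    ext1 x
    refine ext ?_ ?_
    · exact (add_zero (A x)).symm
    · exact (zero_add (B x)).symm
  rw [h3]
  exact h1.add h2

end SLSpace

theorem ContinuousOn.memLp_volIoo {d : ℝ} {y : ℝ → ℝ} (hy : ContinuousOn y (Icc 0 d)) :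
    MemLp y 2 (volIoo d) := by
  obtain ⟨C, hC⟩ := isCompact_Icc.exists_bound_of_continuousOn hy
  refine MemLp.of_bound ((hy.mono Ioo_subset_Icc_self).aestronglyMeasurable measurableSet_Ioo) C ?_
  filter_upwards [ae_restrict_mem measurableSet_Ioo] with x hx
  exact hC x (Ioo_subset_Icc_self hx)

theorem eqOn_Icc_of_ae_volIoo {d : ℝ} (hd : 0 < d) {y z : ℝ → ℝ} (hy : ContinuousOn y (Icc 0 d))
    (hz : ContinuousOn z (Icc 0 d)) (h : y =ᵐ[volIoo d] z) : EqOn y z (Icc 0 d) :=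
  Measure.eqOn_Icc_of_ae_eq volume hd.ne (by rwa [← Measure.restrict_congr_set Ioo_ae_eq_Icc]) hy hz

theorem integral_volIoo_eq {d : ℝ} (hd : 0 < d) (g : ℝ → ℝ) :
    ∫ x, g x ∂(volIoo d) = ∫ x in 0..d, g x := by
  rw [intervalIntegral.integral_of_le hd.le, integral_Ioc_eq_integral_Ioo]

/-! ### Pairs satisfying the boundary and interface conditions -/

/-- A pair of functions with second derivatives `F₁`, `F₂` satisfying the boundary conditions at `0`
and the interface conditions at `d`. -/
structure IsSLPair (d h₁ h₂ a₁ a₂ : ℝ) (F₁ F₂ y₁ y₁' y₂ y₂' : ℝ → ℝ) : Prop where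
  fst : HasSecondDeriv d F₁ y₁ y₁'
  snd : HasSecondDeriv d F₂ y₂ y₂'
  bc₁ : y₁' 0 = h₁ * y₁ 0
  bc₂ : y₂' 0 = h₂ * y₂ 0
  jump : y₂ d = a₁ * y₁ d
  jump' : y₂' d + a₁⁻¹ * y₁' d + a₂ * y₁ d = 0

namespace IsSLPair

variable {d h₁ h₂ a₁ a₂ : ℝ} {F₁ F₂ y₁ y₁' y₂ y₂' G₁ G₂ z₁ z₁' z₂ z₂' : ℝ → ℝ}

/-- Self-adjointness: the Robin conditions cancel the terms at 0. At d the factors a₁ and a₁⁻¹ in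
the interface conditions make the two Wronskians opposite, while the a₂ terms cancel by symmetry. -/
theorem lagrange (hd : 0 < d) (ha : a₁ ≠ 0) (H : IsSLPair d h₁ h₂ a₁ a₂ F₁ F₂ y₁ y₁' y₂ y₂')
    (H' : IsSLPair d h₁ h₂ a₁ a₂ G₁ G₂ z₁ z₁' z₂ z₂') :
    (∫ x in 0..d, (F₁ x * z₁ x - y₁ x * G₁ x)) + ∫ x in 0..d, (F₂ x * z₂ x - y₂ x * G₂ x) = 0 := by
  rw [H.fst.lagrange hd H'.fst, H.snd.lagrange hd H'.snd, H.bc₁, H.bc₂, H'.bc₁, H'.bc₂, H.jump,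
    H'.jump]
  have h1 := H.jump'
  have h2 := H'.jump'
  have h3 : y₂' d = -(a₁⁻¹ * y₁' d + a₂ * y₁ d) := by linarith
  have h4 : z₂' d = -(a₁⁻¹ * z₁' d + a₂ * z₁ d) := by linarith
  rw [h3, h4]
  field_simp
  ring

theorem add_mul (H : IsSLPair d h₁ h₂ a₁ a₂ F₁ F₂ y₁ y₁' y₂ y₂')
    (H' : IsSLPair d h₁ h₂ a₁ a₂ G₁ G₂ z₁ z₁' z₂ z₂') (c : ℝ) :
    IsSLPair d h₁ h₂ a₁ a₂ (fun x => F₁ x + c * G₁ x) (fun x => F₂ x + c * G₂ x)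
      (fun x => y₁ x + c * z₁ x) (fun x => y₁' x + c * z₁' x)
      (fun x => y₂ x + c * z₂ x) (fun x => y₂' x + c * z₂' x) where
  fst := H.fst.add (H'.fst.const_mul c)
  snd := H.snd.add (H'.snd.const_mul c)
  bc₁ := by rw [H.bc₁, H'.bc₁]; ring
  bc₂ := by rw [H.bc₂, H'.bc₂]; ring
  jump := by rw [H.jump, H'.jump]; ring
  jump' := by linear_combination H.jump' + c * H'.jump'

theorem congr (H : IsSLPair d h₁ h₂ a₁ a₂ F₁ F₂ y₁ y₁' y₂ y₂') (e₁ : F₁ =ᵐ[volIoo d] G₁)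
    (e₂ : F₂ =ᵐ[volIoo d] G₂) : IsSLPair d h₁ h₂ a₁ a₂ G₁ G₂ y₁ y₁' y₂ y₂' :=
  ⟨H.fst.congr e₁, H.snd.congr e₂, H.bc₁, H.bc₂, H.jump, H.jump'⟩

/-- The pair as an element of `L₂ ⊕ L₂`. -/
def vec (H : IsSLPair d h₁ h₂ a₁ a₂ F₁ F₂ y₁ y₁' y₂ y₂') : SLSpace d :=
  WithLp.toLp 2 ((H.fst.continuousOn.memLp_volIoo).toLp y₁, (H.snd.continuousOn.memLp_volIoo).toLp y₂)

theorem vec_fst (H : IsSLPair d h₁ h₂ a₁ a₂ F₁ F₂ y₁ y₁' y₂ y₂') : H.vec.fst =ᵐ[volIoo d] y₁ :=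
  (H.fst.continuousOn.memLp_volIoo).coeFn_toLp

theorem vec_snd (H : IsSLPair d h₁ h₂ a₁ a₂ F₁ F₂ y₁ y₁' y₂ y₂') : H.vec.snd =ᵐ[volIoo d] y₂ :=
  (H.snd.continuousOn.memLp_volIoo).coeFn_toLp

end IsSLPair

theorem exists_kernel_of_det_eq_zero {p q r s : ℝ} (h : p * s - q * r = 0) :
    ∃ c₁ c₂ : ℝ, (c₁ ≠ 0 ∨ c₂ ≠ 0) ∧ p * c₁ + q * c₂ = 0 ∧ r * c₁ + s * c₂ = 0 := by
  by_cases h1 : q ≠ 0 ∨ p ≠ 0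
  · refine ⟨q, -p, ?_, by ring, by linarith⟩
    rcases h1 with h | h
    · exact Or.inl h
    · exact Or.inr (neg_ne_zero.2 h)
  · push Not at h1
    by_cases h2 : s ≠ 0 ∨ r ≠ 0
    · refine ⟨s, -r, ?_, by rw [h1.1, h1.2]; ring, by ring⟩
      rcases h2 with h | h
      · exact Or.inl h
      · exact Or.inr (neg_ne_zero.2 h)
    · push Not at h2
      exact ⟨1, 1, Or.inl one_ne_zero, by rw [h1.1, h1.2]; ring, by rw [h2.1, h2.2]; ring⟩

/-! ### Green operator, eigenfunctions and completeness -/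

section Green

variable {d h₁ h₂ a₁ a₂ : ℝ} {Q₁ Q₂ : ℝ → ℝ}

/-- If zero is not an eigenvalue, the problem has a compact symmetric Green operator. -/
theorem exists_green_operator (hd : 0 < d) (ha : a₁ ≠ 0) (hQ₁m : Measurable Q₁)
    (hQ₁ : MemLp Q₁ 2 volume) (hQ₂m : Measurable Q₂) (hQ₂ : MemLp Q₂ 2 volume)
    (h0 : ∀ y₁ y₁' y₂ y₂', IsSLPair d h₁ h₂ a₁ a₂ (fun x => Q₁ x * y₁ x) (fun x => Q₂ x * y₂ x)
      y₁ y₁' y₂ y₂' → y₁ 0 = 0 ∧ y₂ 0 = 0) :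
    ∃ G : SLSpace d →L[ℝ] SLSpace d, IsCompactOperator G ∧ G.IsSymmetric ∧
      ∀ f : SLSpace d, ∃ y₁ y₁' y₂ y₂', IsSLPair d h₁ h₂ a₁ a₂
        (fun x => Q₁ x * y₁ x - f.fst x) (fun x => Q₂ x * y₂ x - f.snd x) y₁ y₁' y₂ y₂' ∧
        (G f).fst =ᵐ[volIoo d] y₁ ∧ (G f).snd =ᵐ[volIoo d] y₂ := by
  obtain ⟨hex₁, Z₁, e₁, e₁', hZ₁c, hZ₁⟩ := exists_solution_operator hd hQ₁m hQ₁
  obtain ⟨hex₂, Z₂, e₂, e₂', hZ₂c, hZ₂⟩ := exists_solution_operator hd hQ₂m hQ₂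
  obtain ⟨φ₁, φ₁', H₁, hφ₁, hφ₁'⟩ := hex₁ 1 h₁
  obtain ⟨φ₂, φ₂', H₂, hφ₂, hφ₂'⟩ := hex₂ 1 h₂
  set p := a₁ * φ₁ d with hp
  set q := -φ₂ d with hq
  set r := a₁⁻¹ * φ₁' d + a₂ * φ₁ d with hr
  set s := φ₂' d with hs
  set D := p * s - q * r with hDdef
  -- D is the determinant of the interface conditions on c₁φ₁, c₂φ₂. If it vanished, a nontrivial
  -- combination would be an eigenfunction for the eigenvalue zero.
  have hD : D ≠ 0 := by
    intro hD
    obtain ⟨c₁, c₂, hc, hc1, hc2⟩ := exists_kernel_of_det_eq_zero hD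
    have := h0 (fun x => c₁ * φ₁ x) (fun x => c₁ * φ₁' x) (fun x => c₂ * φ₂ x) (fun x => c₂ * φ₂' x)
      ⟨(H₁.const_mul c₁).congr (.of_forall fun x => by ring),
        (H₂.const_mul c₂).congr (.of_forall fun x => by ring), by rw [hφ₁, hφ₁']; ring,
        by rw [hφ₂, hφ₂']; ring, by rw [hp, hq] at hc1; linarith, by
          rw [hr, hs] at hc2; linear_combination hc2⟩
    rw [hφ₁, hφ₂, mul_one, mul_one] at this
    rcases hc with h | h
    · exact h this.1
    · exact h this.2
  let R₁ : SLSpace d →L[ℝ] ℝ := e₂ ∘L SLSpace.sndL d - a₁ • (e₁ ∘L SLSpace.fstL d)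
  let R₂ : SLSpace d →L[ℝ] ℝ := -(e₂' ∘L SLSpace.sndL d) - a₁⁻¹ • (e₁' ∘L SLSpace.fstL d)
    - a₂ • (e₁ ∘L SLSpace.fstL d)
  -- Cramer's rule for the multiples of φ₁ and φ₂ that repair the interface conditions, whose
  -- defects for the particular solutions are R₁ and R₂. They add a finite-rank term to a compact
  -- operator.
  let C₁ : SLSpace d →L[ℝ] ℝ := D⁻¹ • (s • R₁ - q • R₂)
  let C₂ : SLSpace d →L[ℝ] ℝ := D⁻¹ • (p • R₂ - r • R₁)
  have hR₁ : ∀ f : SLSpace d, R₁ f = e₂ f.snd - a₁ * e₁ f.fst := fun f => rfl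
  have hR₂ : ∀ f : SLSpace d, R₂ f = -e₂' f.snd - a₁⁻¹ * e₁' f.fst - a₂ * e₁ f.fst := fun f => rfl
  have hC₁ : ∀ f, C₁ f = D⁻¹ * (s * R₁ f - q * R₂ f) := fun f => rfl
  have hC₂ : ∀ f, C₂ f = D⁻¹ * (p * R₂ f - r * R₁ f) := fun f => rfl
  have hsol1 : ∀ f, p * C₁ f + q * C₂ f = R₁ f := fun f => by
    rw [hC₁, hC₂]; field_simp; rw [hDdef]; ring
  have hsol2 : ∀ f, r * C₁ f + s * C₂ f = R₂ f := fun f => by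
    rw [hC₁, hC₂]; field_simp; rw [hDdef]; ring
  set ψ₁ : LTwo d := (H₁.continuousOn.memLp_volIoo).toLp φ₁ with hψ₁
  set ψ₂ : LTwo d := (H₂.continuousOn.memLp_volIoo).toLp φ₂ with hψ₂
  let A : SLSpace d →L[ℝ] LTwo d := Z₁ ∘L SLSpace.fstL d + C₁.smulRight ψ₁
  let B : SLSpace d →L[ℝ] LTwo d := Z₂ ∘L SLSpace.sndL d + C₂.smulRight ψ₂
  let G : SLSpace d →L[ℝ] SLSpace d := SLSpace.pairL A B
  have hGf : ∀ f : SLSpace d, ∃ y₁ y₁' y₂ y₂', IsSLPair d h₁ h₂ a₁ a₂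
        (fun x => Q₁ x * y₁ x - f.fst x) (fun x => Q₂ x * y₂ x - f.snd x) y₁ y₁' y₂ y₂' ∧
        (G f).fst =ᵐ[volIoo d] y₁ ∧ (G f).snd =ᵐ[volIoo d] y₂ := by
    intro f
    obtain ⟨z₁, z₁', K₁, k1, k2, k3, k4, k5⟩ := hZ₁ f.fst
    obtain ⟨z₂, z₂', K₂, l1, l2, l3, l4, l5⟩ := hZ₂ f.snd
    refine ⟨fun x => z₁ x + C₁ f * φ₁ x, fun x => z₁' x + C₁ f * φ₁' x,
      fun x => z₂ x + C₂ f * φ₂ x, fun x => z₂' x + C₂ f * φ₂' x,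
      ⟨(K₁.add (H₁.const_mul _)).congr (.of_forall fun x => by ring),
        (K₂.add (H₂.const_mul _)).congr (.of_forall fun x => by ring),
        by rw [k1, k2, hφ₁, hφ₁']; ring, by rw [l1, l2, hφ₂, hφ₂']; ring, ?_, ?_⟩, ?_, ?_⟩
    · have := hsol1 f
      rw [hR₁, hp, hq] at this
      rw [k4, l4]
      linear_combination -this
    · have := hsol2 f
      rw [hR₂, hr, hs] at this
      rw [k4, k5, l5]
      linear_combination this
    · have h1 : (G f).fst = Z₁ f.fst + C₁ f • ψ₁ := rfl
      rw [h1]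
      filter_upwards [Lp.coeFn_add (Z₁ f.fst) (C₁ f • ψ₁), Lp.coeFn_smul (C₁ f) ψ₁, k3,
        (H₁.continuousOn.memLp_volIoo).coeFn_toLp] with x m1 m2 m3 m4
      rw [m1, Pi.add_apply, m2, Pi.smul_apply, ← m3, hψ₁, m4, smul_eq_mul]
    · have h1 : (G f).snd = Z₂ f.snd + C₂ f • ψ₂ := rfl
      rw [h1]
      filter_upwards [Lp.coeFn_add (Z₂ f.snd) (C₂ f • ψ₂), Lp.coeFn_smul (C₂ f) ψ₂, l3,
        (H₂.continuousOn.memLp_volIoo).coeFn_toLp] with x m1 m2 m3 m4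
      rw [m1, Pi.add_apply, m2, Pi.smul_apply, ← m3, hψ₂, m4, smul_eq_mul]
  refine ⟨G, ?_, ?_, hGf⟩
  · exact SLSpace.isCompactOperator_pairL
      ((hZ₁c.comp_clm (SLSpace.fstL d)).add (isCompactOperator_rankOne C₁ ψ₁))
      ((hZ₂c.comp_clm (SLSpace.sndL d)).add (isCompactOperator_rankOne C₂ ψ₂))
  · intro f g
    change inner ℝ (G f) g = inner ℝ f (G g)
    obtain ⟨y₁, y₁', y₂, y₂', H, e1, e2⟩ := hGf f
    obtain ⟨z₁, z₁', z₂, z₂', K, m1, m2⟩ := hGf g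
    have hL := H.lagrange hd ha K
    rw [← integral_volIoo_eq hd, ← integral_volIoo_eq hd] at hL
    rw [SLSpace.inner_eq_integral, SLSpace.inner_eq_integral]
    have h3 : ∀ {Q y z : ℝ → ℝ} {f g u v : LTwo d}, u =ᵐ[volIoo d] y → v =ᵐ[volIoo d] z →
        ∫ x, ((Q x * y x - f x) * z x - y x * (Q x * z x - g x)) ∂(volIoo d) =
        (∫ x, u x * g x ∂(volIoo d)) - ∫ x, f x * v x ∂(volIoo d) := by
      intro Q y z f g u v hu hv
      have i1 : Integrable (fun x => u x * g x) (volIoo d) :=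
        (Lp.memLp u).integrable_mul (Lp.memLp g)
      have i2 : Integrable (fun x => f x * v x) (volIoo d) :=
        (Lp.memLp f).integrable_mul (Lp.memLp v)
      rw [← integral_sub i1 i2]
      refine integral_congr_ae ?_
      filter_upwards [hu, hv] with x h1 h2
      rw [h1, h2]; ring
    rw [h3 e1 m1, h3 e2 m2] at hL
    linarith

/-- An eigenfunction is determined by its value at the outer end of the second interval. -/
theorem IsSLPair.eq_zero (hd : 0 < d) (ha : a₁ ≠ 0) (hQ₁m : Measurable Q₁)
    (hQ₁ : MemLp Q₁ 2 volume) (hQ₂m : Measurable Q₂) (hQ₂ : MemLp Q₂ 2 volume)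
    {lam : ℝ} (hl : 0 < lam) {y₁ y₁' y₂ y₂' : ℝ → ℝ}
    (H : IsSLPair d h₁ h₂ a₁ a₂ (fun x => (Q₁ x - lam ^ 2) * y₁ x)
      (fun x => (Q₂ x - lam ^ 2) * y₂ x) y₁ y₁' y₂ y₂') (h0 : y₂ 0 = 0) :
    (∀ x ∈ Icc 0 d, y₁ x = 0) ∧ ∀ x ∈ Icc 0 d, y₂ x = 0 := by
  have h2 := H.snd.eq_zero hd hl hQ₂m hQ₂ h0 (by rw [H.bc₂, h0, mul_zero])
  have h2' := H.snd.deriv_eq_zero hd h2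
  have hd' : d ∈ Icc 0 d := ⟨hd.le, le_rfl⟩
  -- With a₁ ≠ 0 the interface conditions carry zero Cauchy data at d from the second interval to
  -- the first.
  have h3 : y₁ d = 0 := by
    have := H.jump
    rw [h2 d hd'] at this
    exact (mul_eq_zero.1 this.symm).resolve_left ha
  have h4 : y₁' d = 0 := by
    have := H.jump'
    rw [h2' d hd', h3, mul_zero, add_zero, zero_add] at this
    exact (mul_eq_zero.1 this).resolve_left (inv_ne_zero ha)
  exact ⟨H.fst.eq_zero_of_right hd hl hQ₁m hQ₁ h3 h4, h2⟩

/-- **Spectral theorem**: if all eigenvalues of the problem are positive, listed as `lam n ^ 2`, then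
the eigenfunctions are pairwise orthogonal and complete. -/
theorem eigenfunctions_orthogonal_complete (hd : 0 < d) (ha : a₁ ≠ 0) (hQ₁m : Measurable Q₁)
    (hQ₁ : MemLp Q₁ 2 volume) (hQ₂m : Measurable Q₂) (hQ₂ : MemLp Q₂ 2 volume)
    {lam : ℕ → ℝ} (hpos : ∀ n, 0 < lam n) (hmono : StrictMono lam)
    (hlam : ∀ (μ : ℝ) (y₁ y₁' y₂ y₂' : ℝ → ℝ), IsSLPair d h₁ h₂ a₁ a₂
      (fun x => (Q₁ x - μ) * y₁ x) (fun x => (Q₂ x - μ) * y₂ x) y₁ y₁' y₂ y₂' →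
      ((∃ x ∈ Icc 0 d, y₁ x ≠ 0) ∨ ∃ x ∈ Icc 0 d, y₂ x ≠ 0) → ∃ n, μ = lam n ^ 2)
    {Y₁ Y₁' Y₂ Y₂' : ℕ → ℝ → ℝ}
    (HY : ∀ n, IsSLPair d h₁ h₂ a₁ a₂ (fun x => (Q₁ x - lam n ^ 2) * Y₁ n x)
      (fun x => (Q₂ x - lam n ^ 2) * Y₂ n x) (Y₁ n) (Y₁' n) (Y₂ n) (Y₂' n))
    (hY : ∀ n, Y₂ n 0 = 1) :
    (∀ m n, m ≠ n → inner ℝ (HY m).vec (HY n).vec = 0) ∧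
      (Submodule.span ℝ (range fun n => (HY n).vec))ᗮ = ⊥ := by
  have h0mem : (0 : ℝ) ∈ Icc 0 d := ⟨le_rfl, hd.le⟩
  constructor
  · intro m n hmn
    have hne : lam n ^ 2 - lam m ^ 2 ≠ 0 := by
      intro h
      have h1 : lam m = lam n :=
        (pow_left_inj₀ (hpos m).le (hpos n).le two_ne_zero).1 (by linarith)
      exact hmn (hmono.injective h1)
    have hL := (HY m).lagrange hd ha (HY n)
    rw [← integral_volIoo_eq hd, ← integral_volIoo_eq hd] at hL
    have h3 : ∀ {Q y z : ℝ → ℝ} {u v : LTwo d}, u =ᵐ[volIoo d] y → v =ᵐ[volIoo d] z →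
        ∫ x, ((Q x - lam m ^ 2) * y x * z x - y x * ((Q x - lam n ^ 2) * z x)) ∂(volIoo d) =
        (lam n ^ 2 - lam m ^ 2) * ∫ x, u x * v x ∂(volIoo d) := by
      intro Q y z u v hu hv
      rw [← integral_const_mul]
      refine integral_congr_ae ?_
      filter_upwards [hu, hv] with x h1 h2
      rw [h1, h2]; ring
    rw [h3 (HY m).vec_fst (HY n).vec_fst, h3 (HY m).vec_snd (HY n).vec_snd, ← mul_add] at hL
    rw [SLSpace.inner_eq_integral]
    exact (mul_eq_zero.1 hL).resolve_left hne
  · obtain ⟨G, hGc, hGs, hG⟩ := exists_green_operator (h₁ := h₁) (h₂ := h₂) (a₂ := a₂) hd ha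
      hQ₁m hQ₁ hQ₂m hQ₂ (fun y₁ y₁' y₂ y₂' H => by
        by_contra hne
        obtain ⟨n, hn⟩ := hlam 0 y₁ y₁' y₂ y₂' (H.congr (.of_forall fun x => by simp)
          (.of_forall fun x => by simp)) (by
            by_contra hcon
            push Not at hcon
            exact hne ⟨hcon.1 0 h0mem, hcon.2 0 h0mem⟩)
        exact (pow_pos (hpos n) 2).ne hn)
    have hspec := ContinuousLinearMap.orthogonalComplement_iSup_eigenspaces_eq_bot hGc hGs
    refine eq_bot_iff.2 (le_trans (Submodule.orthogonal_le ?_) hspec.le)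
    refine iSup_le fun ν f hf => ?_
    have hGf : G f = ν • f := Module.End.mem_eigenspace_iff.1 hf
    obtain ⟨y₁, y₁', y₂, y₂', H, e1, e2⟩ := hG f
    rw [hGf] at e1 e2
    have hc1 := H.fst.continuousOn
    have hc2 := H.snd.continuousOn
    have s1 : (fun x => ν * f.fst x) =ᵐ[volIoo d] y₁ := by
      filter_upwards [e1, Lp.coeFn_smul ν f.fst] with x g1 g2
      rw [← g1]; exact g2.symm
    have s2 : (fun x => ν * f.snd x) =ᵐ[volIoo d] y₂ := by
      filter_upwards [e2, Lp.coeFn_smul ν f.snd] with x g1 g2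
      rw [← g1]; exact g2.symm
    -- Injectivity of the Green operator: if the solution vanishes, the equation forces the
    -- right-hand side to vanish. This disposes of the kernel eigenspace ν = 0.
    have hzero : ∀ {Q y y' : ℝ → ℝ} {g : LTwo d},
        HasSecondDeriv d (fun x => Q x * y x - g x) y y' → (∀ x ∈ Icc 0 d, y x = 0) → g = 0 := by
      intro Q y y' g K hy
      have hy' := K.deriv_eq_zero hd hy
      ext1
      filter_upwards [K.eqn, ae_restrict_mem measurableSet_Ioo, Lp.coeFn_zero ℝ 2 (volIoo d)]
        with x k1 hx k3
      have k2 : HasDerivAt y' 0 x := by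
        refine (hasDerivAt_const x (0 : ℝ)).congr_of_eventuallyEq ?_
        filter_upwards [Icc_mem_nhds hx.1 hx.2] with u hu
        exact hy' u hu
      have k4 := k1.unique k2
      rw [hy x (Ioo_subset_Icc_self hx), mul_zero, zero_sub, neg_eq_zero] at k4
      rw [k4, k3]; rfl
    by_cases hne : (∃ x ∈ Icc 0 d, y₁ x ≠ 0) ∨ ∃ x ∈ Icc 0 d, y₂ x ≠ 0
    · have hν : ν ≠ 0 := by
        rintro rfl
        have t1 : EqOn (fun _ => 0) y₁ (Icc 0 d) :=
          eqOn_Icc_of_ae_volIoo hd continuousOn_const hc1 (by simpa using s1)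
        have t2 : EqOn (fun _ => 0) y₂ (Icc 0 d) :=
          eqOn_Icc_of_ae_volIoo hd continuousOn_const hc2 (by simpa using s2)
        rcases hne with ⟨x, hx, h⟩ | ⟨x, hx, h⟩
        · exact h (t1 hx).symm
        · exact h (t2 hx).symm
      have H2 : IsSLPair d h₁ h₂ a₁ a₂ (fun x => (Q₁ x - ν⁻¹) * y₁ x)
          (fun x => (Q₂ x - ν⁻¹) * y₂ x) y₁ y₁' y₂ y₂' := by
        refine H.congr ?_ ?_
        · filter_upwards [s1] with x g1
          rw [← g1]; field_simp
        · filter_upwards [s2] with x g1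
          rw [← g1]; field_simp
      obtain ⟨n, hn⟩ := hlam _ _ _ _ _ H2 hne
      rw [hn] at H2
      -- Subtracting y₂(0) times the normalized eigenfunction leaves a solution whose second
      -- component vanishes at 0, hence the zero pair.
      have H3 := (H2.add_mul (HY n) (-y₂ 0)).congr
        (G₁ := fun x => (Q₁ x - lam n ^ 2) * (y₁ x + -y₂ 0 * Y₁ n x))
        (G₂ := fun x => (Q₂ x - lam n ^ 2) * (y₂ x + -y₂ 0 * Y₂ n x))
        (.of_forall fun x => by ring) (.of_forall fun x => by ring)
      obtain ⟨w1, w2⟩ := H3.eq_zero hd ha hQ₁m hQ₁ hQ₂m hQ₂ (hpos n) (by rw [hY]; ring)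
      have hfin : f = (ν⁻¹ * y₂ 0) • (HY n).vec := by
        refine SLSpace.ext ?_ ?_
        · ext1
          filter_upwards [s1, (HY n).vec_fst, Lp.coeFn_smul (ν⁻¹ * y₂ 0) (HY n).vec.fst,
            ae_restrict_mem measurableSet_Ioo] with x g1 g2 g3 hx
          have := w1 x (Ioo_subset_Icc_self hx)
          refine Eq.trans ?_ g3.symm
          rw [Pi.smul_apply, g2, smul_eq_mul]
          field_simp
          linarith
        · ext1
          filter_upwards [s2, (HY n).vec_snd, Lp.coeFn_smul (ν⁻¹ * y₂ 0) (HY n).vec.snd,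
            ae_restrict_mem measurableSet_Ioo] with x g1 g2 g3 hx
          have := w2 x (Ioo_subset_Icc_self hx)
          refine Eq.trans ?_ g3.symm
          rw [Pi.smul_apply, g2, smul_eq_mul]
          field_simp
          linarith
      rw [hfin]
      exact Submodule.smul_mem _ _ (Submodule.subset_span ⟨n, rfl⟩)
    · push Not at hne
      have : f = 0 := SLSpace.ext (hzero H.fst hne.1) (hzero H.snd hne.2)
      rw [this]
      exact Submodule.zero_mem _

end Green


/-! ### Riesz bases -/

/-- The operator that is diagonal in a Hilbert basis, with bounded diagonal entries. -/
theorem exists_diagonal_clm {E : Type*} [NormedAddCommGroup E] [InnerProductSpace ℝ E]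
    (b : HilbertBasis ℕ ℝ E) {r : ℕ → ℝ} {C : ℝ} (hC : 0 ≤ C) (hr : ∀ n, |r n| ≤ C) :
    ∃ D : E →L[ℝ] E, ∀ x n, b.repr (D x) n = r n * b.repr x n := by
  let M : lp (fun _ : ℕ => ℝ) 2 →L[ℝ] lp (fun _ : ℕ => ℝ) 2 :=
    lp.mapCLM 2 (fun n => r n • (1 : ℝ →L[ℝ] ℝ)) (K := C) hC (fun n => by
      rw [norm_smul, Real.norm_eq_abs]
      exact (mul_le_of_le_one_right (abs_nonneg _) ContinuousLinearMap.norm_id_le).trans (hr n))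
  refine ⟨(b.repr.symm : _ →L[ℝ] E) ∘L M ∘L (b.repr : E →L[ℝ] _), fun x n => ?_⟩
  change b.repr (b.repr.symm (M (b.repr x))) n = _
  rw [LinearIsometryEquiv.apply_symm_apply]
  rfl

/-- The image of a complete orthogonal system with norms bounded above and below under a bounded
invertible operator is a Riesz basis. -/
theorem isRieszBasis_of_orthogonal {E : Type*} [NormedAddCommGroup E] [InnerProductSpace ℝ E]
    [CompleteSpace E] {Φ : ℕ → E} (horth : ∀ m n, m ≠ n → inner ℝ (Φ m) (Φ n) = 0)
    (hcompl : (Submodule.span ℝ (range Φ))ᗮ = ⊥) {c C : ℝ} (hc : 0 < c) (hlow : ∀ n, c ≤ ‖Φ n‖)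
    (hup : ∀ n, ‖Φ n‖ ≤ C) (T : E ≃L[ℝ] E) : IsRieszBasis ℝ (fun n => T (Φ n)) := by
  have hpos : ∀ n, 0 < ‖Φ n‖ := fun n => hc.trans_le (hlow n)
  have hC : 0 ≤ C := (norm_nonneg _).trans (hup 0)
  set u : ℕ → E := fun n => ‖Φ n‖⁻¹ • Φ n with hu
  have hon : Orthonormal ℝ u := by
    refine ⟨fun n => ?_, fun m n hmn => ?_⟩
    · rw [hu]; simp only
      rw [norm_smul, norm_inv, norm_norm, inv_mul_cancel₀ (hpos n).ne']
    · rw [hu]; simp only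
      rw [inner_smul_left, inner_smul_right, horth m n hmn]; simp
  have hspan : (Submodule.span ℝ (range u))ᗮ = ⊥ := by
    refine eq_bot_iff.2 (le_trans (Submodule.orthogonal_le ?_) hcompl.le)
    refine Submodule.span_le.2 ?_
    rintro _ ⟨n, rfl⟩
    have : Φ n = ‖Φ n‖ • u n := by
      rw [hu]; simp only
      rw [smul_smul, mul_inv_cancel₀ (hpos n).ne', one_smul]
    rw [SetLike.mem_coe, this]
    exact Submodule.smul_mem _ _ (Submodule.subset_span ⟨n, rfl⟩)
  let b : HilbertBasis ℕ ℝ E := HilbertBasis.mkOfOrthogonalEqBot hon hspan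
  have hb : ∀ n, b n = u n := fun n => by
    rw [HilbertBasis.coe_mkOfOrthogonalEqBot hon hspan]
  obtain ⟨D, hD⟩ := exists_diagonal_clm b hC (r := fun n => ‖Φ n‖)
    (fun n => by rw [abs_norm]; exact hup n)
  obtain ⟨D', hD'⟩ := exists_diagonal_clm b (inv_nonneg.2 hc.le) (r := fun n => ‖Φ n‖⁻¹)
    (fun n => by rw [abs_inv, abs_norm]; exact inv_anti₀ hc (hlow n))
  have hext : ∀ x y : E, (∀ n, b.repr x n = b.repr y n) → x = y := fun x y h =>
    b.repr.injective (lp.ext (funext h))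
  -- The upper bound on the norms makes the diagonal operator bounded, and the lower bound makes its
  -- inverse bounded.
  let De : E ≃L[ℝ] E := ContinuousLinearEquiv.equivOfInverse D D'
    (fun x => hext _ _ fun n => by
      rw [hD', hD, ← mul_assoc, inv_mul_cancel₀ (hpos n).ne', one_mul])
    (fun x => hext _ _ fun n => by
      rw [hD, hD', ← mul_assoc, mul_inv_cancel₀ (hpos n).ne', one_mul])
  refine ⟨b, De.trans T, fun n => ?_⟩
  change T (Φ n) = T (D (b n))
  congr 1
  refine hext _ _ fun m => ?_
  rw [hD, hb, hu]
  simp only [map_smul]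
  rw [lp.coeFn_smul, Pi.smul_apply, smul_eq_mul]
  by_cases hmn : m = n
  · rw [hmn, ← mul_assoc, mul_inv_cancel₀ (hpos n).ne', one_mul]
  · have : b.repr (Φ n) m = 0 := by
      rw [HilbertBasis.repr_apply_apply, hb, hu]; simp only
      rw [inner_smul_left, horth m n hmn, mul_zero]
    rw [this]; simp

/-! ### Block Volterra operators and reflection -/

/-- The energy of a pair on `(0, t]`. -/
def pairEnergy (d t : ℝ) (f : SLSpace d) : ℝ := energy d t f.fst + energy d t f.snd

theorem SLSpace.norm_sq {d : ℝ} (f : SLSpace d) : ‖f‖ ^ 2 = ‖f.fst‖ ^ 2 + ‖f.snd‖ ^ 2 :=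
  WithLp.prod_norm_sq_eq_of_L2 f

/-- The operator on pairs given by a `2 × 2` matrix of operators. -/
def SLSpace.block {d : ℝ} (A B C D : LTwo d →L[ℝ] LTwo d) : SLSpace d →L[ℝ] SLSpace d :=
  SLSpace.pairL (A ∘L SLSpace.fstL d + B ∘L SLSpace.sndL d)
    (C ∘L SLSpace.fstL d + D ∘L SLSpace.sndL d)

theorem SLSpace.block_fst {d : ℝ} (A B C D : LTwo d →L[ℝ] LTwo d) (f : SLSpace d) :
    (SLSpace.block A B C D f).fst = A f.fst + B f.snd := rfl

theorem SLSpace.block_snd {d : ℝ} (A B C D : LTwo d →L[ℝ] LTwo d) (f : SLSpace d) :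
    (SLSpace.block A B C D f).snd = C f.fst + D f.snd := rfl

/-- Both components are measured up to the same t, so the off-diagonal entries are as harmless as
the diagonal ones and the whole block operator is Volterra. -/
theorem VolterraBound.block {d : ℝ} {A B C D : LTwo d →L[ℝ] LTwo d}
    (hA : VolterraBound d (energy d) A) (hB : VolterraBound d (energy d) B)
    (hC : VolterraBound d (energy d) C) (hD : VolterraBound d (energy d) D) :
    VolterraBound d (pairEnergy d) (SLSpace.block A B C D) := by
  obtain ⟨a, ha, hA⟩ := hA
  obtain ⟨b, hb, hB⟩ := hB
  obtain ⟨c, hc, hC⟩ := hC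
  obtain ⟨e, he, hD⟩ := hD
  refine ⟨2 * (a + b + c + e), by positivity, fun f t => ?_⟩
  have hsplit : ∫ s in Iic t, pairEnergy d s f ∂(volIoo d) =
      (∫ s in Iic t, energy d s f.fst ∂(volIoo d)) + ∫ s in Iic t, energy d s f.snd ∂(volIoo d) :=
    integral_add (integrable_energy d f.fst).integrableOn (integrable_energy d f.snd).integrableOn
  rw [hsplit, pairEnergy, SLSpace.block_fst, SLSpace.block_snd]
  have h1 := energy_add_le d t (A f.fst) (B f.snd)
  have h2 := energy_add_le d t (C f.fst) (D f.snd)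
  have h3 := hA f.fst t
  have h4 := hB f.snd t
  have h5 := hC f.fst t
  have h6 := hD f.snd t
  set I := ∫ s in Iic t, energy d s f.fst ∂(volIoo d)
  set I' := ∫ s in Iic t, energy d s f.snd ∂(volIoo d)
  have hI : 0 ≤ I := integral_nonneg fun _ => energy_nonneg _ _ _
  have hI' : 0 ≤ I' := integral_nonneg fun _ => energy_nonneg _ _ _
  have e1 := mul_nonneg ha hI'
  have e2 := mul_nonneg hb hI
  have e3 := mul_nonneg hc hI'
  have e4 := mul_nonneg he hI
  linarith

theorem VolterraBound.isUnit_one_add_pair {d : ℝ} (hd : 0 ≤ d) {K : SLSpace d →L[ℝ] SLSpace d}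
    (hK : VolterraBound d (pairEnergy d) K) : IsUnit (1 + K) :=
  hK.isUnit_one_add hd (fun t f => add_nonneg (energy_nonneg _ _ _) (energy_nonneg _ _ _))
    (fun t f => by
      rw [SLSpace.norm_sq]; exact add_le_add (energy_le _ _ _) (energy_le _ _ _))
    (fun f => by rw [SLSpace.norm_sq, ← energy_top, ← energy_top])

theorem measurePreserving_reflect (d : ℝ) :
    MeasurePreserving (fun t => d - t) (volIoo d) (volIoo d) := by
  have h := (Measure.measurePreserving_sub_left (volume : Measure ℝ) d).restrict_preimage
    (s := Ioo 0 d) measurableSet_Ioo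
  have h2 : (fun t => d - t) ⁻¹' Ioo 0 d = Ioo 0 d := by
    ext t
    simp only [mem_preimage, mem_Ioo]
    constructor <;> rintro ⟨h1, h2⟩ <;> constructor <;> linarith
  rwa [h2] at h

/-- The reflection `f ↦ f (d - ·)` of `L₂(0, d)`. -/
def reflectL (d : ℝ) : LTwo d →L[ℝ] LTwo d :=
  (Lp.compMeasurePreservingₗᵢ ℝ (fun t => d - t) (measurePreserving_reflect d)).toContinuousLinearMap

theorem reflectL_ae {d : ℝ} (f : LTwo d) {y : ℝ → ℝ} (h : f =ᵐ[volIoo d] y) :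
    reflectL d f =ᵐ[volIoo d] fun t => y (d - t) :=
  (Lp.coeFn_compMeasurePreserving f (measurePreserving_reflect d)).trans
    ((measurePreserving_reflect d).quasiMeasurePreserving.ae_eq_comp h)

theorem reflectL_reflectL {d : ℝ} (f : LTwo d) : reflectL d (reflectL d f) = f := by
  ext1
  refine (reflectL_ae _ (reflectL_ae f (Filter.EventuallyEq.refl _ _))).trans ?_
  simp

/-! ### The transmutation operators -/

/-- The transmutation operators acting on the even and on the odd part of the free solution. -/
theorem exists_transmutation_operators {d : ℝ} (hd : 0 < d) {Q : ℝ → ℝ} (hQm : Measurable Q)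
    (hQ : MemLp Q 2 volume) :
    ∃ KC KS : LTwo d →L[ℝ] LTwo d, VolterraBound d (energy d) KC ∧ VolterraBound d (energy d) KS ∧
      ∀ lam > 0, ∀ (α β : ℝ) (Y : ℝ → ℝ), ContinuousOn Y (Icc 0 d) →
        (∀ t ∈ Icc 0 d, Y t = freeSol lam α β t + duhamel lam Q Y t) →
        ∀ f g y : LTwo d, (f =ᵐ[volIoo d] fun t => α * Real.cos (lam * t)) →
          (g =ᵐ[volIoo d] fun t => β * (Real.sin (lam * t) / lam)) → y =ᵐ[volIoo d] Y →
          y = f + g + (KC f + KS g) := by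
  obtain ⟨P, M, hPm, hPM, hPs, hP⟩ := exists_transmutation_kernel hd hQm hQ
  have hm1 : Measurable fun p : ℝ × ℝ => P (p.1, -p.2) := hPm.comp (by fun_prop)
  have hsupp : ∀ t u : ℝ, t < u → P (t, u) = 0 ∧ P (t, -u) = 0 := by
    intro t u h
    constructor
    · by_contra h1
      have := hPs _ h1
      simp only at this
      linarith
    · by_contra h1
      have := hPs _ h1
      simp only at this
      linarith
  -- Folding the integral over [-t, t] onto [0, t]: the cosine is even and meets P(t, u) + P(t, -u),
  -- while the sine is odd and meets the difference.
  obtain ⟨KC, hKC, hKCV⟩ := exists_kernel_operator (d := d) (k := fun t u => P (t, u) + P (t, -u))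
    (hPm.add hm1) (m := fun _ => 2 * M) (memLp_const _)
    (fun t _ u _ => (abs_add_le _ _).trans (by linarith [hPM (t, u), hPM (t, -u)]))
    (fun t u h => by rw [(hsupp t u h).1, (hsupp t u h).2, add_zero])
  obtain ⟨KS, hKS, hKSV⟩ := exists_kernel_operator (d := d) (k := fun t u => P (t, u) - P (t, -u))
    (hPm.sub hm1) (m := fun _ => 2 * M) (memLp_const _)
    (fun t _ u _ => (abs_sub _ _).trans (by linarith [hPM (t, u), hPM (t, -u)]))
    (fun t u h => by rw [(hsupp t u h).1, (hsupp t u h).2, sub_zero])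
  refine ⟨KC, KS, hKCV, hKSV, fun lam hl α β Y hYc hY f g y hf hg hy => ?_⟩
  ext1
  filter_upwards [hf, hg, hy, hKC f, hKS g, Lp.coeFn_add (f + g) (KC f + KS g), Lp.coeFn_add f g,
    Lp.coeFn_add (KC f) (KS g), ae_restrict_mem measurableSet_Ioo] with t e1 e2 e3 e4 e5 e6 e7 e8 ht
  rw [e6, Pi.add_apply, e7, Pi.add_apply, e8, Pi.add_apply, e1, e2, e3, e4, e5,
    hP lam hl α β Y hYc hY t (Ioo_subset_Icc_self ht), ← freeSol]
  congr 1
  have hPt : Measurable fun ρ => P (t, ρ) := hPm.comp measurable_prodMk_left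
  have hint : ∀ φ : ℝ → ℝ, Continuous φ → ∀ a b, IntervalIntegrable (fun ρ => P (t, ρ) * φ ρ)
      volume a b := fun φ hφ a b => by
    refine IntervalIntegrable.mul_continuousOn ?_ hφ.continuousOn
    rw [intervalIntegrable_iff]
    exact Measure.integrableOn_of_bounded (M := M) (by simp) hPt.aestronglyMeasurable
      (.of_forall fun ρ => hPM _)
  have hyc := continuous_freeSol lam α β
  have hyn : Continuous fun u => freeSol lam α β (-u) := hyc.comp continuous_neg
  have h1 : ∫ ρ, P (t, ρ) * freeSol lam α β ρ = ∫ ρ in (-d)..d, P (t, ρ) * freeSol lam α β ρ := by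
    rw [intervalIntegral.integral_of_le (by linarith)]
    symm
    refine setIntegral_eq_integral_of_forall_compl_eq_zero fun ρ hρ => ?_
    have : P (t, ρ) = 0 := by
      by_contra hne
      obtain ⟨_, _, h3, h4⟩ := hPs _ hne
      simp only at h3 h4
      exact hρ ⟨by linarith [ht.2], by linarith [ht.2]⟩
    rw [this, zero_mul]
  have h2 : ∫ ρ in (-d)..0, P (t, ρ) * freeSol lam α β ρ =
      ∫ u in 0..d, P (t, -u) * freeSol lam α β (-u) := by
    have := intervalIntegral.integral_comp_neg (a := 0) (b := d)
      (fun ρ => P (t, ρ) * freeSol lam α β ρ)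
    rw [this, neg_zero]
  have hint' : ∀ φ : ℝ → ℝ, Continuous φ → IntervalIntegrable (fun u => P (t, -u) * φ u)
      volume 0 d := fun φ hφ => by
    refine IntervalIntegrable.mul_continuousOn ?_ hφ.continuousOn
    rw [intervalIntegrable_iff]
    exact Measure.integrableOn_of_bounded (M := M) (by simp)
      (hPt.comp measurable_neg).aestronglyMeasurable (.of_forall fun ρ => hPM _)
  have hc1 : Continuous fun u => α * Real.cos (lam * u) := by fun_prop
  have hc2 : Continuous fun u => β * (Real.sin (lam * u) / lam) := by fun_prop
  have h3 : ∫ u, (P (t, u) + P (t, -u)) * f u ∂(volIoo d) =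
      ∫ u in 0..d, (P (t, u) + P (t, -u)) * (α * Real.cos (lam * u)) := by
    rw [← integral_volIoo_eq hd]
    exact integral_congr_ae (by filter_upwards [hf] with u hu; rw [hu])
  have h4 : ∫ u, (P (t, u) - P (t, -u)) * g u ∂(volIoo d) =
      ∫ u in 0..d, (P (t, u) - P (t, -u)) * (β * (Real.sin (lam * u) / lam)) := by
    rw [← integral_volIoo_eq hd]
    exact integral_congr_ae (by filter_upwards [hg] with u hu; rw [hu])
  rw [h1, ← intervalIntegral.integral_add_adjacent_intervals (hint _ hyc (-d) 0) (hint _ hyc 0 d),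
    h2, h3, h4, ← intervalIntegral.integral_add (hint' _ hyn)
      (hint _ hyc 0 d), ← intervalIntegral.integral_add]
  · congr 1
    ext u
    simp only [freeSol, mul_neg, Real.cos_neg, Real.sin_neg]
    ring
  · simpa only [add_mul] using (hint _ hc1 0 d).add (hint' _ hc1)
  · simpa only [sub_mul] using (hint _ hc2 0 d).sub (hint' _ hc2)


/-! ### Complex and real solutions -/

theorem LipschitzWith.comp_absolutelyContinuousOnInterval {X Y : Type*} [PseudoMetricSpace X]
    [PseudoMetricSpace Y] {K : NNReal} {g : X → Y} (hg : LipschitzWith K g) {f : ℝ → X} {a b : ℝ}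
    (hf : AbsolutelyContinuousOnInterval f a b) :
    AbsolutelyContinuousOnInterval (fun x => g (f x)) a b := by
  apply squeeze_zero (fun t => ?_) (fun t => ?_) (by simpa using Filter.Tendsto.const_mul (K : ℝ) hf)
  · exact Finset.sum_nonneg fun i _ => dist_nonneg
  · rw [Finset.mul_sum]
    exact Finset.sum_le_sum fun i _ => hg.dist_le_mul _ _

/-- A real-linear map sends solutions with real spectral parameter to solutions. -/
theorem IsSLSolution.map {𝕜 𝕜' : Type*} [RCLike 𝕜] [RCLike 𝕜'] (l : 𝕜 →L[ℝ] 𝕜') {d : ℝ}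
    {q : ℝ → ℝ} {μ : ℝ} {y y' : ℝ → 𝕜} (H : IsSLSolution d q (μ : 𝕜) y y') :
    IsSLSolution d q (μ : 𝕜') (fun x => l (y x)) (fun x => l (y' x)) where
  hasDeriv x hx := l.hasFDerivAt.comp_hasDerivWithinAt x (H.hasDeriv x hx)
  absCont := l.lipschitz.comp_absolutelyContinuousOnInterval H.absCont
  eqn := by
    filter_upwards [H.eqn] with x hx
    have h := l.hasFDerivAt.comp_hasDerivAt x hx
    have e : ((q x : 𝕜) - (μ : 𝕜)) * y x = (q x - μ) • y x := by
      rw [RCLike.real_smul_eq_coe_mul, RCLike.ofReal_sub]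
    rw [e, map_smul, RCLike.real_smul_eq_coe_mul, RCLike.ofReal_sub] at h
    exact h

theorem IsSLSolution.hasSecondDeriv {d μ : ℝ} {q Q y y' : ℝ → ℝ} (H : IsSLSolution d q μ y y')
    (hQ : q =ᵐ[volIoo d] Q) : HasSecondDeriv d (fun x => (Q x - μ) * y x) y y' :=
  ⟨H.hasDeriv, H.absCont, by filter_upwards [H.eqn, hQ] with x h1 h2; rw [← h2]; exact h1⟩

theorem HasSecondDeriv.isSLSolution {d μ : ℝ} {q Q y y' : ℝ → ℝ}
    (H : HasSecondDeriv d (fun x => (Q x - μ) * y x) y y') (hQ : q =ᵐ[volIoo d] Q) :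
    IsSLSolution d q μ y y' :=
  ⟨H.hasDeriv, H.absCont, by
    filter_upwards [H.eqn, hQ] with x h1 h2; rw [← h2] at h1; exact h1⟩

/-- A square integrable function on `(0, d)` agrees almost everywhere with a measurable square
integrable function on the line. -/
theorem exists_measurable_extension {d : ℝ} {q : ℝ → ℝ} (hq : MemLp q 2 (volIoo d)) :
    ∃ Q : ℝ → ℝ, Measurable Q ∧ MemLp Q 2 volume ∧ q =ᵐ[volIoo d] Q := by
  refine ⟨(Ioo 0 d).indicator (hq.aestronglyMeasurable.mk q),
    hq.aestronglyMeasurable.stronglyMeasurable_mk.measurable.indicator measurableSet_Ioo,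
    (memLp_indicator_iff_restrict measurableSet_Ioo).2
      (hq.ae_eq hq.aestronglyMeasurable.ae_eq_mk), ?_⟩
  filter_upwards [hq.aestronglyMeasurable.ae_eq_mk, ae_restrict_mem measurableSet_Ioo] with x h hx
  rw [indicator_of_mem hx, h]

/-! ### Real normalized eigenfunctions and the values of φ₂ -/

section Eigenfunctions

variable {d h₁ h₂ a₁ a₂ : ℝ} {q₁ q₂ Q₁ Q₂ : ℝ → ℝ}

theorem IsSLPair.isSLEigenvalue {y₁ y₁' y₂ y₂' : ℝ → ℝ} {μ : ℝ} (hd : 1 - d = d)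
    (e₁ : q₁ =ᵐ[volIoo d] Q₁) (e₂ : q₂ =ᵐ[volIoo d] Q₂)
    (H : IsSLPair d h₁ h₂ a₁ a₂ (fun x => (Q₁ x - μ) * y₁ x) (fun x => (Q₂ x - μ) * y₂ x)
      y₁ y₁' y₂ y₂') (hne : (∃ x ∈ Icc 0 d, y₁ x ≠ 0) ∨ ∃ x ∈ Icc 0 d, y₂ x ≠ 0) :
    IsSLEigenvalue d q₁ q₂ h₁ h₂ a₁ a₂ (μ : ℂ) := by
  refine ⟨fun x => (y₁ x : ℂ), fun x => (y₁' x : ℂ), fun x => (y₂ x : ℂ), fun x => (y₂' x : ℂ),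
    (H.fst.isSLSolution e₁).map Complex.ofRealCLM, ?_, ?_, ?_, ?_, ?_, ?_⟩
  · rw [hd]
    exact (H.snd.isSLSolution e₂).map Complex.ofRealCLM
  · simp only [H.bc₁]; push_cast; ring
  · simp only [H.bc₂]; push_cast; ring
  · simp only [hd, H.jump]; push_cast; ring
  · simp only [hd]; exact_mod_cast H.jump'
  · rw [hd]; simpa using hne

/-- An eigenvalue has a real eigenfunction, normalized at the outer end of the second interval. -/
theorem IsSLEigenvalue.exists_isSLPair (hd0 : 0 < d) (hd : 1 - d = d) (ha : a₁ ≠ 0)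
    (hQ₁m : Measurable Q₁) (hQ₁ : MemLp Q₁ 2 volume) (hQ₂m : Measurable Q₂)
    (hQ₂ : MemLp Q₂ 2 volume) (e₁ : q₁ =ᵐ[volIoo d] Q₁) (e₂ : q₂ =ᵐ[volIoo d] Q₂) {lam : ℝ}
    (hl : 0 < lam) (H : IsSLEigenvalue d q₁ q₂ h₁ h₂ a₁ a₂ ((lam ^ 2 : ℝ) : ℂ)) :
    ∃ y₁ y₁' y₂ y₂' : ℝ → ℝ, IsSLPair d h₁ h₂ a₁ a₂ (fun x => (Q₁ x - lam ^ 2) * y₁ x)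
      (fun x => (Q₂ x - lam ^ 2) * y₂ x) y₁ y₁' y₂ y₂' ∧ y₂ 0 = 1 := by
  obtain ⟨z₁, z₁', z₂, z₂', H1, H2, b1, b2, j, j', hne⟩ := H
  rw [hd] at H2 j j' hne
  have key : ∀ l : ℂ →L[ℝ] ℝ, IsSLPair d h₁ h₂ a₁ a₂ (fun x => (Q₁ x - lam ^ 2) * l (z₁ x))
      (fun x => (Q₂ x - lam ^ 2) * l (z₂ x)) (fun x => l (z₁ x)) (fun x => l (z₁' x))
      (fun x => l (z₂ x)) (fun x => l (z₂' x)) := by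
    intro l
    have hr : ∀ (c : ℝ) (z : ℂ), l (c * z) = c * l z := fun c z => by
      rw [← Complex.real_smul, map_smul, smul_eq_mul]
    refine ⟨IsSLSolution.hasSecondDeriv (H1.map l) e₁, IsSLSolution.hasSecondDeriv (H2.map l) e₂,
      ?_, ?_, ?_, ?_⟩
    · rw [sub_eq_zero.1 b1, hr]
    · rw [sub_eq_zero.1 b2, hr]
    · rw [j, hr]
    · have := congrArg l j'
      rwa [map_add, map_add, ← Complex.ofReal_inv, hr, hr, map_zero] at this
  -- Otherwise the real and imaginary parts are real solution pairs with vanishing second component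
  -- at 0, so both are zero.
  have h0 : z₂ 0 ≠ 0 := by
    intro h0
    have hre := (key Complex.reCLM).eq_zero hd0 ha hQ₁m hQ₁ hQ₂m hQ₂ hl (by simp [h0])
    have him := (key Complex.imCLM).eq_zero hd0 ha hQ₁m hQ₁ hQ₂m hQ₂ hl (by simp [h0])
    rcases hne with ⟨x, hx, h⟩ | ⟨x, hx, h⟩
    · exact h (Complex.ext (hre.1 x hx) (him.1 x hx))
    · exact h (Complex.ext (hre.2 x hx) (him.2 x hx))
  -- The real-linear functional z ↦ Re(z / z₂(0)) extracts a real eigenfunction and normalizes it at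
  -- once.
  refine ⟨_, _, _, _, key (Complex.reCLM ∘L
    (ContinuousLinearMap.mul ℝ ℂ (z₂ 0)⁻¹)), ?_⟩
  simp [inv_mul_cancel₀ h0]

/-- Uniqueness identifies the values of `slPhi` and `slPhi'`. -/
theorem slPhi_eq (hd : 0 < d) (hQm : Measurable Q₂) (hQ : MemLp Q₂ 2 volume)
    (e : q₂ =ᵐ[volIoo d] Q₂) {lam : ℝ} (hl : 0 < lam) {y y' : ℝ → ℝ}
    (H : HasSecondDeriv d (fun x => (Q₂ x - lam ^ 2) * y x) y y') (h0 : y 0 = 1)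
    (h0' : y' 0 = h₂) {x : ℝ} (hx : x ∈ Icc 0 d) :
    slPhi d q₂ h₂ x lam = y x ∧ slPhi' d q₂ h₂ x lam = y' x := by
  have hex : ∃ p : (ℝ → ℝ) × (ℝ → ℝ), IsSLSolution d q₂ (lam ^ 2) p.1 p.2 ∧ p.1 0 = 1 ∧
      p.2 0 = h₂ := ⟨(y, y'), H.isSLSolution e, h0, h0'⟩
  obtain ⟨H1, h1, h1'⟩ := Classical.epsilon_spec hex
  set p : (ℝ → ℝ) × (ℝ → ℝ) := slPhiPair d q₂ h₂ lam with hp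
  have hp' : p = Classical.epsilon fun p : (ℝ → ℝ) × (ℝ → ℝ) =>
    IsSLSolution d q₂ (lam ^ 2) p.1 p.2 ∧ p.1 0 = 1 ∧ p.2 0 = h₂ := rfl
  rw [← hp'] at H1 h1 h1'
  have H2 := (H1.hasSecondDeriv e).add (H.const_mul (-1))
  have H3 : HasSecondDeriv d (fun x => (Q₂ x - lam ^ 2) * (p.1 x + -1 * y x))
      (fun x => p.1 x + -1 * y x) (fun x => p.2 x + -1 * y' x) :=
    H2.congr (.of_forall fun x => by ring)
  have hz := H3.eq_zero hd hl hQm hQ (by rw [h1, h0]; ring) (by rw [h1', h0']; ring)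
  have hz' := H3.deriv_eq_zero hd hz x hx
  have hz := hz x hx
  rw [slPhi, slPhi', ← hp]
  exact ⟨by linarith, by linarith⟩

end Eigenfunctions


/-! ### Uniform bounds for the normalized eigenfunctions -/

/-- The integral is d/2 + sin(2λd)/(4λ), so the claim is sin(2θ) ≥ -θ for θ = λd. The sine is
nonnegative while 2θ ≤ π, and beyond that θ exceeds 1. -/
theorem quarter_le_integral_cos_sq {d lam : ℝ} (hd : 0 < d) (hl : 0 < lam) :
    d / 4 ≤ ∫ t in 0..d, Real.cos (lam * t) ^ 2 := by
  have hθ : 0 < lam * d := mul_pos hl hd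
  have h : -(lam * d) / 2 ≤ Real.cos (lam * d) * Real.sin (lam * d) := by
    have h2 := Real.sin_two_mul (lam * d)
    rcases le_or_gt (2 * (lam * d)) Real.pi with h | h
    · have := Real.sin_nonneg_of_nonneg_of_le_pi (by positivity) h
      linarith
    · have h3 := Real.neg_one_le_sin (2 * (lam * d))
      have h4 := Real.pi_gt_three
      linarith
  rw [intervalIntegral.integral_comp_mul_left (fun x => Real.cos x ^ 2) hl.ne', integral_cos_sq,
    smul_eq_mul, mul_zero, Real.sin_zero, mul_zero, sub_zero, sub_zero, inv_mul_eq_div,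
    le_div_iff₀ hl]
  linarith

theorem integral_ae_cos {d lam c : ℝ} (hl : lam ≠ 0) {f : LTwo d}
    (hf : f =ᵐ[volIoo d] fun t => c * Real.cos (lam * t)) {t : ℝ} (ht : t ∈ Icc 0 d) :
    ∫ u in 0..t, f u = c * (Real.sin (lam * t) / lam) := by
  have h1 : ∫ u in 0..t, f u = ∫ u in 0..t, c * Real.cos (lam * u) := by
    refine intervalIntegral.integral_congr_ae ?_
    filter_upwards [ae_mem_Ioo_of_volIoo hf ⟨le_rfl, ht.1.trans ht.2⟩ ht] with u h hu
    exact (h hu).1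
  rw [h1, intervalIntegral.integral_const_mul,
    intervalIntegral.integral_comp_mul_left (fun x => Real.cos x) hl, integral_cos]
  simp only [smul_eq_mul, mul_zero, Real.sin_zero, sub_zero, inv_mul_eq_div]

section Bounds

variable {d : ℝ} {Q : ℝ → ℝ}

/-- The solutions with fixed Cauchy data are bounded uniformly in `lam` away from zero, and their
derivatives grow at most linearly in `lam`. -/
theorem exists_bound_of_cauchy_data (hd : 0 < d) (hQm : Measurable Q) (hQ : MemLp Q 2 volume)
    (h : ℝ) {l : ℝ} (hl : 0 < l) :
    ∃ C, ∀ lam, l ≤ lam → ∀ y y' : ℝ → ℝ, HasSecondDeriv d (fun x => (Q x - lam ^ 2) * y x) y y' →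
      y 0 = 1 → y' 0 = h → |y d| ≤ C ∧ |y' d| ≤ C * lam := by
  obtain ⟨P, M, hPm, hPM, hPs, hP⟩ := exists_transmutation_kernel hd hQm hQ
  have hM : 0 ≤ M := (abs_nonneg _).trans (hPM 0)
  set B := 1 + |h| / l with hB
  have hB0 : 0 ≤ B := by positivity
  set C₁ := B + M * B * (2 * d) with hC₁
  have hC₁0 : 0 ≤ C₁ := by positivity
  have hQi : IntervalIntegrable Q volume 0 d :=
    ((locallyIntegrable_of_memLp_two hQ).integrableOn_isCompact isCompact_uIcc).intervalIntegrable
  set I := ∫ x in 0..d, |Q x| with hI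
  have hI0 : 0 ≤ I := intervalIntegral.integral_nonneg hd.le fun _ _ => abs_nonneg _
  -- C₁ bounds y on [0, d]. The bracket bounds y'(d)/λ, where division by l absorbs the terms not
  -- growing with λ.
  refine ⟨C₁ + (|h| / l + 1 + C₁ * I / l), fun lam hlam y y' H h0 h0' => ?_⟩
  have hlam0 : 0 < lam := hl.trans_le hlam
  have hfree : ∀ ρ, |freeSol lam 1 h ρ| ≤ B := fun ρ =>
    (abs_freeSol_le hlam0 _ _ _).trans (by
      rw [abs_one, hB]
      gcongr)
  have hy : ∀ t ∈ Icc 0 d, |y t| ≤ C₁ := by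
    intro t ht
    have h1 := H.eq_duhamel hd hlam0
    rw [h0, h0'] at h1
    rw [hP lam hlam0 1 h y H.continuousOn h1 t ht]
    refine (abs_add_le _ _).trans (add_le_add (hfree t) ?_)
    have h2 : ∫ ρ, P (t, ρ) * freeSol lam 1 h ρ =
        ∫ ρ in Icc (-d) d, P (t, ρ) * freeSol lam 1 h ρ := by
      symm
      refine setIntegral_eq_integral_of_forall_compl_eq_zero fun ρ hρ => ?_
      have : P (t, ρ) = 0 := by
        by_contra hne
        obtain ⟨_, _, h3, h4⟩ := hPs _ hne
        simp only at h3 h4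
        exact hρ ⟨by linarith [ht.2], by linarith [ht.2]⟩
      rw [this, zero_mul]
    rw [h2, ← Real.norm_eq_abs]
    refine (norm_setIntegral_le_of_norm_le_const (C := M * B) (by simp) fun ρ _ => ?_).trans ?_
    · rw [Real.norm_eq_abs, abs_mul]
      exact mul_le_mul (hPM _) (hfree ρ) (abs_nonneg _) hM
    · rw [measureReal_def, Real.volume_Icc, ENNReal.toReal_ofReal (by linarith)]
      exact le_of_eq (by ring)
  have hint : |∫ x in 0..d, Real.cos (lam * (d - x)) * (Q x * y x)| ≤ C₁ * I := by
    rw [hI, ← intervalIntegral.integral_const_mul, ← Real.norm_eq_abs]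
    refine intervalIntegral.norm_integral_le_of_norm_le hd.le (.of_forall fun x hx => ?_)
      (hQi.abs.const_mul C₁)
    rw [Real.norm_eq_abs, abs_mul, abs_mul]
    have := hy x ⟨hx.1.le, hx.2⟩
    calc |Real.cos (lam * (d - x))| * (|Q x| * |y x|) ≤ 1 * (|Q x| * C₁) := by
          gcongr
          exact Real.abs_cos_le_one _
      _ = C₁ * |Q x| := by ring
  have hr : 0 ≤ |h| / l + 1 + C₁ * I / l := by positivity
  have hdm : d ∈ Icc 0 d := ⟨hd.le, le_rfl⟩
  refine ⟨(hy d hdm).trans (by linarith), ?_⟩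
  rw [H.deriv_eq hd ⟨le_rfl, hd.le⟩ hdm, h0, h0']
  have e1 : |h * Real.cos (lam * (d - 0))| ≤ |h| := by
    rw [abs_mul]; exact mul_le_of_le_one_right (abs_nonneg _) (Real.abs_cos_le_one _)
  have e2 : |lam * (1 * Real.sin (lam * (d - 0)))| ≤ lam := by
    rw [one_mul, abs_mul, abs_of_pos hlam0]
    exact mul_le_of_le_one_right hlam0.le (Real.abs_sin_le_one _)
  have e3 : |h| ≤ |h| / l * lam := by
    rw [div_mul_eq_mul_div, le_div_iff₀ hl]
    exact mul_le_mul_of_nonneg_left hlam (abs_nonneg _)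
  have e4 : C₁ * I ≤ C₁ * I / l * lam := by
    rw [div_mul_eq_mul_div, le_div_iff₀ hl]
    exact mul_le_mul_of_nonneg_left hlam (by positivity)
  have e5 := mul_nonneg hC₁0 hlam0.le
  refine (abs_add_le _ _).trans ((add_le_add ((abs_sub _ _).trans (add_le_add e1 e2)) hint).trans ?_)
  nlinarith

/-- The norms of the solutions with initial value one and fixed initial slope are bounded below. -/
theorem exists_norm_lower_bound (hd : 0 < d) (hQm : Measurable Q) (hQ : MemLp Q 2 volume) (h : ℝ) :
    ∃ c > 0, ∀ lam > 0, ∀ y y' : ℝ → ℝ, HasSecondDeriv d (fun x => (Q x - lam ^ 2) * y x) y y' →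
      y 0 = 1 → y' 0 = h → ∀ u : LTwo d, u =ᵐ[volIoo d] y → c ≤ ‖u‖ := by
  obtain ⟨KC, KS, hKC, hKS, hK⟩ := exists_transmutation_operators hd hQm hQ
  obtain ⟨J, hJ, hJV⟩ := exists_integration_operator (d := d)
  -- With f = cos(λt), the sine part h sin(λt)/λ is hJf, so the solution is (1 + hJ + KC + hKSJ)f.
  -- The operator is the same for every λ, and its inverse turns the lower bound for f into one for
  -- the solution.
  obtain ⟨U, hU⟩ := (((hJV.smul h).add hKC).add ((hKS.mul hJV).smul h)).isUnit_one_add_L2 hd.le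
  refine ⟨√(d / 4) / (‖(↑U⁻¹ : LTwo d →L[ℝ] LTwo d)‖ + 1), by positivity,
    fun lam hl y y' H h0 h0' u hu => ?_⟩
  set f : LTwo d := (memLp_const_mul_cos d 1 lam).toLp _ with hf
  have hfe : f =ᵐ[volIoo d] fun t => 1 * Real.cos (lam * t) :=
    (memLp_const_mul_cos d 1 lam).coeFn_toLp
  have hg : (h • J f : LTwo d) =ᵐ[volIoo d] fun t => h * (Real.sin (lam * t) / lam) := by
    filter_upwards [Lp.coeFn_smul h (J f), hJ f, ae_restrict_mem measurableSet_Ioo] with t e1 e2 ht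
    rw [e1, Pi.smul_apply, smul_eq_mul, e2, integral_ae_cos hl.ne' hfe ⟨ht.1.le, ht.2.le⟩, one_mul]
  have h1 := H.eq_duhamel hd hl
  rw [h0, h0'] at h1
  have hu' := hK lam hl 1 h y H.continuousOn h1 f (h • J f) u hfe hg hu
  have hUf : u = (U : LTwo d →L[ℝ] LTwo d) f := by
    rw [hU, hu']
    simp only [add_apply, one_apply_eq_self, map_smul,
      smul_apply, mul_apply_eq_comp]
    abel
  have hf' : f = (↑U⁻¹ : LTwo d →L[ℝ] LTwo d) u := by
    rw [hUf, ← mul_apply_eq_comp, Units.inv_mul, one_apply_eq_self]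
  have hnf : √(d / 4) ≤ ‖f‖ := by
    refine Real.sqrt_le_iff.2 ⟨norm_nonneg _, ?_⟩
    rw [LTwo.norm_sq]
    refine (quarter_le_integral_cos_sq hd hl).trans (le_of_eq ?_)
    rw [← integral_volIoo_eq hd]
    refine integral_congr_ae ?_
    filter_upwards [hfe] with t ht
    rw [ht, one_mul]
  rw [div_le_iff₀ (by positivity)]
  calc √(d / 4) ≤ ‖f‖ := hnf
    _ ≤ ‖(↑U⁻¹ : LTwo d →L[ℝ] LTwo d)‖ * ‖u‖ := by
      conv_lhs => rw [hf']
      exact ContinuousLinearMap.le_opNorm _ _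
    _ ≤ ‖u‖ * (‖(↑U⁻¹ : LTwo d →L[ℝ] LTwo d)‖ + 1) := by
      have := norm_nonneg u
      linarith

end Bounds


/-! ### The operator that maps the eigenfunctions to the trigonometric system -/

/-- Multiplication of pairs by an invertible scalar matrix, preceded by reflection. -/
theorem exists_reflected_mixing (d : ℝ) {a : ℝ} (ha : 0 < a) :
    ∃ M : SLSpace d ≃L[ℝ] SLSpace d, ∀ f,
      (M f).fst = (a + a⁻¹)⁻¹ • (a • reflectL d f.fst - reflectL d f.snd) ∧
      (M f).snd = (a + a⁻¹)⁻¹ • (a⁻¹ • reflectL d f.fst + reflectL d f.snd) := by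
  have hk : a + a⁻¹ ≠ 0 := by positivity
  have ha' := ha.ne'
  refine ⟨ContinuousLinearEquiv.equivOfInverse
    (SLSpace.block (((a + a⁻¹)⁻¹ * a) • reflectL d) ((-(a + a⁻¹)⁻¹) • reflectL d)
      (((a + a⁻¹)⁻¹ * a⁻¹) • reflectL d) ((a + a⁻¹)⁻¹ • reflectL d))
    -- Rows (1, 1) and (-a⁻¹, a), with determinant a + a⁻¹: the leading part of the passage from (g,
    -- f) to the reflected eigenfunction.
    (SLSpace.block (reflectL d) (reflectL d) ((-a⁻¹) • reflectL d) (a • reflectL d))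
    (fun f => ?_) (fun f => ?_), fun f => ⟨?_, ?_⟩⟩
  · refine SLSpace.ext ?_ ?_ <;>
    simp only [SLSpace.block_fst, SLSpace.block_snd, smul_apply, map_add, map_smul,
      reflectL_reflectL] <;> match_scalars <;> field_simp <;> ring
  · refine SLSpace.ext ?_ ?_ <;>
    simp only [SLSpace.block_fst, SLSpace.block_snd, smul_apply, map_add, map_smul,
      reflectL_reflectL] <;> match_scalars <;> field_simp <;> ring
  · rw [ContinuousLinearEquiv.equivOfInverse_apply, SLSpace.block_fst, smul_apply, smul_apply]
    module
  · rw [ContinuousLinearEquiv.equivOfInverse_apply, SLSpace.block_snd, smul_apply, smul_apply]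
    module

section Transform

variable {d h₁ h₂ a₁ a₂ : ℝ} {Q₁ Q₂ : ℝ → ℝ}

/-- One bounded invertible operator maps every eigenfunction to the pair of a sine and a cosine whose
amplitudes are read off from the values of the eigenfunction at the discontinuity. -/
theorem exists_trigonometric_transform (hd : 0 < d) (ha : 0 < a₁) (hQ₁m : Measurable Q₁)
    (hQ₁ : MemLp Q₁ 2 volume) (hQ₂m : Measurable Q₂) (hQ₂ : MemLp Q₂ 2 volume) :
    ∃ T : SLSpace d ≃L[ℝ] SLSpace d, ∀ lam > 0, ∀ (y₁ y₁' y₂ y₂' : ℝ → ℝ)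
      (H : IsSLPair d h₁ h₂ a₁ a₂ (fun x => (Q₁ x - lam ^ 2) * y₁ x)
        (fun x => (Q₂ x - lam ^ 2) * y₂ x) y₁ y₁' y₂ y₂') (v : SLSpace d),
      (v.fst =ᵐ[volIoo d] fun t => 1 / lam * (a₁ * y₂' d + a₂ * y₂ d) * Real.sin (lam * t)) →
      (v.snd =ᵐ[volIoo d] fun t => a₁⁻¹ * y₂ d * Real.cos (lam * t)) → v = T H.vec := by
  obtain ⟨A, B, hA, hB, hAB⟩ := exists_transmutation_operators hd
    (hQ₁m.comp (measurable_const.sub measurable_id)) (memLp_reflect d hQ₁)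
  obtain ⟨C, D, hC, hD, hCD⟩ := exists_transmutation_operators hd
    (hQ₂m.comp (measurable_const.sub measurable_id)) (memLp_reflect d hQ₂)
  obtain ⟨J, hJ, hJV⟩ := exists_integration_operator (d := d)
  obtain ⟨M, hM⟩ := exists_reflected_mixing d ha
  have hk : a₁ + a₁⁻¹ ≠ 0 := by positivity
  have ha' := ha.ne'
  set E : LTwo d →L[ℝ] LTwo d := (-a₁⁻¹) • D with hE
  set F : LTwo d →L[ℝ] LTwo d := a₂ • J + a₁ • C + a₂ • (D * J) with hF
  have hEV : VolterraBound d (energy d) E := hD.smul _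
  have hFV : VolterraBound d (energy d) F := ((hJV.smul _).add (hC.smul _)).add ((hD.mul hJV).smul _)
  set k := (a₁ + a₁⁻¹)⁻¹ with hkdef
  -- U collects what remains after the leading matrix is inverted. E and F are the Volterra parts
  -- acting on g and f in the second reflected component; A and B are those in the first.
  obtain ⟨U, hU⟩ := (((hB.smul (k * a₁)).add (hEV.smul (-k))).block
    ((hA.smul (k * a₁)).add (hFV.smul (-k))) ((hB.smul (k * a₁⁻¹)).add (hEV.smul k))
    ((hA.smul (k * a₁⁻¹)).add (hFV.smul k))).isUnit_one_add_pair hd.le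
  refine ⟨M.trans (ContinuousLinearEquiv.unitsEquiv ℝ _ U⁻¹),
    fun lam hl y₁ y₁' y₂ y₂' H v hg hf => ?_⟩
  suffices h : (U : SLSpace d →L[ℝ] SLSpace d) v = M H.vec by
    change v = (↑U⁻¹ : SLSpace d →L[ℝ] SLSpace d) (M H.vec)
    rw [← h, ← mul_apply_eq_comp, Units.inv_mul, one_apply_eq_self]
  set f := v.snd
  set g := v.fst
  -- The interface conditions express the Cauchy data of y₁ at d by those of y₂, exactly as the
  -- amplitudes in vₙ.
  have hj : y₁ d = a₁⁻¹ * y₂ d := by rw [H.jump]; field_simp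
  have hj' : y₁' d = -(a₁ * y₂' d + a₂ * y₂ d) := by
    have h1 := H.jump'
    rw [hj] at h1
    field_simp at h1
    linarith
  have eq₁ : reflectL d H.vec.fst = f + g + (A f + B g) := by
    refine hAB lam hl (y₁ d) (-y₁' d) _ (continuousOn_reflect H.fst.continuousOn)
      (H.fst.eq_duhamel_reflect hd hl) f g _ ?_ ?_ (reflectL_ae _ H.vec_fst)
    · rw [hj]; exact hf
    · rw [hj']
      filter_upwards [hg] with t ht
      rw [ht]; ring
  -- The slope -y₂'(d) is not itself an amplitude of vₙ: -a₁⁻¹g also contains an a₂ term, which a₂Jf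
  -- cancels because Jf = a₁⁻¹y₂(d) sin(λt)/λ.
  have eq₂ : reflectL d H.vec.snd = a₁ • f + ((-a₁⁻¹) • g + a₂ • J f) +
      (C (a₁ • f) + D ((-a₁⁻¹) • g + a₂ • J f)) := by
    refine hCD lam hl (y₂ d) (-y₂' d) _ (continuousOn_reflect H.snd.continuousOn)
      (H.snd.eq_duhamel_reflect hd hl) _ _ _ ?_ ?_ (reflectL_ae _ H.vec_snd)
    · filter_upwards [Lp.coeFn_smul a₁ f, hf] with t e1 e2
      rw [e1, Pi.smul_apply, smul_eq_mul, e2]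
      field_simp
    · filter_upwards [Lp.coeFn_add ((-a₁⁻¹) • g) (a₂ • J f), Lp.coeFn_smul (-a₁⁻¹) g,
        Lp.coeFn_smul a₂ (J f), hg, hJ f, ae_restrict_mem measurableSet_Ioo] with t e1 e2 e3 e4 e5 ht
      rw [e1, Pi.add_apply, e2, e3, Pi.smul_apply, Pi.smul_apply, smul_eq_mul, smul_eq_mul, e4, e5,
        integral_ae_cos hl.ne' hf ⟨ht.1.le, ht.2.le⟩]
      field_simp
      ring
  have hkk : k * a₁ + k * a₁⁻¹ = 1 := by rw [hkdef, ← mul_add, inv_mul_cancel₀ hk]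
  rw [hU, add_apply, one_apply_eq_self]
  refine SLSpace.ext ?_ ?_
  · rw [(hM _).1, eq₁, eq₂]
    change g + (((k * a₁) • B + (-k) • E) g + ((k * a₁) • A + (-k) • F) f) = _
    simp only [hE, hF, add_apply, smul_apply, mul_apply_eq_comp, map_add, map_smul]
    have : g = (k * a₁ + k * a₁⁻¹) • g := by rw [hkk, one_smul]
    conv_lhs => enter [1]; rw [this]
    module
  · rw [(hM _).2, eq₁, eq₂]
    change f + (((k * a₁⁻¹) • B + k • E) g + ((k * a₁⁻¹) • A + k • F) f) = _
    simp only [hE, hF, add_apply, smul_apply, mul_apply_eq_comp, map_add, map_smul]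
    have : f = (k * a₁ + k * a₁⁻¹) • f := by rw [hkk, one_smul]
    conv_lhs => enter [1]; rw [this]
    module

end Transform

/-! ### Norm bounds for trigonometric pairs -/

theorem LTwo.norm_le_of_ae_bound {d C : ℝ} (hC : 0 ≤ C) {f : LTwo d}
    (hf : ∀ᵐ x ∂(volIoo d), |f x| ≤ C) :
    ‖f‖ ≤ (measureUnivNNReal (volIoo d) : ℝ) ^ (2 : ℝ)⁻¹ * C := by
  simpa using Lp.norm_le_of_ae_bound (f := f) hC hf

theorem SLSpace.norm_le {d : ℝ} (f : SLSpace d) : ‖f‖ ≤ ‖f.fst‖ + ‖f.snd‖ := by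
  refine (sq_le_sq₀ (norm_nonneg _) (by positivity)).1 ?_
  rw [SLSpace.norm_sq]
  nlinarith [mul_nonneg (norm_nonneg f.fst) (norm_nonneg f.snd)]

theorem SLSpace.norm_snd_le {d : ℝ} (f : SLSpace d) : ‖f.snd‖ ≤ ‖f‖ := by
  refine (sq_le_sq₀ (norm_nonneg _) (norm_nonneg _)).1 ?_
  rw [SLSpace.norm_sq]
  linarith [sq_nonneg ‖f.fst‖]

/-- The trigonometric systems with bounded amplitudes are bounded. -/
theorem exists_norm_le_of_trigonometric (d : ℝ) {C : ℝ} (hC : 0 ≤ C) :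
    ∃ C', ∀ (lam α β : ℝ) (v : SLSpace d), |α| ≤ C → |β| ≤ C →
      (v.fst =ᵐ[volIoo d] fun t => α * Real.sin (lam * t)) →
      (v.snd =ᵐ[volIoo d] fun t => β * Real.cos (lam * t)) → ‖v‖ ≤ C' := by
  refine ⟨_, fun lam α β v hα hβ h1 h2 => (SLSpace.norm_le v).trans
    (add_le_add (LTwo.norm_le_of_ae_bound hC ?_) (LTwo.norm_le_of_ae_bound hC ?_))⟩
  · filter_upwards [h1] with t ht
    rw [ht, abs_mul]
    exact (mul_le_of_le_one_right (abs_nonneg _) (Real.abs_sin_le_one _)).trans hα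
  · filter_upwards [h2] with t ht
    rw [ht, abs_mul]
    exact (mul_le_of_le_one_right (abs_nonneg _) (Real.abs_cos_le_one _)).trans hβ

end
-- The Riesz basis property
theorem theorem2p1 (q₁ q₂ : ℝ → ℝ)
    (hq₁ : MemLp q₁ 2 (volume.restrict (Ioo 0 (1 / 2))))
    (hq₂ : MemLp q₂ 2 (volume.restrict (Ioo 0 (1 / 2))))
    (h₁ h₂ a₁ a₂ : ℝ) (ha₁ : 0 < a₁)
    (lam : ℕ → ℝ) (hpos : ∀ n, 0 < lam n) (hmono : StrictMono lam)
    (hlam : ∀ μ : ℝ,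
      IsSLEigenvalue (1 / 2) q₁ q₂ h₁ h₂ a₁ a₂ (μ : ℂ) ↔ ∃ n, μ = lam n ^ 2) :
    IsRieszBasis ℝ (fun n : ℕ => slVec (1 / 2) q₂ h₂ a₁ a₂ (lam n)) := by
  -- Of the value 1/2 only d > 0 and 1 - d = d are used: both intervals have the same length.
  obtain ⟨d, hd⟩ : ∃ d : ℝ, d = 1 / 2 := ⟨_, rfl⟩
  rw [← hd] at hq₁ hq₂ hlam ⊢
  have hd1 : 1 - d = d := by rw [hd]; norm_num
  have hd0 : 0 < d := by rw [hd]; norm_num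
  clear hd
  obtain ⟨Q₁, hQ₁m, hQ₁, e₁⟩ := exists_measurable_extension hq₁
  obtain ⟨Q₂, hQ₂m, hQ₂, e₂⟩ := exists_measurable_extension hq₂
  choose Y₁ Y₁' Y₂ Y₂' HY hY using fun n => ((hlam (lam n ^ 2)).2 ⟨n, rfl⟩).exists_isSLPair hd0 hd1
    ha₁.ne' hQ₁m hQ₁ hQ₂m hQ₂ e₁ e₂ (hpos n)
  have hY' : ∀ n, Y₂' n 0 = h₂ := fun n => by rw [(HY n).bc₂, hY, mul_one]
  have hdm : d ∈ Icc 0 d := ⟨hd0.le, le_rfl⟩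
  have hφ := fun n => slPhi_eq hd0 hQ₂m hQ₂ e₂ (hpos n) (HY n).snd (hY n) (hY' n) hdm
  obtain ⟨horth, hcompl⟩ := eigenfunctions_orthogonal_complete hd0 ha₁.ne' hQ₁m hQ₁ hQ₂m hQ₂ hpos
    hmono (fun μ y₁ y₁' y₂ y₂' H hne => (hlam μ).1 (H.isSLEigenvalue hd1 e₁ e₂ hne)) HY hY
  obtain ⟨T, hT⟩ := exists_trigonometric_transform (h₁ := h₁) (h₂ := h₂) (a₂ := a₂) hd0 ha₁ hQ₁m hQ₁
    hQ₂m hQ₂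
  have hfst : ∀ n, (slVec d q₂ h₂ a₁ a₂ (lam n)).fst =ᵐ[volIoo d] fun t =>
      1 / lam n * (a₁ * Y₂' n d + a₂ * Y₂ n d) * Real.sin (lam n * t) := fun n => by
    rw [← (hφ n).1, ← (hφ n).2]
    have h := (memLp_const_mul_sin d (1 / lam n * (a₁ * slPhi' (1 - d) q₂ h₂ (1 - d) (lam n)
      + a₂ * slPhi (1 - d) q₂ h₂ (1 - d) (lam n))) (lam n)).coeFn_toLp
    simp only [hd1] at h
    unfold slVec
    simp only [hd1]
    exact h
  have hsnd : ∀ n, (slVec d q₂ h₂ a₁ a₂ (lam n)).snd =ᵐ[volIoo d] fun t =>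
      a₁⁻¹ * Y₂ n d * Real.cos (lam n * t) := fun n => by
    rw [← (hφ n).1]
    have h := (memLp_const_mul_cos d (a₁⁻¹ * slPhi (1 - d) q₂ h₂ (1 - d) (lam n))
      (lam n)).coeFn_toLp
    simp only [hd1] at h
    unfold slVec
    simp only [hd1]
    exact h
  have hv : ∀ n, slVec d q₂ h₂ a₁ a₂ (lam n) = T (HY n).vec := fun n =>
    hT (lam n) (hpos n) _ _ _ _ (HY n) _ (hfst n) (hsnd n)
  -- The eigenvalues increase, so λ₀ is the positive lower bound that makes the estimates uniform in
  -- n.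
  obtain ⟨C, hC⟩ := exists_bound_of_cauchy_data hd0 hQ₂m hQ₂ h₂ (hpos 0)
  obtain ⟨c, hc, hlow⟩ := exists_norm_lower_bound hd0 hQ₂m hQ₂ h₂
  have hb := fun n => hC (lam n) (hmono.monotone (Nat.zero_le n)) _ _ (HY n).snd (hY n) (hY' n)
  have hC0 : 0 ≤ C := (abs_nonneg _).trans (hb 0).1
  obtain ⟨C', hC'⟩ := exists_norm_le_of_trigonometric d
    (C := a₁ * C + |a₂| * C / lam 0 + a₁⁻¹ * C) (by have := hpos 0; positivity)
  -- The factor 1/λₙ in the first amplitude offsets the linear growth of φ₂'(d, λₙ), so the vₙ are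
  -- bounded; T⁻¹ transfers this to the eigenfunctions.
  have hup : ∀ n, ‖(HY n).vec‖ ≤ ‖(T.symm : SLSpace d →L[ℝ] SLSpace d)‖ * C' := fun n => by
    have h0 := hpos 0
    have hn := hpos n
    have h1 : ‖slVec d q₂ h₂ a₁ a₂ (lam n)‖ ≤ C' := by
      refine hC' _ _ _ _ ?_ ?_ (hfst n) (hsnd n)
      · have e1 : |a₁ * Y₂' n d + a₂ * Y₂ n d| ≤ a₁ * (C * lam n) + |a₂| * C := by
          refine (abs_add_le _ _).trans ?_
          rw [abs_mul, abs_mul, abs_of_pos ha₁]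
          have := hb n
          gcongr
          · exact this.2
          · exact this.1
        have e2 : |a₂| * C / lam n ≤ |a₂| * C / lam 0 := by
          have := hmono.monotone (Nat.zero_le n)
          gcongr
        have e3 : 0 ≤ a₁⁻¹ * C := by positivity
        rw [abs_mul, abs_of_pos (by positivity), one_div, inv_mul_eq_div]
        calc _ ≤ (a₁ * (C * lam n) + |a₂| * C) / lam n := by gcongr
          _ = a₁ * C + |a₂| * C / lam n := by field_simp
          _ ≤ _ := by linarith
      · rw [abs_mul, abs_of_pos (by positivity)]
        have e1 : a₁⁻¹ * |Y₂ n d| ≤ a₁⁻¹ * C := by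
          have := (hb n).1
          gcongr
        have e2 : 0 ≤ a₁ * C + |a₂| * C / lam 0 := by positivity
        linarith
    calc ‖(HY n).vec‖ = ‖(T.symm : SLSpace d →L[ℝ] SLSpace d) (slVec d q₂ h₂ a₁ a₂ (lam n))‖ := by
          rw [hv n, ContinuousLinearEquiv.coe_coe, T.symm_apply_apply]
      _ ≤ _ := ContinuousLinearMap.le_opNorm_of_le _ h1
  -- The second component alone bounds the norm from below, since it is the one normalized at 0.
  have hlow' : ∀ n, c ≤ ‖(HY n).vec‖ := fun n =>
    (hlow (lam n) (hpos n) _ _ (HY n).snd (hY n) (hY' n) _ (HY n).vec_snd).trans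
      (SLSpace.norm_snd_le _)
  rw [funext hv]
  exact isRieszBasis_of_orthogonal horth hcompl hc hlow' hup T
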